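/- Let $V(x)=\sum_m g_m x^m$ be a real polynomial of degree $d$ such that $x\mapsto V(x^2)$ is uniformly convex on $\mathbb R$, and let $\beta\ge 1$, $a>-1$. For $n\ge 1$ and variables $x=(x_1,\dots,x_n)$, $y=(y_1,\dots,y_{n-1})$ let $B=B(x,y)$ be the $n\times n$ lower bidiagonal matrix with $B_{i,i}=x_i$, $B_{i+1,i}=-y_i$, and $$H(x,y)=\operatorname{tr}V(BB^T)-\sum_{k=1}^n\Big(\frac kn+\frac an-\frac1{n\beta}\Big)\log x_k-\sum_{k=1}^{n-1}\Big(\frac kn-\frac1{n\beta}\Big)\log y_k .$$ All variables range over $(0,\infty)$, except that a variable whose logarithm has coefficient $0$ (such as $y_1$ when $\beta=1$) ranges over $[0,\infty)$. Let $(x^o,y^o)$ denote the minimizer of $H$. For an interval of indices $I=[i_0,i_1]\subset[1,n]$ put $\partial I=([i_0-d,i_0-1]\cup[i_1+1,i_1+d])\cap[1,n]$. Given real values $q$ for the variables with index in $\partial I$, let $H_q$ be $H$ as a function of the variables with index in $I$, those with index in $\partial I$ being set equal to $q$ (terms not involving the variables in $I$ are dropped), and let $(x^q,y^q)$ denote its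 minimizer. Write $\|\cdot\|_{\infty,\partial I}$ for the maximum of the absolute values over all variables with index in $\partial I$ ($0$ if there are none); terms in $y_n$ below are absent. For $t>0$ let $\phi(t)>0$ be the solution of $t=\sum_{m=1}^d m\binom{2m}{m}g_m\phi(t)^{2m}$, let $x_1(t),y_1(t)$ be given by $$x_1(t)-y_1(t)=\Big(a+\tfrac12\Big)\Big(\int_0^t\frac{du}{\phi(u)}\Big)^{-1}-\frac{\phi'(t)}2,\qquad x_1(t)+y_1(t)=\Big(a-\frac2\beta\Big)\phi'(t),$$ and define the fine minimizer by $x^\bullet_i=\phi(i/n)+x_1(i/n)/n$, $y^\bullet_i=\phi(i/n)+y_1(i/n)/n$. Then for every $c'$ there is a constant $c=c(V,\beta,a,c')>0$ such that the following hold for all $n\ge1$, all $I=[i_0,i_1]\subset[1,n]$ and all $q$ with $\|q\|_{\infty,\partial I}\le c'$. 1. If $1+a-1/\beta\ge 0$, then $(x^o,y^o)$ exists and is unique. If $1+a-1/\beta\ge0$ or $i_0\ge2$, then $(x^q,y^q)$ exists and is unique. 2. Whenever $(x^o,y^o)$ and $(x^q,y^q)$ are minimizers as above, for every $i\in I$,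 $$|x_i^q-x_i^o|+|y_i^q-y_i^o|\le c\,\|q-(x^o,y^o)\|_{\infty,\partial I}\,e^{-\mathrm{dist}(i,\partial I)/c}.$$ 3. If $I\subset[1,n-d]$ and $(x^q,y^q)$ is a minimizer as above, then for every $i\in I$, $$|x_i^q-x^\bullet_i|+|y_i^q-y^\bullet_i|\le c\,\max\Big(\frac1{\sqrt{n\,i_0^3}},\ \|q-(x^\bullet,y^\bullet)\|_{\infty,\partial I}\,e^{-\mathrm{dist}(i,\partial I)/c}\Big).$$ -/

import Mathlib

open Polynomial

noncomputable section

namespace HardEdge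

/-- The coordinates of the Hamiltonian on `[1, n]`: `Sum.inl k` stands for `x_{k+1}` and
`Sum.inr k` for `y_{k+1}`; there are `n` variables `x` and `n - 1` variables `y`. -/
abbrev Coord (n : ℕ) : Type := Fin n ⊕ Fin (n - 1)

/-- The index (in `[1, n]`) of a coordinate. -/
def site {n : ℕ} : Coord n → ℕ
  | Sum.inl k => (k : ℕ) + 1
  | Sum.inr k => (k : ℕ) + 1

/-- Values of all the variables `(x_1, …, x_n, y_1, …, y_{n-1})`. -/
abbrev Config (n : ℕ) : Type := Coord n → ℝ

/-- Values of those variables whose index lies in `S`. Its norm is the sup norm. -/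
abbrev Values (n : ℕ) (S : Finset ℕ) : Type := {k : Coord n // site k ∈ S} → ℝ

/-- The restriction of a configuration to the indices in `S`. -/
def restrict {n : ℕ} (z : Config n) (S : Finset ℕ) : Values n S := fun k => z k.1

/-- The lower bidiagonal matrix `B(x, y)`, with `B_{i,i} = x_i` and `B_{i+1,i} = -y_i`. -/
def bidiag {n : ℕ} (z : Config n) : Matrix (Fin n) (Fin n) ℝ :=
  Matrix.of fun i j =>
    if i = j then z (Sum.inl i)
    else if h : (i : ℕ) = (j : ℕ) + 1 then - z (Sum.inr ⟨(j : ℕ), by omega⟩)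
    else 0

/-- `tr V(B Bᵀ)`. -/
def potential {n : ℕ} (V : ℝ[X]) (z : Config n) : ℝ :=
  (aeval (bidiag z * (bidiag z).transpose) V).trace

/-- The coefficient of `- log` of a coordinate in the Hamiltonian:
`k/n + a/n - 1/(nβ)` for `x_k` and `k/n - 1/(nβ)` for `y_k`. -/
def weight {n : ℕ} (β a : ℝ) : Coord n → ℝ
  | Sum.inl k => ((k : ℕ) + 1 : ℝ) / n + a / n - 1 / (n * β)
  | Sum.inr k => ((k : ℕ) + 1 : ℝ) / n - 1 / (n * β)

/-- The Hamiltonian `H(x, y)`. -/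
def hamiltonian {n : ℕ} (V : ℝ[X]) (β a : ℝ) (z : Config n) : ℝ :=
  potential V z - ∑ k, weight β a k * Real.log (z k)

/-- A coordinate ranges over the positive reals; when its logarithm does not occur in the
Hamiltonian (its weight is `0`, as for `y_1` when `β = 1`), the value `0` is allowed too. -/
def Admissible {n : ℕ} (β a : ℝ) (k : Coord n) (r : ℝ) : Prop :=
  0 < r ∨ (weight β a k = 0 ∧ r = 0)

/-- `z = (x^o, y^o)` minimizes the Hamiltonian. -/
def IsMinimizer {n : ℕ} (V : ℝ[X]) (β a : ℝ) (z : Config n) : Prop :=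
  (∀ k, Admissible β a k (z k)) ∧
    ∀ w : Config n, (∀ k, Admissible β a k (w k)) →
      hamiltonian V β a z ≤ hamiltonian V β a w

/-- The boundary `∂I` of `I = [i₀, i₁]`: the indices in `[1, n]` among the `d` indices to the left
of `I` and the `d` indices to its right. -/
def boundary (n d i₀ i₁ : ℕ) : Finset ℕ :=
  (Finset.Icc 1 n).filter fun j => (j < i₀ ∧ i₀ ≤ j + d) ∨ (i₁ < j ∧ j ≤ i₁ + d)

/-- The configuration equal to `u` on `I = [i₀, i₁]` and to `q` on `∂I`. The remaining variables,
which are set to `0`, have no monomial in common with those in `I` when `d = deg V`. -/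
def glue {n d i₀ i₁ : ℕ} (q : Values n (boundary n d i₀ i₁))
    (u : Values n (Finset.Icc i₀ i₁)) : Config n := fun k =>
  if h : site k ∈ Finset.Icc i₀ i₁ then u ⟨k, h⟩
  else if h' : site k ∈ boundary n d i₀ i₁ then q ⟨k, h'⟩
  else 0

/-- The conditional Hamiltonian `H_q` on `I = [i₀, i₁]`, as a function of the variables with index
in `I`. Summands that do not involve these variables are irrelevant, and the logarithms of the
prescribed values are left out. -/
def condHamiltonian {n i₀ i₁ : ℕ} (V : ℝ[X]) (β a : ℝ)
    (q : Values n (boundary n V.natDegree i₀ i₁)) (u : Values n (Finset.Icc i₀ i₁)) : ℝ :=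
  potential V (glue q u) - ∑ k, weight β a k.1 * Real.log (u k)

/-- `u = (x^q, y^q)` minimizes the conditional Hamiltonian `H_q`. -/
def IsCondMinimizer {n i₀ i₁ : ℕ} (V : ℝ[X]) (β a : ℝ)
    (q : Values n (boundary n V.natDegree i₀ i₁)) (u : Values n (Finset.Icc i₀ i₁)) : Prop :=
  (∀ k, Admissible β a k.1 (u k)) ∧
    ∀ w : Values n (Finset.Icc i₀ i₁), (∀ k, Admissible β a k.1 (w k)) →
      condHamiltonian V β a q u ≤ condHamiltonian V β a q w

/-- `∑_m m (2m choose m) g_m s^{2m}` for `V(x) = ∑_m g_m x^m`. -/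
def coarse (V : ℝ[X]) (s : ℝ) : ℝ :=
  ∑ m ∈ Finset.Icc 1 V.natDegree, (m : ℝ) * ((2 * m).choose m : ℝ) * V.coeff m * s ^ (2 * m)

/-- `φ(t)`, the unique nonnegative `s` with `t = ∑_m m (2m choose m) g_m s^{2m}`
(for `t ≥ 0`, the infimum is over a one-point set). -/
def phi (V : ℝ[X]) (t : ℝ) : ℝ := sInf {s : ℝ | 0 ≤ s ∧ t = coarse V s}

/-- `x_1(t) - y_1(t)`. -/
def corrDiff (V : ℝ[X]) (a t : ℝ) : ℝ :=
  (a + 1 / 2) * (∫ u in (0 : ℝ)..t, 1 / phi V u)⁻¹ - deriv (phi V) t / 2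

/-- `x_1(t) + y_1(t)`. -/
def corrSum (V : ℝ[X]) (β a t : ℝ) : ℝ := (a - 2 / β) * deriv (phi V) t

/-- The correction `x_1(t)`. -/
def corrX (V : ℝ[X]) (β a t : ℝ) : ℝ := (corrSum V β a t + corrDiff V a t) / 2

/-- The correction `y_1(t)`. -/
def corrY (V : ℝ[X]) (β a t : ℝ) : ℝ := (corrSum V β a t - corrDiff V a t) / 2

/-- The fine minimizer, `φ(i/n) + x_1(i/n)/n` in the `x`-variables and
`φ(i/n) + y_1(i/n)/n` in the `y`-variables. -/
def fine (n : ℕ) (V : ℝ[X]) (β a : ℝ) : Config n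
  | Sum.inl k =>
      phi V (((k : ℕ) + 1 : ℝ) / n) + corrX V β a (((k : ℕ) + 1 : ℝ) / n) / n
  | Sum.inr k =>
      phi V (((k : ℕ) + 1 : ℝ) / n) + corrY V β a (((k : ℕ) + 1 : ℝ) / n) / n

/-- `|x_i - x'_i| + |y_i - y'_i|` for `i ∈ I = [i₀, i₁]`, where `(x, y) = u` is given on `I` and
`(x', y') = z` everywhere; for `i = n` there is no `y`-term. -/
def deviation {n i₀ i₁ : ℕ} (u : Values n (Finset.Icc i₀ i₁)) (z : Config n) (i : ℕ) : ℝ :=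
  ∑ k : {k : Coord n // site k ∈ Finset.Icc i₀ i₁}, if site k.1 = i then |u k - z k.1| else 0

/-- The distance of the index `i` to `∂I`. -/
def distBoundary (n d i₀ i₁ i : ℕ) : ℝ :=
  Metric.infDist i (boundary n d i₀ i₁ : Set ℕ)

end HardEdge

end

/-! Let `J` be the symmetric matrix with off-diagonal blocks `B` and `Bᵀ`. Ordering rows and columns
alternately makes it a Jacobi matrix with zero diagonal, whose entries along the chain are `x₁, -y₁,
x₂, -y₂, …`, and `tr V(BBᵀ) = tr V(J²) / 2`. Writing two such matrices in their eigenbases turns the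
scalar inequality for the derivative of `V(x²)` into strong monotonicity of the gradient of the
potential (`mul_trace_sub_sq_le`, `grad_strongMono`). The logarithms only help: at a minimizer each
variable times its partial derivative equals the weight, both factors being nonnegative, and two
solutions of such an equation vary in opposite directions (`sub_mul_sub_nonpos`). This form also
covers a variable of weight zero that sits at `0`. Existence follows from coercivity, uniqueness
from monotonicity.

The partial derivatives of the potential are weighted sums over short walks on the chain
(`jacobi_pow_apply`, `trace_aeval_jacobi_mul`). Hence the Hessian is banded, and by the a priori
bound `exists_bound` its entries are bounded uniformly in `n`. Banded, uniformly positive systems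
have exponentially decaying solutions (`exists_combesThomas`); `exists_comparison` is the nonlinear
version, which tolerates a residual `η` in the equations. With `η = 0` it gives the second claim.

The third claim uses the same comparison with `η` the residual of the fine minimizer. The residual
is computed in terms of the squares of the variables, since `φ²` is regular up to `t = 0` while `φ`
behaves like `√t`. Near a given site the squares are `φ²` plus `1/n` times a sum of a linear, a
constant and an alternating profile. By symmetry the linear one has no effect on the force; the
constant one brings in the derivative of the coarse polynomial `h`, and the alternating one brings
in a polynomial `b` with `∫₀ᵗ du/φ = 2 φ b(φ²)`. Both are at least `κ`, because central binomial
coefficients are moments of `4 sin²`. The given `x₁(t)`, `y₁(t)` solve the resulting equation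
exactly (`localCorr_equation`). What remains is `O(1/(n i))`, and division by the variable itself,
which is of order `√(i/n)`, yields `1/√(n i³)`. -/

namespace HardEdge

/-! ### Weighted walk counts and their first and second order expansions. -/

/-- The weighted number of walks on `ℤ` from `v` that make `j` steps, of which `a` are upward, where
an upward step from `u` has weight `r u` and downward steps have weight `1`. -/
def walk (r : ℤ → ℝ) (v : ℤ) : ℕ → ℕ → ℝ
  | 0, 0 => 1
  | 0, _ + 1 => 0
  | j + 1, 0 => walk r v j 0
  -- Recursion on the last step: after `j` steps, `a` of them upward, the walk stands at `v - j + 2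
  -- * a`.
  | j + 1, a + 1 => r (v - j + 2 * a) * walk r v j a + walk r v j (a + 1)

/-- The derivative of `walk` at `r` in the direction `ε`. -/
def dwalk (r ε : ℤ → ℝ) (v : ℤ) : ℕ → ℕ → ℝ
  | 0, _ => 0
  | j + 1, 0 => dwalk r ε v j 0
  | j + 1, a + 1 => ε (v - j + 2 * a) * walk r v j a + r (v - j + 2 * a) * dwalk r ε v j a +
      dwalk r ε v j (a + 1)

/-- The window consists of the edges that the recursion evaluates. It is larger than the range of
actual walks, since the recursion also passes through vanishing terms with more upward steps than
steps. -/
theorem walk_congr {r r' : ℤ → ℝ} {v : ℤ} (j a : ℕ)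
    (h : ∀ e : ℤ, v - j < e → e < v + 2 * a → r e = r' e) : walk r v j a = walk r' v j a := by
  induction j generalizing a with
  | zero => cases a <;> rfl
  | succ j ih =>
    cases a with
    | zero =>
      simp only [walk]
      exact ih 0 fun e h1 h2 => h e (by push_cast; linarith) h2
    | succ a =>
      simp only [walk]
      rw [ih a fun e h1 h2 => h e (by push_cast; linarith) (by push_cast; linarith),
        ih (a + 1) fun e h1 h2 => h e (by push_cast; linarith) h2]
      rw [h (v - j + 2 * a) (by push_cast; linarith [Int.natCast_nonneg a])
        (by push_cast; linarith [Int.natCast_nonneg j])]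

theorem walk_nonneg {r : ℤ → ℝ} (hr : ∀ e, 0 ≤ r e) (v : ℤ) (j a : ℕ) : 0 ≤ walk r v j a := by
  induction j generalizing a with
  | zero => cases a <;> simp [walk]
  | succ j ih =>
    cases a with
    | zero => exact ih 0
    | succ a => exact add_nonneg (mul_nonneg (hr _) (ih a)) (ih (a + 1))

theorem walk_le {r : ℤ → ℝ} {M : ℝ} (hr : ∀ e, 0 ≤ r e) (hM : ∀ e, r e ≤ M) (v : ℤ) (j a : ℕ) :
    walk r v j a ≤ 2 ^ j * M ^ a := by
  have hM0 : 0 ≤ M := (hr 0).trans (hM 0)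
  induction j generalizing a with
  | zero => cases a <;> simp [walk]; positivity
  | succ j ih =>
    cases a with
    | zero =>
      refine (ih 0).trans ?_
      simp only [pow_zero, mul_one]
      exact pow_le_pow_right₀ (by norm_num) (by omega)
    | succ a =>
      have h1 : r (v - j + 2 * a) * walk r v j a ≤ M * (2 ^ j * M ^ a) :=
        mul_le_mul (hM _) (ih a) (walk_nonneg hr _ _ _) hM0
      have h2 := ih (a + 1)
      calc walk r v (j + 1) (a + 1) ≤ M * (2 ^ j * M ^ a) + 2 ^ j * M ^ (a + 1) := add_le_add h1 h2
        _ = 2 ^ (j + 1) * M ^ (a + 1) := by ring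

/-- The walk that crosses the edge `p` back and forth, starting downward, already contributes `r p ^
m`. -/
theorem pow_le_walk {r : ℤ → ℝ} (hr : ∀ e, 0 ≤ r e) (p : ℤ) (m : ℕ) :
    r p ^ m ≤ walk r (p + 1) (2 * m + 1) m := by
  induction m with
  | zero => simp [walk]
  | succ m ih =>
    have h1 : walk r (p + 1) (2 * m + 2) (m + 1) ≤ walk r (p + 1) (2 * (m + 1) + 1) (m + 1) := by
      change _ ≤ r _ * walk r _ _ _ + walk r _ _ _
      exact le_add_of_nonneg_left (mul_nonneg (hr _) (walk_nonneg hr _ _ _))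
    refine le_trans ?_ h1
    change _ ≤ r _ * walk r _ _ _ + walk r _ _ _
    have h2 : (p + 1 - ((2 * m + 1 : ℕ) : ℤ) + 2 * m) = p := by push_cast; ring
    rw [h2, pow_succ']
    exact (mul_le_mul_of_nonneg_left ih (hr p)).trans
      (le_add_of_nonneg_right (walk_nonneg hr _ _ _))

theorem abs_walk_le {r : ℤ → ℝ} {M : ℝ} {v : ℤ} (hM : 0 ≤ M) (j a : ℕ)
    (h : ∀ e : ℤ, v - j < e → e < v + 2 * a → |r e| ≤ M) : |walk r v j a| ≤ (1 + M) ^ j := by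
  induction j generalizing a with
  | zero => cases a <;> simp [walk]
  | succ j ih =>
    cases a with
    | zero =>
      refine (ih 0 fun e h1 h2 => h e (by push_cast; linarith) h2).trans ?_
      exact pow_le_pow_right₀ (by linarith) (by omega)
    | succ a =>
      have h1 := ih a fun e h1 h2 => h e (by push_cast; linarith) (by push_cast; linarith)
      have h2 := ih (a + 1) fun e h1 h2 => h e (by push_cast; linarith) h2
      have h3 := h (v - j + 2 * a) (by push_cast; linarith [Int.natCast_nonneg a])
          (by push_cast; linarith [Int.natCast_nonneg j])
      simp only [walk]
      calc _ ≤ |r (v - j + 2 * a)| * |walk r v j a| + |walk r v j (a + 1)| := by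
            rw [← abs_mul]; exact abs_add_le _ _
        _ ≤ M * (1 + M) ^ j + (1 + M) ^ j := by gcongr
        _ = (1 + M) ^ (j + 1) := by ring

theorem abs_dwalk_le {r ε : ℤ → ℝ} {M η : ℝ} {v : ℤ} (hM : 0 ≤ M) (hη : 0 ≤ η) (j a : ℕ)
    (h : ∀ e : ℤ, v - j < e → e < v + 2 * a → |r e| ≤ M)
    (h' : ∀ e : ℤ, v - j < e → e < v + 2 * a → |ε e| ≤ η) :
    |dwalk r ε v j a| ≤ j * (1 + M) ^ j * η := by
  induction j generalizing a with
  | zero => simp [dwalk]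
  | succ j ih =>
    cases a with
    | zero =>
      refine (ih 0 (fun e h1 h2 => h e (by push_cast; linarith) h2)
        (fun e h1 h2 => h' e (by push_cast; linarith) h2)).trans ?_
      gcongr
      · omega
      · linarith
      · omega
    | succ a =>
      have h1 := ih a (fun e h1 h2 => h e (by push_cast; linarith) (by push_cast; linarith))
        (fun e h1 h2 => h' e (by push_cast; linarith) (by push_cast; linarith))
      have h2 := ih (a + 1) (fun e h1 h2 => h e (by push_cast; linarith) h2)
        (fun e h1 h2 => h' e (by push_cast; linarith) h2)
      have h3 := h (v - j + 2 * a) (by push_cast; linarith [Int.natCast_nonneg a])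
          (by push_cast; linarith [Int.natCast_nonneg j])
      have h4 := h' (v - j + 2 * a) (by push_cast; linarith [Int.natCast_nonneg a])
          (by push_cast; linarith [Int.natCast_nonneg j])
      have h5 := abs_walk_le (v := v) hM j a
        (fun e h1 h2 => h e (by push_cast; linarith) (by push_cast; linarith))
      simp only [dwalk]
      calc _ ≤ |ε (v - j + 2 * a)| * |walk r v j a| + |r (v - j + 2 * a)| * |dwalk r ε v j a| +
              |dwalk r ε v j (a + 1)| := by
            rw [← abs_mul, ← abs_mul]
            exact (abs_add_le _ _).trans (add_le_add (abs_add_le _ _) le_rfl)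
        _ ≤ η * (1 + M) ^ j + M * (j * (1 + M) ^ j * η) + j * (1 + M) ^ j * η := by gcongr
        _ = (j * (1 + M) + 1) * (1 + M) ^ j * η := by ring
        _ ≤ ((j + 1) * (1 + M)) * (1 + M) ^ j * η := by gcongr; linarith
        _ = _ := by push_cast; ring

/-- Taylor remainder, by induction with the product rule. It makes perturbations of the squares of
size `1/n` cost only `1/n²` beyond first order. -/
theorem abs_walk_sub_sub_le {r ε : ℤ → ℝ} {M η : ℝ} {v : ℤ} (hM : 0 ≤ M) (hη : 0 ≤ η) (j a : ℕ)
    (h : ∀ e : ℤ, v - j < e → e < v + 2 * a → |r e| ≤ M)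
    (h' : ∀ e : ℤ, v - j < e → e < v + 2 * a → |ε e| ≤ η) :
    |walk (fun e => r e + ε e) v j a - walk r v j a - dwalk r ε v j a| ≤
      j ^ 2 * (1 + M + η) ^ j * η ^ 2 := by
  induction j generalizing a with
  | zero => cases a <;> simp [dwalk, walk]
  | succ j ih =>
    cases a with
    | zero =>
      refine (ih 0 (fun e h1 h2 => h e (by push_cast; linarith) h2)
        (fun e h1 h2 => h' e (by push_cast; linarith) h2)).trans ?_
      gcongr
      · omega
      · linarith
      · omega
    | succ a =>
      have w1 : ∀ e : ℤ, v - j < e → e < v + 2 * a → |r e| ≤ M :=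
        fun e h1 h2 => h e (by push_cast; linarith) (by push_cast; linarith)
      have w2 : ∀ e : ℤ, v - j < e → e < v + 2 * a → |ε e| ≤ η :=
        fun e h1 h2 => h' e (by push_cast; linarith) (by push_cast; linarith)
      have h1 := ih a w1 w2
      have h2 := ih (a + 1) (fun e h1 h2 => h e (by push_cast; linarith) h2)
        (fun e h1 h2 => h' e (by push_cast; linarith) h2)
      have h3 := h (v - j + 2 * a) (by push_cast; linarith [Int.natCast_nonneg a])
          (by push_cast; linarith [Int.natCast_nonneg j])
      have h4 := h' (v - j + 2 * a) (by push_cast; linarith [Int.natCast_nonneg a])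
          (by push_cast; linarith [Int.natCast_nonneg j])
      have h5 := abs_dwalk_le hM hη j a w1 w2
      simp only [dwalk, walk]
      set R := r (v - j + 2 * a)
      set E := ε (v - j + 2 * a)
      set A := walk (fun e => r e + ε e) v j a
      set B := walk r v j a
      set D := dwalk r ε v j a
      set A' := walk (fun e => r e + ε e) v j (a + 1)
      set B' := walk r v j (a + 1)
      set D' := dwalk r ε v j (a + 1)
      have key : (R + E) * A + A' - (R * B + B') - (E * B + R * D + D') =
        (R + E) * (A - B - D) + E * D + (A' - B' - D') := by ring
      rw [key]
      have h6 : |R + E| ≤ M + η := (abs_add_le _ _).trans (add_le_add h3 h4)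
      have h7 : (1 + M) ^ j ≤ (1 + M + η) ^ j :=
        pow_le_pow_left₀ (by linarith) (by linarith) j
      calc _ ≤ |R + E| * |A - B - D| + |E| * |D| + |A' - B' - D'| := by
            rw [← abs_mul, ← abs_mul]
            exact (abs_add_le _ _).trans (add_le_add (abs_add_le _ _) le_rfl)
        _ ≤ (M + η) * (j ^ 2 * (1 + M + η) ^ j * η ^ 2) + η * (j * (1 + M + η) ^ j * η) +
              j ^ 2 * (1 + M + η) ^ j * η ^ 2 := by
            gcongr
            exact h5.trans (by gcongr)
        _ = (j ^ 2 * (1 + M + η) + j) * ((1 + M + η) ^ j * η ^ 2) := by ring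
        _ ≤ ((j + 1) ^ 2 * (1 + M + η)) * ((1 + M + η) ^ j * η ^ 2) := by
            gcongr
            have : (0 : ℝ) ≤ j := Nat.cast_nonneg j
            nlinarith [mul_nonneg this hM, mul_nonneg this hη]
        _ = _ := by push_cast; ring

theorem dwalk_add (r ε ε' : ℤ → ℝ) (v : ℤ) (j a : ℕ) :
    dwalk r (fun e => ε e + ε' e) v j a = dwalk r ε v j a + dwalk r ε' v j a := by
  induction j generalizing a with
  | zero => simp [dwalk]
  | succ j ih =>
    cases a with
    | zero => exact ih 0
    | succ a => simp only [dwalk, ih]; ring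

theorem dwalk_const_mul (r ε : ℤ → ℝ) (c : ℝ) (v : ℤ) (j a : ℕ) :
    dwalk r (fun e => c * ε e) v j a = c * dwalk r ε v j a := by
  induction j generalizing a with
  | zero => simp [dwalk]
  | succ j ih =>
    cases a with
    | zero => exact ih 0
    | succ a => simp only [dwalk, ih]; ring

theorem hasDerivAt_walk {R : ℝ → ℤ → ℝ} {ε : ℤ → ℝ} {τ : ℝ}
    (h : ∀ e, HasDerivAt (fun t => R t e) (ε e) τ) (v : ℤ) (j a : ℕ) :
    HasDerivAt (fun t => walk (R t) v j a) (dwalk (R τ) ε v j a) τ := by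
  induction j generalizing a with
  | zero => cases a <;> simp only [walk, dwalk] <;> exact hasDerivAt_const _ _
  | succ j ih =>
    cases a with
    | zero => exact ih 0
    | succ a => exact ((h _).mul (ih a)).add (ih (a + 1))

theorem walk_const (ρ : ℝ) (v : ℤ) (j a : ℕ) : walk (fun _ => ρ) v j a = j.choose a * ρ ^ a := by
  induction j generalizing a with
  | zero => cases a <;> simp [walk]
  | succ j ih =>
    cases a with
    | zero => simp [walk, ih]
    | succ a => simp only [walk, ih, Nat.choose_succ_succ]; push_cast; ring

theorem succ_mul_choose_succ_cast (j a : ℕ) :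
    ((a : ℝ) + 1) * (j.choose (a + 1) : ℝ) = (j.choose a : ℝ) * (j - a) := by
  rcases le_or_gt a j with h | h
  · have := Nat.choose_succ_right_eq j a
    have h2 : ((j - a : ℕ) : ℝ) = (j : ℝ) - a := by push_cast [h]; ring
    rw [← h2]
    exact_mod_cast (by rw [mul_comm]; exact this)
  · rw [Nat.choose_eq_zero_of_lt h, Nat.choose_eq_zero_of_lt (by omega)]; simp

theorem dwalk_const_const (ρ : ℝ) (v : ℤ) (j a : ℕ) :
    dwalk (fun _ => ρ) (fun _ => 1) v j a = a * j.choose a * ρ ^ (a - 1) := by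
  induction j generalizing a with
  | zero => cases a <;> simp [dwalk]
  | succ j ih =>
    cases a with
    | zero => simp [dwalk, ih]
    | succ a =>
      simp only [dwalk, ih, walk_const, Nat.choose_succ_succ, Nat.add_sub_cancel]
      cases a with
      | zero => simp
      | succ a => simp only [Nat.add_sub_cancel]; push_cast; ring

/-- A half turn of the walk sends an upward step from `e` to one from `v + u - 1 - e`, where `u = v
- j + 2 * a` is the endpoint. So the average starting point of an upward step is `(v + u - 1) / 2`.
-/
theorem dwalk_const_linear (ρ : ℝ) (v : ℤ) (j a : ℕ) :
    dwalk (fun _ => ρ) (fun e => (e : ℝ)) v j a =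
      (v + (2 * a - j - 1) / 2) * (a * j.choose a * ρ ^ (a - 1)) := by
  induction j generalizing a with
  | zero => cases a <;> simp [dwalk]
  | succ j ih =>
    cases a with
    | zero => simp [dwalk, ih]
    | succ a =>
      have hc := succ_mul_choose_succ_cast j a
      simp only [dwalk, ih, walk_const, Nat.choose_succ_succ, Nat.add_sub_cancel]
      cases a with
      | zero => simp at hc ⊢; ring
      | succ a =>
        simp only [Nat.add_sub_cancel]
        push_cast at hc ⊢
        linear_combination (ρ ^ (a + 1) / 2) * hc

/-- The sign of a step is the parity of its time, and a step at any given time is upward in equally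
many walks. Consecutive times therefore cancel in pairs, and an odd number of steps leaves one of
them over. -/
theorem dwalk_const_alternating (ρ : ℝ) (v : ℤ) (m : ℕ) :
    (∀ a, dwalk (fun _ => ρ) (fun e => (-1 : ℝ) ^ (e - v)) v (2 * m) a = 0) ∧
    dwalk (fun _ => ρ) (fun e => (-1 : ℝ) ^ (e - v)) v (2 * m + 1) 0 = 0 ∧
    ∀ a, dwalk (fun _ => ρ) (fun e => (-1 : ℝ) ^ (e - v)) v (2 * m + 1) (a + 1) =
      (2 * m).choose a * ρ ^ a := by
  have step : ∀ m : ℕ, (∀ a, dwalk (fun _ => ρ) (fun e => (-1 : ℝ) ^ (e - v)) v (2 * m) a = 0) →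
      dwalk (fun _ => ρ) (fun e => (-1 : ℝ) ^ (e - v)) v (2 * m + 1) 0 = 0 ∧
      ∀ a, dwalk (fun _ => ρ) (fun e => (-1 : ℝ) ^ (e - v)) v (2 * m + 1) (a + 1) =
        (2 * m).choose a * ρ ^ a := by
    intro m h
    refine ⟨by simp only [dwalk, h], fun a => ?_⟩
    simp only [dwalk, h, walk_const]
    have : (-1 : ℝ) ^ (v - ((2 * m : ℕ) : ℤ) + 2 * (a : ℤ) - v) = 1 :=
      Even.neg_one_zpow ⟨a - m, by push_cast; ring⟩
    rw [this]; ring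
  induction m with
  | zero =>
    have h : ∀ a, dwalk (fun _ => ρ) (fun e => (-1 : ℝ) ^ (e - v)) v (2 * 0) a = 0 := by
      simp [dwalk]
    exact ⟨h, step 0 h⟩
  | succ m ih =>
    have h : ∀ a, dwalk (fun _ => ρ) (fun e => (-1 : ℝ) ^ (e - v)) v (2 * (m + 1)) a = 0 := by
      intro a
      cases a with
      | zero => exact ih.2.1
      | succ a =>
        rw [show 2 * (m + 1) = (2 * m + 1) + 1 by ring]
        rw [dwalk, ih.2.2 a, walk_const]
        have : (-1 : ℝ) ^ (v - ((2 * m + 1 : ℕ) : ℤ) + 2 * (a : ℤ) - v) = -1 :=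
          Odd.neg_one_zpow ⟨a - m - 1, by push_cast; ring⟩
        rw [this]
        cases a with
        | zero => rw [ih.2.1]; simp
        | succ a => rw [ih.2.2 a, Nat.choose_succ_succ]; push_cast; ring
    exact ⟨h, step _ h⟩

end HardEdge

/-! ### Powers of the Jacobi matrix as walk counts; rows sit at even and columns at odd vertices. -/

namespace HardEdge

/-- The weighted number of walks on `ℤ` from `v` to `u` with `j` steps, where both steps along the
edge from `e` to `e + 1` have weight `t e`. -/
noncomputable def symWalk (t : ℤ → ℝ) (v : ℤ) : ℕ → ℤ → ℝ
  | 0, u => if u = v then 1 else 0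
  | j + 1, u => t (u - 1) * symWalk t v j (u - 1) + t u * symWalk t v j (u + 1)

theorem symWalk_eq_zero (t : ℤ → ℝ) (v : ℤ) (j : ℕ) {u : ℤ} (h : u < v - j) :
    symWalk t v j u = 0 := by
  induction j generalizing u with
  | zero => simp only [symWalk]; rw [if_neg]; push_cast at h; omega
  | succ j ih =>
    push_cast at h
    simp only [symWalk]
    rw [ih (by omega), ih (by omega)]; simp

/-- A walk crosses each edge equally often upward and downward, except for one extra crossing of
every edge between its endpoints. Charging `t e ^ 2` to upward steps only thus differs from charging
`t e` to both by the product over those edges. -/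
theorem walk_eq_symWalk (t : ℤ → ℝ) (v : ℤ) (j : ℕ) :
    (∀ a k : ℕ, 2 * a = j + k → walk (fun e => t e ^ 2) v j a =
      symWalk t v j (v + k) * ∏ i ∈ Finset.range k, t (v + i)) ∧
    (∀ a k : ℕ, 2 * a + k = j → symWalk t v j (v - k) =
      walk (fun e => t e ^ 2) v j a * ∏ i ∈ Finset.range k, t (v - 1 - i)) := by
  induction j with
  | zero =>
    constructor
    · intro a k h
      cases a with
      | zero => obtain rfl : k = 0 := by omega
                simp [walk, symWalk]
      | succ a =>
        simp only [walk, symWalk]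
        rw [if_neg (by omega)]; simp
    · intro a k h
      obtain rfl : k = 0 := by omega
      obtain rfl : a = 0 := by omega
      simp [walk, symWalk]
  | succ j ih =>
    obtain ⟨ihA, ihB⟩ := ih
    have hA : ∀ a k : ℕ, 2 * a = j + 1 + k → walk (fun e => t e ^ 2) v (j + 1) a =
        symWalk t v (j + 1) (v + k) * ∏ i ∈ Finset.range k, t (v + i) := by
      intro a k h
      obtain ⟨a, rfl⟩ : ∃ b, a = b + 1 := ⟨a - 1, by omega⟩
      simp only [walk, symWalk]
      cases k with
      | zero =>
        have h1 := ihB a 1 (by omega)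
        have h2 := ihA (a + 1) 1 (by omega)
        rw [h2, show v - (j : ℤ) + 2 * a = v - 1 by omega]
        simp only [Finset.range_one, Finset.prod_singleton, Finset.range_zero, Finset.prod_empty,
          Nat.cast_one, Nat.cast_zero, add_zero, sub_zero] at h1 ⊢
        rw [h1]; ring
      | succ k =>
        have h1 := ihA a k (by omega)
        have h2 := ihA (a + 1) (k + 2) (by omega)
        rw [h1, h2, show v - (j : ℤ) + 2 * a = v + k by omega]
        simp only [Finset.prod_range_succ]
        push_cast
        rw [show v + ((k : ℤ) + 1) - 1 = v + k by ring,
          show v + ((k : ℤ) + 2) = v + (k + 1) + 1 by ring]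
        ring
    refine ⟨hA, ?_⟩
    intro a k h
    cases k with
    | zero =>
      have := hA a 0 (by omega)
      simpa using this.symm
    | succ k =>
      have h1 := ihB a k (by omega)
      rw [symWalk, show v - ((k + 1 : ℕ) : ℤ) + 1 = v - k by push_cast; ring, h1]
      cases a with
      | zero =>
        rw [symWalk_eq_zero t v j (by push_cast; omega), walk, Finset.prod_range_succ,
          show v - ((k + 1 : ℕ) : ℤ) = v - 1 - k by push_cast; ring]
        ring
      | succ a =>
        have h2 := ihB a (k + 2) (by omega)
        rw [show v - ((k + 1 : ℕ) : ℤ) - 1 = v - ((k + 2 : ℕ) : ℤ) by push_cast; ring, h2, walk,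
          show v - (j : ℤ) + 2 * a = v - ((k + 2 : ℕ) : ℤ) by omega]
        simp only [Finset.prod_range_succ]
        rw [show v - ((k + 1 : ℕ) : ℤ) = v - 1 - k by push_cast; ring,
          show v - 1 - ((k + 1 : ℕ) : ℤ) = v - ((k + 2 : ℕ) : ℤ) by push_cast; ring]
        ring

theorem symWalk_edge (t : ℤ → ℝ) (p : ℤ) (m : ℕ) :
    symWalk t (p + 1) (2 * m + 1) p = t p * walk (fun e => t e ^ 2) (p + 1) (2 * m + 1) m := by
  have := (walk_eq_symWalk t (p + 1) (2 * m + 1)).2 m 1 rfl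
  simp only [Nat.cast_one, add_sub_cancel_right, Finset.range_one, Finset.prod_singleton,
    Nat.cast_zero, sub_zero] at this
  rw [this, mul_comm]

/-- The position of a coordinate on the chain `x₁, y₁, x₂, y₂, …`, counted from `0`. -/
noncomputable def pos {n : ℕ} : Coord n → ℤ
  | Sum.inl k => 2 * (k : ℤ)
  | Sum.inr k => 2 * (k : ℤ) + 1

theorem pos_injective {n : ℕ} : Function.Injective (pos (n := n)) := by
  rintro (k | k) (l | l) h <;> simp only [pos] at h
  · exact congrArg _ (Fin.ext (by omega))
  · omega
  · omega
  · exact congrArg _ (Fin.ext (by omega))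

/-- A configuration as a function on the edges of `ℤ`, zero off the chain. -/
noncomputable def seq {n : ℕ} (z : Config n) (p : ℤ) : ℝ := ∑ k, if pos k = p then z k else 0

theorem seq_pos {n : ℕ} (z : Config n) (k : Coord n) : seq z (pos k) = z k := by
  rw [seq, Finset.sum_eq_single k]
  · simp
  · intro l _ hl
    rw [if_neg fun h => hl (pos_injective h)]
  · simp

theorem seq_eq_zero {n : ℕ} (z : Config n) {p : ℤ} (h : ∀ k : Coord n, pos k ≠ p) :
    seq z p = 0 :=
  Finset.sum_eq_zero fun k _ => if_neg (h k)

theorem seq_add_mul {n : ℕ} (z δ : Config n) (τ : ℝ) (p : ℤ) :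
    seq (z + τ • δ) p = seq z p + τ * seq δ p := by
  simp only [seq, Finset.mul_sum, ← Finset.sum_add_distrib]
  refine Finset.sum_congr rfl fun k _ => ?_
  split_ifs <;> simp

/-- `Λ_p(r)`: the derivative of the potential at the edge `p`, divided by the value there, as a
function of the squares of the variables. -/
noncomputable def force (V : ℝ[X]) (r : ℤ → ℝ) (p : ℤ) : ℝ :=
  ∑ m ∈ Finset.range V.natDegree, 2 * ((m : ℝ) + 1) * V.coeff (m + 1) *
    walk r (p + 1) (2 * m + 1) m

/-- The partial derivatives of the potential. -/
noncomputable def grad {n : ℕ} (V : ℝ[X]) (z : Config n) (k : Coord n) : ℝ :=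
  z k * force V (fun e => seq z e ^ 2) (pos k)

/-- The symmetric matrix with off-diagonal blocks `B` and `Bᵀ`. -/
noncomputable def jacobi {n : ℕ} (z : Config n) : Matrix (Fin n ⊕ Fin n) (Fin n ⊕ Fin n) ℝ :=
  Matrix.fromBlocks 0 (bidiag z) (bidiag z).transpose 0

/-- The position on `ℤ` of an index of the matrix `jacobi z`. -/
noncomputable def vertex {n : ℕ} : Fin n ⊕ Fin n → ℤ
  | Sum.inl k => 2 * (k : ℤ)
  | Sum.inr k => 2 * (k : ℤ) + 1

theorem jacobi_isSymm {n : ℕ} (z : Config n) : (jacobi z).transpose = jacobi z := by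
  simp [jacobi, Matrix.fromBlocks_transpose]

theorem jacobi_add_smul {n : ℕ} (z δ : Config n) (τ : ℝ) :
    jacobi (z + τ • δ) = jacobi z + τ • jacobi δ := by
  have : bidiag (z + τ • δ) = bidiag z + τ • bidiag δ := by
    ext i j
    simp only [bidiag, Matrix.of_apply, Matrix.add_apply, Matrix.smul_apply, smul_eq_mul]
    split_ifs <;> simp; ring
  simp [jacobi, this, Matrix.fromBlocks_add, Matrix.fromBlocks_smul]

theorem sum_vertex {n : ℕ} (f : ℤ → ℝ) :
    ∑ w : Fin n ⊕ Fin n, f (vertex w) = ∑ b ∈ Finset.Ico (0 : ℤ) (2 * n), f b := by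
  have hinj : Function.Injective (vertex (n := n)) := by
    rintro (k | k) (l | l) h <;> simp only [vertex] at h
    · exact congrArg _ (Fin.ext (by omega))
    · omega
    · omega
    · exact congrArg _ (Fin.ext (by omega))
  rw [← Finset.sum_image (f := f) (g := vertex) (fun _ _ _ _ h => hinj h)]
  congr 1
  ext b
  simp only [Finset.mem_image, Finset.mem_univ, true_and, Finset.mem_Ico]
  constructor
  · rintro ⟨k | k, rfl⟩ <;> simp only [vertex] <;> omega
  · intro h
    rcases Int.even_or_odd' b with ⟨c, rfl | rfl⟩
    · exact ⟨Sum.inl ⟨c.toNat, by omega⟩, by simp only [vertex]; omega⟩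
    · exact ⟨Sum.inr ⟨c.toNat, by omega⟩, by simp only [vertex]; omega⟩

/-- The entries of the bi-infinite extension of `jacobi z`. -/
noncomputable def jacobiEntry (t : ℤ → ℝ) (a b : ℤ) : ℝ :=
  (if a = b - 1 then t (b - 1) else 0) + if a = b + 1 then t b else 0

theorem jacobiEntry_eq_zero (t : ℤ → ℝ) {a b : ℤ} (h1 : a ≠ b - 1) (h2 : a ≠ b + 1) :
    jacobiEntry t a b = 0 := by
  rw [jacobiEntry, if_neg h1, if_neg h2, add_zero]

/-- The signed entries of the chain. -/
noncomputable def signedSeq {n : ℕ} (z : Config n) (p : ℤ) : ℝ := (-1) ^ p * seq z p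

theorem signedSeq_sq {n : ℕ} (z : Config n) (p : ℤ) : signedSeq z p ^ 2 = seq z p ^ 2 := by
  rw [signedSeq, mul_pow]
  rcases Int.even_or_odd p with h | h
  · simp [h.neg_one_zpow]
  · simp [h.neg_one_zpow]

theorem signedSeq_two_mul {n : ℕ} (z : Config n) (k : Fin n) :
    signedSeq z (2 * (k : ℤ)) = z (Sum.inl k) := by
  rw [signedSeq, Even.neg_one_zpow ⟨(k : ℤ), by ring⟩, one_mul]
  exact seq_pos z (Sum.inl k)

theorem signedSeq_two_mul_add_one {n : ℕ} (z : Config n) (k : Fin (n - 1)) :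
    signedSeq z (2 * (k : ℤ) + 1) = - z (Sum.inr k) := by
  rw [signedSeq, Odd.neg_one_zpow ⟨(k : ℤ), by ring⟩, ← seq_pos z (Sum.inr k)]
  simp [pos]

theorem signedSeq_neg_one {n : ℕ} (z : Config n) : signedSeq z (-1) = 0 := by
  rw [signedSeq, seq_eq_zero, mul_zero]
  rintro (k | k) <;> simp only [pos] <;> omega

theorem signedSeq_last {n : ℕ} (z : Config n) : signedSeq z (2 * n - 1) = 0 := by
  rw [signedSeq, seq_eq_zero, mul_zero]
  rintro (k | k) <;> simp only [pos] <;> omega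

theorem jacobi_apply {n : ℕ} (z : Config n) (u v : Fin n ⊕ Fin n) :
    jacobi z u v = jacobiEntry (signedSeq z) (vertex u) (vertex v) := by
  have key : ∀ i j : Fin n,
      bidiag z i j = jacobiEntry (signedSeq z) (2 * (i : ℤ)) (2 * (j : ℤ) + 1) := by
    intro i j
    simp only [bidiag, Matrix.of_apply]
    by_cases hij : i = j
    · rw [if_pos hij, jacobiEntry, if_pos (by rw [hij]; omega), if_neg (by rw [hij]; omega),
        add_sub_cancel_right, hij, signedSeq_two_mul, add_zero]
    · have hij' : (i : ℤ) ≠ j := fun h => hij (Fin.ext (by omega))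
      rw [if_neg hij]
      by_cases h : (i : ℕ) = j + 1
      · rw [dif_pos h, jacobiEntry, if_neg (by omega), if_pos (by omega), zero_add]
        exact (signedSeq_two_mul_add_one z ⟨(j : ℕ), by omega⟩).symm
      · rw [dif_neg h, jacobiEntry_eq_zero _ (by omega) (by omega)]
  rcases u with i | i <;> rcases v with j | j
  · simp only [jacobi, Matrix.fromBlocks_apply₁₁, Matrix.zero_apply]
    exact (jacobiEntry_eq_zero _ (by simp only [vertex]; omega) (by simp only [vertex]; omega)).symm
  · exact key i j
  · simp only [jacobi, Matrix.fromBlocks_apply₂₁, Matrix.transpose_apply, vertex]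
    rw [key j i]
    simp only [jacobiEntry]
    rw [add_comm]
    congr 1
    · by_cases h : (2 * (j : ℤ)) = 2 * i + 1 + 1
      · rw [if_pos h, if_pos (by omega)]; congr 1; omega
      · rw [if_neg h, if_neg (by omega)]
    · by_cases h : (2 * (j : ℤ)) = 2 * i + 1 - 1
      · rw [if_pos h, if_pos (by omega)]; congr 1; omega
      · rw [if_neg h, if_neg (by omega)]
  · simp only [jacobi, Matrix.fromBlocks_apply₂₂, Matrix.zero_apply]
    exact (jacobiEntry_eq_zero _ (by simp only [vertex]; omega) (by simp only [vertex]; omega)).symm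

/-- The weights of the edges `-1` and `2 * n - 1` vanish, so walks on `ℤ` cannot leave the index
range of the matrix. -/
theorem jacobi_pow_apply {n : ℕ} (z : Config n) (j : ℕ) (u v : Fin n ⊕ Fin n) :
    (jacobi z ^ j) u v = symWalk (signedSeq z) (vertex u) j (vertex v) := by
  induction j generalizing v with
  | zero =>
    simp only [pow_zero, symWalk, Matrix.one_apply]
    congr 1
    refine propext ⟨fun h => by rw [h], fun h => ?_⟩
    rcases u with k | k <;> rcases v with l | l <;> simp only [vertex] at h
    · exact congrArg _ (Fin.ext (by omega))
    · omega
    · omega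
    · exact congrArg _ (Fin.ext (by omega))
  | succ j ih =>
    rw [pow_succ, Matrix.mul_apply]
    simp only [ih, jacobi_apply, symWalk]
    rw [sum_vertex fun b => symWalk (signedSeq z) (vertex u) j b *
      jacobiEntry (signedSeq z) b (vertex v)]
    simp only [jacobiEntry, mul_add, Finset.sum_add_distrib, mul_ite, mul_zero,
      Finset.sum_ite_eq', Finset.mem_Ico]
    have hv : 0 ≤ vertex v ∧ vertex v < 2 * n := by
      rcases v with k | k <;> simp only [vertex] <;> omega
    congr 1
    · split_ifs with h
      · ring
      · rw [show vertex v - 1 = -1 by omega, signedSeq_neg_one]; ring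
    · split_ifs with h
      · ring
      · rw [show vertex v = 2 * n - 1 by omega, signedSeq_last]; ring

theorem jacobi_pow_inl {n : ℕ} (z : Config n) (m : ℕ) (k : Fin n) :
    (jacobi z ^ (2 * m + 1)) (Sum.inr k) (Sum.inl k) =
      z (Sum.inl k) * walk (fun e => seq z e ^ 2) (pos (n := n) (Sum.inl k) + 1) (2 * m + 1) m := by
  rw [jacobi_pow_apply]
  have := symWalk_edge (signedSeq z) (2 * (k : ℤ)) m
  simp only [signedSeq_sq, signedSeq_two_mul] at this
  exact this

theorem jacobi_pow_inr {n : ℕ} (z : Config n) (m : ℕ) (k : Fin (n - 1)) :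
    (jacobi z ^ (2 * m + 1)) (Sum.inl ⟨k + 1, by omega⟩) (Sum.inr ⟨k, by omega⟩) =
      -(z (Sum.inr k) *
        walk (fun e => seq z e ^ 2) (pos (n := n) (Sum.inr k) + 1) (2 * m + 1) m) := by
  rw [jacobi_pow_apply]
  have := symWalk_edge (signedSeq z) (2 * (k : ℤ) + 1) m
  simp only [signedSeq_sq, signedSeq_two_mul_add_one] at this
  rw [neg_mul] at this
  rw [pos, ← this]
  simp only [vertex]
  congr 1

theorem sum_mul_bidiag {n : ℕ} (z : Config n) (f : Fin n → Fin n → ℝ) :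
    ∑ i, ∑ j, f i j * bidiag z i j = ∑ i, f i i * z (Sum.inl i) -
      ∑ j : Fin (n - 1), f ⟨j + 1, by omega⟩ ⟨j, by omega⟩ * z (Sum.inr j) := by
  have h1 : ∀ i j : Fin n, f i j * bidiag z i j = (if i = j then f i j * z (Sum.inl i) else 0) -
      ∑ l : Fin (n - 1), if i = ⟨l + 1, by omega⟩ ∧ j = ⟨l, by omega⟩ then
        f i j * z (Sum.inr l) else 0 := by
    intro i j
    simp only [bidiag, Matrix.of_apply]
    by_cases hij : i = j
    · rw [if_pos hij, if_pos hij, Finset.sum_eq_zero, sub_zero]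
      intro l _
      refine if_neg fun h => ?_
      have h1 := congrArg Fin.val h.1
      have h2 := congrArg Fin.val h.2
      have h3 := congrArg Fin.val hij
      simp only at h1 h2
      omega
    · rw [if_neg hij, if_neg hij]
      by_cases h : (i : ℕ) = j + 1
      · rw [dif_pos h, Finset.sum_eq_single ⟨(j : ℕ), by omega⟩]
        · rw [if_pos ⟨Fin.ext h, Fin.ext rfl⟩]; ring
        · intro l _ hl
          refine if_neg fun h' => hl (Fin.ext ?_)
          exact (congrArg Fin.val h'.2).symm
        · simp
      · rw [dif_neg h, Finset.sum_eq_zero]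
        · ring
        · intro l _
          refine if_neg fun h' => h ?_
          have h1 := congrArg Fin.val h'.1
          have h2 := congrArg Fin.val h'.2
          simp only at h1 h2
          omega
  simp only [h1, Finset.sum_sub_distrib, Finset.sum_ite_eq, Finset.mem_univ, if_true]
  congr 1
  have h2 : ∀ i : Fin n, ∑ j : Fin n, ∑ l : Fin (n - 1), (if i = (⟨l + 1, by omega⟩ : Fin n) ∧
      j = (⟨l, by omega⟩ : Fin n) then f i j * z (Sum.inr l) else 0) =
      ∑ l : Fin (n - 1), if i = (⟨l + 1, by omega⟩ : Fin n) then
        f i ⟨l, by omega⟩ * z (Sum.inr l) else 0 := by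
    intro i
    rw [Finset.sum_comm]
    refine Finset.sum_congr rfl fun l _ => ?_
    by_cases h : i = (⟨l + 1, by omega⟩ : Fin n)
    · simp only [h, true_and]; simp
    · simp [h]
  simp only [h2]
  rw [Finset.sum_comm]
  simp

end HardEdge

/-! ### Trace inequality and uniform convexity of the potential. -/

namespace HardEdge

theorem hasDerivAt_of_eq {f g : ℝ → ℝ} {f' g' x : ℝ} (h : HasDerivAt f f' x)
    (hf : ∀ y, f y = g y) (hd : f' = g') : HasDerivAt g g' x := by
  rw [← hd, ← funext hf]; exact h

section TraceInequality

variable {N : Type*} [Fintype N] [DecidableEq N]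

theorem exists_diagonalization (A : Matrix N N ℝ) (hA : A.transpose = A) :
    ∃ (U : Matrix N N ℝ) (α : N → ℝ), U.transpose * U = 1 ∧ U * U.transpose = 1 ∧
      ∀ f : ℝ[X], aeval A f = U * Matrix.diagonal (fun i => f.eval (α i)) * U.transpose := by
  have hA' : A.IsHermitian := by
    rw [Matrix.IsHermitian, Matrix.conjTranspose_eq_transpose_of_trivial, hA]
  set U : Matrix N N ℝ := (hA'.eigenvectorUnitary : Matrix N N ℝ) with hU
  have hstar : star U = U.transpose := by
    rw [Matrix.star_eq_conjTranspose, Matrix.conjTranspose_eq_transpose_of_trivial]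
  have h1 : U.transpose * U = 1 := by
    rw [← hstar]; exact (Matrix.mem_unitaryGroup_iff').1 hA'.eigenvectorUnitary.2
  have h2 : U * U.transpose = 1 := by
    rw [← hstar]; exact (Matrix.mem_unitaryGroup_iff).1 hA'.eigenvectorUnitary.2
  have hs : A = U * Matrix.diagonal hA'.eigenvalues * U.transpose := by
    have := hA'.spectral_theorem
    rw [Unitary.conjStarAlgAut_apply] at this
    rw [← hstar]
    exact this
  refine ⟨U, hA'.eigenvalues, h1, h2, fun f => ?_⟩
  have hpow : ∀ j : ℕ, A ^ j =
      U * Matrix.diagonal (fun i => hA'.eigenvalues i ^ j) * U.transpose := by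
    intro j
    induction j with
    | zero => simp [h2]
    | succ j ih =>
      rw [pow_succ, ih]
      nth_rewrite 2 [hs]
      have : U * Matrix.diagonal (fun i => hA'.eigenvalues i ^ j) * U.transpose *
          (U * Matrix.diagonal hA'.eigenvalues * U.transpose) =
          U * Matrix.diagonal (fun i => hA'.eigenvalues i ^ j) * (U.transpose * U) *
            Matrix.diagonal hA'.eigenvalues * U.transpose := by noncomm_ring
      rw [this, h1, mul_one, mul_assoc U, Matrix.diagonal_mul_diagonal]
      simp only [pow_succ]
  induction f using Polynomial.induction_on' with
  | add p q hp hq =>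
    rw [map_add, hp, hq, ← add_mul, ← mul_add, Matrix.diagonal_add]
    simp
  | monomial j c =>
    rw [aeval_monomial, hpow, ← Algebra.smul_def]
    simp only [eval_monomial]
    rw [← Matrix.smul_mul, ← Matrix.mul_smul, ← Matrix.diagonal_smul]
    rfl

theorem trace_aeval_mul_aeval {A B U V : Matrix N N ℝ} {α β : N → ℝ}
    (hA : ∀ f : ℝ[X], aeval A f = U * Matrix.diagonal (fun i => f.eval (α i)) * U.transpose)
    (hB : ∀ f : ℝ[X], aeval B f = V * Matrix.diagonal (fun i => f.eval (β i)) * V.transpose)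
    (f g : ℝ[X]) :
    (aeval A f * aeval B g).trace =
      ∑ i, ∑ j, (U.transpose * V) i j ^ 2 * (f.eval (α i) * g.eval (β j)) := by
  rw [hA, hB]
  set Z := U.transpose * V with hZ
  have h : (U * Matrix.diagonal (fun i => f.eval (α i)) * U.transpose *
      (V * Matrix.diagonal (fun i => g.eval (β i)) * V.transpose)).trace =
      (Matrix.diagonal (fun i => f.eval (α i)) * Z * Matrix.diagonal (fun i => g.eval (β i)) *
        Z.transpose).trace := by
    rw [Matrix.mul_assoc, Matrix.mul_assoc, Matrix.trace_mul_comm, hZ, Matrix.transpose_mul,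
      Matrix.transpose_transpose]
    congr 1
    noncomm_ring
  rw [h, Matrix.trace]
  refine Finset.sum_congr rfl fun i _ => ?_
  rw [Matrix.diag_apply, Matrix.mul_apply]
  refine Finset.sum_congr rfl fun j _ => ?_
  rw [Matrix.mul_diagonal, Matrix.diagonal_mul, Matrix.transpose_apply]
  ring

theorem mul_trace_sub_sq_le {g : ℝ[X]} {κ : ℝ}
    (hg : ∀ x y : ℝ, κ * (x - y) ^ 2 ≤ (g.eval x - g.eval y) * (x - y))
    {A B : Matrix N N ℝ} (hA : A.transpose = A) (hB : B.transpose = B) :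
    κ * ((A - B) * (A - B)).trace ≤ ((aeval A g - aeval B g) * (A - B)).trace := by
  obtain ⟨U, α, -, -, hA'⟩ := exists_diagonalization A hA
  obtain ⟨V, β, -, -, hB'⟩ := exists_diagonalization B hB
  have key := trace_aeval_mul_aeval hA' hB'
  have e1 := key (g * X) 1
  have e2 := key g X
  have e3 := key X g
  have e4 := key 1 (g * X)
  have e5 := key (X * X) 1
  have e6 := key X X
  have e7 := key 1 (X * X)
  simp only [map_mul, aeval_X, map_one, mul_one, one_mul, eval_mul, eval_X, eval_one]
    at e1 e2 e3 e4 e5 e6 e7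
  have h1 : ((aeval A g - aeval B g) * (A - B)).trace = (aeval A g * A).trace -
      (aeval A g * B).trace - (A * aeval B g).trace + (aeval B g * B).trace := by
    simp only [sub_mul, mul_sub, Matrix.trace_sub]
    rw [Matrix.trace_mul_comm (aeval B g) A]; ring
  have h2 : ((A - B) * (A - B)).trace = (A * A).trace - 2 * (A * B).trace + (B * B).trace := by
    simp only [sub_mul, mul_sub, Matrix.trace_sub]
    rw [Matrix.trace_mul_comm B A]; ring
  rw [h1, h2, e1, e2, e3, e4, e5, e6, e7]
  simp only [Finset.mul_sum, ← Finset.sum_sub_distrib, ← Finset.sum_add_distrib]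
  refine Finset.sum_le_sum fun i _ => Finset.sum_le_sum fun j _ => ?_
  nlinarith [mul_le_mul_of_nonneg_left (hg (α i) (β j)) (sq_nonneg ((U.transpose * V) i j))]

attribute [local instance] Matrix.linftyOpNormedRing
attribute [local instance] Matrix.linftyOpNormedAlgebra

/-- `A` and `E` need not commute; under the trace, cyclicity makes all terms of the product rule
equal. -/
theorem hasDerivAt_trace_aeval (A E : Matrix N N ℝ) (f : ℝ[X]) (τ : ℝ) :
    HasDerivAt (fun t : ℝ => (aeval (A + t • E) f).trace)
      ((aeval (A + τ • E) (derivative f) * E).trace) τ := by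
  induction f using Polynomial.induction_on' with
  | add p q hp hq =>
    simp only [map_add, Matrix.trace_add, add_mul]
    exact hp.add hq
  | monomial j c =>
    have h1 : HasDerivAt (fun t : ℝ => A + t • E) E τ := by
      have := ((hasDerivAt_id τ).smul_const E).const_add A
      rwa [one_smul] at this
    have h2 := h1.fun_pow' j
    have h3 := ((Matrix.traceLinearMap N ℝ ℝ).toContinuousLinearMap.hasFDerivAt
      (x := (A + τ • E) ^ j)).comp_hasDerivAt τ h2
    have h4 := h3.const_mul c
    refine hasDerivAt_of_eq h4 (fun t => ?_) ?_
    · rw [aeval_monomial, ← Algebra.smul_def, Matrix.trace_smul, smul_eq_mul]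
      rfl
    · symm
      rw [derivative_monomial, aeval_monomial, ← Algebra.smul_def, Matrix.smul_mul,
        Matrix.trace_smul, smul_eq_mul, mul_assoc]
      congr 1
      change _ = Matrix.trace (∑ i ∈ Finset.range j, _)
      rw [Matrix.trace_sum, Finset.sum_congr rfl (g := fun _ => ((A + τ • E) ^ (j - 1) * E).trace)]
      · simp
      · intro i hi
        have hi' := Finset.mem_range.1 hi
        rw [Matrix.trace_mul_comm, ← mul_assoc, ← pow_add, Nat.pred_eq_sub_one]
        congr 3
        omega

end TraceInequality

theorem comp_sq_eq_sum (V : ℝ[X]) :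
    V.comp (X ^ 2) = ∑ m ∈ Finset.range (V.natDegree + 1), C (V.coeff m) * X ^ (2 * m) := by
  conv_lhs => rw [V.as_sum_range_C_mul_X_pow]
  rw [Polynomial.sum_comp]
  simp [pow_mul]

theorem derivative_comp_sq (V : ℝ[X]) :
    derivative (V.comp (X ^ 2)) = ∑ m ∈ Finset.range V.natDegree,
      C (2 * ((m : ℝ) + 1) * V.coeff (m + 1)) * X ^ (2 * m + 1) := by
  rw [comp_sq_eq_sum, derivative_sum, Finset.sum_range_succ']
  simp only [derivative_C_mul_X_pow]
  simp only [mul_zero, Nat.cast_zero, map_zero, zero_mul, add_zero]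
  refine Finset.sum_congr rfl fun m _ => ?_
  congr 2
  push_cast; ring

/-- The derivative of `x ↦ V (x ^ 2)` increases at rate at least `κ`. -/
def StrongMono (V : ℝ[X]) (κ : ℝ) : Prop :=
  ∀ x y : ℝ, κ * (x - y) ^ 2 ≤
    ((derivative (V.comp (X ^ 2))).eval x - (derivative (V.comp (X ^ 2))).eval y) * (x - y)

theorem strongMono_of_strongConvexOn {V : ℝ[X]} {κ : ℝ}
    (hV : StrongConvexOn Set.univ κ (fun x : ℝ => V.eval (x ^ 2))) : StrongMono V κ := by
  have h1 := strongConvexOn_iff_convex.1 hV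
  have h2 : ∀ x : ℝ, HasDerivAt (fun x : ℝ => V.eval (x ^ 2) - κ / 2 * ‖x‖ ^ 2)
      ((derivative (V.comp (X ^ 2))).eval x - κ * x) x := by
    intro x
    have h3 := (V.comp (X ^ 2)).hasDerivAt x
    have h4 := h3.sub ((hasDerivAt_pow 2 x).const_mul (κ / 2))
    refine hasDerivAt_of_eq h4 (fun y => ?_) ?_
    · simp [eval_comp]
    · norm_num; ring
  have h3 := h1.monotoneOn_deriv fun x _ => (h2 x).differentiableAt
  have h4 : ∀ x y : ℝ, x ≤ y → (derivative (V.comp (X ^ 2))).eval x - κ * x ≤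
      (derivative (V.comp (X ^ 2))).eval y - κ * y := by
    intro x y hxy
    have := h3 (Set.mem_univ x) (Set.mem_univ y) hxy
    rwa [(h2 x).deriv, (h2 y).deriv] at this
  intro x y
  rcases le_total x y with h | h
  · nlinarith [h4 x y h]
  · nlinarith [h4 y x h]

variable {n : ℕ}

theorem trace_fromBlocks_mul (z : Config n) (Q : Matrix (Fin n ⊕ Fin n) (Fin n ⊕ Fin n) ℝ)
    (hQ : Q.transpose = Q) :
    (Q * jacobi z).trace = 2 * ∑ i, ∑ j, Q (Sum.inl i) (Sum.inr j) * bidiag z i j := by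
  have hQ' : ∀ u v, Q u v = Q v u := fun u v => congrFun (congrFun hQ v) u
  rw [Matrix.trace, Fintype.sum_sum_type]
  simp only [Matrix.diag_apply, Matrix.mul_apply, Fintype.sum_sum_type, jacobi,
    Matrix.fromBlocks_apply₁₁, Matrix.fromBlocks_apply₁₂, Matrix.fromBlocks_apply₂₁,
    Matrix.fromBlocks_apply₂₂, Matrix.zero_apply, mul_zero, Finset.sum_const_zero, zero_add,
    add_zero, Matrix.transpose_apply]
  rw [two_mul]
  congr 1
  rw [Finset.sum_comm]
  simp only [hQ' (Sum.inr _) (Sum.inl _)]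

theorem trace_jacobi_mul_self (z : Config n) :
    (jacobi z * jacobi z).trace = 2 * ∑ k, z k ^ 2 := by
  rw [trace_fromBlocks_mul z _ (jacobi_isSymm z), Fintype.sum_sum_type]
  simp only [jacobi, Matrix.fromBlocks_apply₁₂]
  rw [sum_mul_bidiag z (bidiag z)]
  congr 1
  rw [sub_eq_add_neg, ← Finset.sum_neg_distrib]
  congr 1
  · exact Finset.sum_congr rfl fun i _ => by simp [bidiag, sq]
  · exact Finset.sum_congr rfl fun i _ => by simp [bidiag, sq]

/-- The derivative of `V (x ^ 2)` is odd, and the entry of an odd power of the matrix at the two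
ends of an edge counts walks across it. This identifies `grad` as the gradient of the potential. -/
theorem trace_aeval_jacobi_mul (V : ℝ[X]) (z δ : Config n) :
    (aeval (jacobi z) (derivative (V.comp (X ^ 2))) * jacobi δ).trace =
      2 * ∑ k, grad V z k * δ k := by
  have hpow : ∀ m : ℕ, (jacobi z ^ (2 * m + 1) * jacobi δ).trace =
      2 * ∑ k, z k * walk (fun e => seq z e ^ 2) (pos k + 1) (2 * m + 1) m * δ k := by
    intro m
    have hs : (jacobi z ^ (2 * m + 1)).transpose = jacobi z ^ (2 * m + 1) := by
      rw [Matrix.transpose_pow, jacobi_isSymm]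
    rw [trace_fromBlocks_mul δ _ hs, Fintype.sum_sum_type,
      sum_mul_bidiag δ fun i j => (jacobi z ^ (2 * m + 1)) (Sum.inl i) (Sum.inr j)]
    congr 1
    rw [sub_eq_add_neg, ← Finset.sum_neg_distrib]
    congr 1
    · refine Finset.sum_congr rfl fun i _ => ?_
      rw [← jacobi_pow_inl, ← congrFun (congrFun hs (Sum.inr i)) (Sum.inl i),
        Matrix.transpose_apply]
    · refine Finset.sum_congr rfl fun i _ => ?_
      rw [jacobi_pow_inr]; ring
  rw [derivative_comp_sq, map_sum, Finset.sum_mul, Matrix.trace_sum]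
  simp only [map_mul, aeval_C, map_pow, aeval_X, ← Algebra.smul_def, Matrix.smul_mul,
    Matrix.trace_smul, hpow, smul_eq_mul, grad, force, Finset.sum_mul, Finset.mul_sum]
  rw [Finset.sum_comm]
  refine Finset.sum_congr rfl fun k _ => Finset.sum_congr rfl fun m _ => ?_
  ring

/-- The square of `jacobi z` is block diagonal with blocks `BBᵀ` and `BᵀB`, whose powers have equal
traces. -/
theorem potential_eq (V : ℝ[X]) (z : Config n) :
    potential V z = (aeval (jacobi z) (V.comp (X ^ 2))).trace / 2 := by
  have hsq : jacobi z ^ 2 = Matrix.fromBlocks (bidiag z * (bidiag z).transpose) 0 0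
      ((bidiag z).transpose * bidiag z) := by
    rw [sq, jacobi, Matrix.fromBlocks_multiply]; simp
  have hpow : ∀ m : ℕ, (jacobi z ^ 2) ^ m =
      Matrix.fromBlocks ((bidiag z * (bidiag z).transpose) ^ m) 0 0
        (((bidiag z).transpose * bidiag z) ^ m) := by
    intro m
    induction m with
    | zero => simp [Matrix.fromBlocks_one]
    | succ m ih => rw [pow_succ, ih, hsq, Matrix.fromBlocks_multiply]; simp [pow_succ]
  have htr : ∀ m : ℕ, (((bidiag z).transpose * bidiag z) ^ m).trace =
      ((bidiag z * (bidiag z).transpose) ^ m).trace := by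
    intro m
    cases m with
    | zero => simp
    | succ m =>
      have h : ∀ m : ℕ, ((bidiag z).transpose * bidiag z) ^ m * (bidiag z).transpose =
          (bidiag z).transpose * (bidiag z * (bidiag z).transpose) ^ m := by
        intro m
        induction m with
        | zero => simp
        | succ m ih =>
          rw [pow_succ', mul_assoc, ih, pow_succ']
          simp only [Matrix.mul_assoc]
      rw [pow_succ, ← Matrix.mul_assoc, h, Matrix.mul_assoc, Matrix.trace_mul_comm,
        Matrix.mul_assoc, pow_succ]
  rw [comp_sq_eq_sum, potential, aeval_eq_sum_range, map_sum, Matrix.trace_sum, Matrix.trace_sum,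
    Finset.sum_div]
  refine Finset.sum_congr rfl fun m _ => ?_
  rw [map_mul, aeval_C, map_pow, aeval_X, ← Algebra.smul_def, pow_mul, hpow, Matrix.trace_smul,
    Matrix.trace_smul]
  have : ∀ A D : Matrix (Fin n) (Fin n) ℝ,
      (Matrix.fromBlocks A 0 0 D).trace = A.trace + D.trace := by
    intro A D
    simp [Matrix.trace, Fintype.sum_sum_type]
  rw [this, htr]
  simp only [smul_eq_mul]; ring

theorem hasDerivAt_potential (V : ℝ[X]) (z δ : Config n) (τ : ℝ) :
    HasDerivAt (fun t : ℝ => potential V (z + t • δ)) (∑ k, grad V (z + τ • δ) k * δ k) τ := by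
  have := (hasDerivAt_trace_aeval (jacobi z) (jacobi δ) (V.comp (X ^ 2)) τ).div_const 2
  rw [← jacobi_add_smul, trace_aeval_jacobi_mul] at this
  refine hasDerivAt_of_eq this (fun t => ?_) (by ring)
  rw [potential_eq, jacobi_add_smul]

theorem continuous_potential (V : ℝ[X]) : Continuous (potential (n := n) V) := by
  have h : Continuous (bidiag (n := n)) := by
    refine continuous_matrix fun i j => ?_
    simp only [bidiag, Matrix.of_apply]
    split_ifs <;> fun_prop
  have h2 : Continuous fun z : Config n => bidiag z * (bidiag z).transpose :=
    h.matrix_mul h.matrix_transpose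
  exact ((Polynomial.continuous_aeval V).comp h2).matrix_trace

theorem grad_strongMono {V : ℝ[X]} {κ : ℝ} (hV : StrongMono V κ) (z z' : Config n) :
    κ * ∑ k, (z k - z' k) ^ 2 ≤ ∑ k, (grad V z k - grad V z' k) * (z k - z' k) := by
  have h := mul_trace_sub_sq_le hV (jacobi_isSymm z) (jacobi_isSymm z')
  have hd : jacobi z - jacobi z' = jacobi (z - z') := by
    have := jacobi_add_smul z z' (-1)
    rw [neg_one_smul, neg_one_smul, ← sub_eq_add_neg, ← sub_eq_add_neg] at this
    exact this.symm
  rw [hd, trace_jacobi_mul_self, sub_mul, Matrix.trace_sub, trace_aeval_jacobi_mul,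
    trace_aeval_jacobi_mul, ← mul_sub, ← Finset.sum_sub_distrib] at h
  simp only [← sub_mul, Pi.sub_apply] at h
  linarith

/-- The gradient carries the factor `z k` and so vanishes at `0`; strong monotonicity is integrated
along the ray to `z`. This is the coercivity behind the existence of minimizers. -/
theorem potential_zero_add_le {V : ℝ[X]} {κ : ℝ} (hV : StrongMono V κ) (z : Config n) :
    potential V (0 : Config n) + κ / 2 * ∑ k, z k ^ 2 ≤ potential V z := by
  have hd : ∀ τ : ℝ, HasDerivAt
      (fun t : ℝ => potential V (0 + t • z) - κ / 2 * (∑ k, z k ^ 2) * t ^ 2)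
      (∑ k, grad V (0 + τ • z) k * z k - κ * (∑ k, z k ^ 2) * τ) τ := by
    intro τ
    have := (hasDerivAt_potential V 0 z τ).sub
      ((hasDerivAt_pow 2 τ).const_mul (κ / 2 * ∑ k, z k ^ 2))
    refine hasDerivAt_of_eq this (fun t => rfl) ?_
    norm_num; ring
  have hmono : MonotoneOn
      (fun t : ℝ => potential V (0 + t • z) - κ / 2 * (∑ k, z k ^ 2) * t ^ 2) (Set.Icc 0 1) := by
    refine monotoneOn_of_deriv_nonneg (convex_Icc 0 1)
      (fun τ _ => (hd τ).continuousAt.continuousWithinAt)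
      (fun τ _ => (hd τ).differentiableAt.differentiableWithinAt) fun τ hτ => ?_
    rw [interior_Icc] at hτ
    rw [(hd τ).deriv]
    have h := grad_strongMono hV (0 + τ • z) 0
    simp only [grad, Pi.zero_apply, zero_mul, sub_zero, zero_add, Pi.smul_apply, smul_eq_mul] at h ⊢
    have e1 : ∑ k, (τ * z k) ^ 2 = τ * (τ * ∑ k, z k ^ 2) := by
      simp only [Finset.mul_sum]; exact Finset.sum_congr rfl fun k _ => by ring
    have e2 : ∑ k, τ * z k * force V (fun e => seq (τ • z) e ^ 2) (pos k) * (τ * z k) =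
        τ * ∑ k, τ * z k * force V (fun e => seq (τ • z) e ^ 2) (pos k) * z k := by
      simp only [Finset.mul_sum]; exact Finset.sum_congr rfl fun k _ => by ring
    rw [e1, e2] at h
    have := le_of_mul_le_mul_left (h.trans' (le_of_eq (by ring)) :
      τ * (κ * (τ * ∑ k, z k ^ 2)) ≤ _) hτ.1
    linarith
  have := hmono (Set.left_mem_Icc.2 zero_le_one) (Set.right_mem_Icc.2 zero_le_one) zero_le_one
  simp only [zero_smul, add_zero, one_smul, zero_add] at this
  linarith

end HardEdge

/-! ### Minimization in the presence of logarithms. -/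

namespace HardEdge

section LogMinimization

variable {ι : Type*} [Fintype ι]

/-- `Φ` minus the logarithms of the coordinates with weights `w`. -/
noncomputable def logEnergy (Φ : (ι → ℝ) → ℝ) (w : ι → ℝ) (z : ι → ℝ) : ℝ :=
  Φ z - ∑ k, w k * Real.log (z k)

/-- `z` minimizes `logEnergy Φ w` over the nonnegative vectors which are positive where the
weight does not vanish. -/
def IsLogMinimizer (Φ : (ι → ℝ) → ℝ) (w : ι → ℝ) (z : ι → ℝ) : Prop :=
  (∀ k, 0 < z k ∨ (w k = 0 ∧ z k = 0)) ∧
    ∀ y : ι → ℝ, (∀ k, 0 < y k ∨ (w k = 0 ∧ y k = 0)) → logEnergy Φ w z ≤ logEnergy Φ w y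

variable {Φ : (ι → ℝ) → ℝ} {w : ι → ℝ}

theorem exists_isLogMinimizer (hΦ : Continuous Φ) (hw : ∀ k, 0 ≤ w k) {c κ : ℝ} (hκ : 0 < κ)
    (h : ∀ z, c + κ * ∑ k, z k ^ 2 ≤ Φ z) : ∃ z, IsLogMinimizer Φ w z := by
  set ℓ : ι → ℝ := fun k => w k ^ 2 / (2 * κ) with hℓ
  have hℓ0 : ∀ k, 0 ≤ ℓ k := fun k => by positivity
  have hterm : ∀ (k : ι) (x : ℝ), 0 ≤ x → -ℓ k ≤ κ / 2 * x ^ 2 - w k * Real.log x := by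
    intro k x hx
    have h1 : Real.log x ≤ x := Real.log_le_self hx
    have h2 : w k * Real.log x ≤ w k * x := mul_le_mul_of_nonneg_left h1 (hw k)
    have h3 : ℓ k + κ / 2 * x ^ 2 - w k * x = (w k - κ * x) ^ 2 / (2 * κ) := by
      simp only [hℓ]; field_simp; ring
    have h4 : 0 ≤ (w k - κ * x) ^ 2 / (2 * κ) := by positivity
    linarith
  set K : ℝ := logEnergy Φ w (fun _ => 1) - c + ∑ k, ℓ k with hK
  have hlow : ∀ z : ι → ℝ, (∀ k, 0 ≤ z k) → ∀ k,
      c - ∑ l, ℓ l + κ / 2 * z k ^ 2 ≤ logEnergy Φ w z ∧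
      c - ∑ l, ℓ l - w k * Real.log (z k) ≤ logEnergy Φ w z := by
    intro z hz k
    have h1 : c + ∑ l, (κ / 2 * z l ^ 2 + (κ / 2 * z l ^ 2 - w l * Real.log (z l))) ≤
        logEnergy Φ w z := by
      have := h z
      rw [logEnergy]
      have e : ∑ l, (κ / 2 * z l ^ 2 + (κ / 2 * z l ^ 2 - w l * Real.log (z l))) =
          κ * ∑ l, z l ^ 2 - ∑ l, w l * Real.log (z l) := by
        rw [Finset.mul_sum, ← Finset.sum_sub_distrib]
        exact Finset.sum_congr rfl fun l _ => by ring
      rw [e]; linarith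
    have h2 : (κ / 2 * z k ^ 2 + (κ / 2 * z k ^ 2 - w k * Real.log (z k))) + ℓ k ≤
        ∑ l, ((κ / 2 * z l ^ 2 + (κ / 2 * z l ^ 2 - w l * Real.log (z l))) + ℓ l) :=
      Finset.single_le_sum (f := fun l =>
          (κ / 2 * z l ^ 2 + (κ / 2 * z l ^ 2 - w l * Real.log (z l))) + ℓ l)
        (fun l _ => by
          have := hterm l (z l) (hz l)
          have : 0 ≤ κ / 2 * z l ^ 2 := by positivity
          linarith) (Finset.mem_univ k)
    rw [Finset.sum_add_distrib] at h2
    have h3 := hterm k (z k) (hz k)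
    have h4 : 0 ≤ κ / 2 * z k ^ 2 := by positivity
    have h5 := hℓ0 k
    constructor <;> linarith
  have hnn : ∀ y : ι → ℝ, (∀ k, 0 < y k ∨ (w k = 0 ∧ y k = 0)) → ∀ k, 0 ≤ y k := by
    intro y hy k
    rcases hy k with h | h
    · exact h.le
    · exact h.2.ge
  rcases isEmpty_or_nonempty ι with hι | hι
  · exact ⟨fun _ => 1, fun k => hι.elim k, fun y _ => by
      rw [show y = fun _ => 1 from funext fun k => hι.elim k]⟩
  have hK0 : 0 ≤ K := by
    have := (hlow (fun _ => 1) (fun _ => zero_le_one) (Classical.arbitrary ι)).1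
    have h2 : 0 ≤ κ / 2 * (1 : ℝ) ^ 2 := by positivity
    linarith
  -- For an admissible vector whose energy does not exceed that of the constant vector `1`, the
  -- number `K` bounds both `κ / 2 * y k ^ 2` and `-w k * log (y k)`. Such vectors lie in the
  -- compact box with sides `[ε k, R]`.
  set ε : ι → ℝ := fun k => if w k = 0 then 0 else Real.exp (-K / w k) with hε
  set R : ℝ := 1 + 2 * K / κ with hR
  have hR1 : 1 ≤ R := by rw [hR]; have : 0 ≤ 2 * K / κ := by positivity
                         linarith
  set S : Set (ι → ℝ) := Set.pi Set.univ fun k => Set.Icc (ε k) R with hS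
  have hε0 : ∀ k, 0 ≤ ε k := by
    intro k; simp only [hε]; split_ifs
    · exact le_rfl
    · positivity
  have hεpos : ∀ k, w k ≠ 0 → 0 < ε k := by
    intro k hk; simp only [hε]; rw [if_neg hk]; positivity
  have hmem : ∀ y : ι → ℝ, (∀ k, 0 < y k ∨ (w k = 0 ∧ y k = 0)) →
      logEnergy Φ w y ≤ logEnergy Φ w (fun _ => 1) → y ∈ S := by
    intro y hy hle k _
    have h1 := hlow y (hnn y hy) k
    refine ⟨?_, ?_⟩
    · simp only [hε]
      split_ifs with hk
      · exact hnn y hy k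
      · have hyk : 0 < y k := (hy k).resolve_right fun h => hk h.1
        have hwk : 0 < w k := lt_of_le_of_ne (hw k) (Ne.symm hk)
        rw [← Real.le_log_iff_exp_le hyk, div_le_iff₀ hwk]
        linarith [h1.2]
    · have h2 : κ / 2 * y k ^ 2 ≤ K := by linarith [h1.1]
      have h3 : y k ^ 2 ≤ 2 * K / κ := by
        rw [le_div_iff₀ hκ]; linarith
      have h4 : 0 ≤ y k := hnn y hy k
      by_contra hcon
      push Not at hcon
      nlinarith
  have h1S : (fun _ => (1 : ℝ)) ∈ S := hmem _ (fun _ => Or.inl one_pos) le_rfl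
  have hcont : ContinuousOn (logEnergy Φ w) S := by
    unfold logEnergy
    refine hΦ.continuousOn.sub (continuousOn_finsetSum _ fun k _ => ?_)
    by_cases hk : w k = 0
    · simp only [hk, zero_mul]; exact continuousOn_const
    · refine continuousOn_const.mul (ContinuousOn.log (by fun_prop) fun z hz => ?_)
      exact ((hεpos k hk).trans_le (hz k (Set.mem_univ k)).1).ne'
  have hcpt : IsCompact S := isCompact_univ_pi fun k => isCompact_Icc
  obtain ⟨z, hz, hmin⟩ := hcpt.exists_isMinOn ⟨_, h1S⟩ hcont
  refine ⟨z, fun k => ?_, fun y hy => ?_⟩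
  · have := (hz k (Set.mem_univ k)).1
    by_cases hk : w k = 0
    · rcases ((hε0 k).trans this).lt_or_eq with h | h
      · exact Or.inl h
      · exact Or.inr ⟨hk, h.symm⟩
    · exact Or.inl ((hεpos k hk).trans_le this)
  · by_cases hle : logEnergy Φ w y ≤ logEnergy Φ w (fun _ => 1)
    · exact hmin (hmem y hy hle)
    · exact (hmin h1S).trans (not_le.1 hle).le

variable [DecidableEq ι]

theorem IsLogMinimizer.le_update {z : ι → ℝ} (hz : IsLogMinimizer Φ w z) (k : ι) {t : ℝ}
    (ht : 0 < t ∨ (w k = 0 ∧ t = 0)) :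
    Φ z - w k * Real.log (z k) ≤ Φ (Function.update z k t) - w k * Real.log t := by
  have h := hz.2 (Function.update z k t) fun l => by
    by_cases hl : l = k
    · subst hl; simpa using ht
    · rw [Function.update_of_ne hl]; exact hz.1 l
  simp only [logEnergy] at h
  rw [← Finset.add_sum_erase _ _ (Finset.mem_univ k),
    ← Finset.add_sum_erase _ (fun l => w l * Real.log (Function.update z k t l))
      (Finset.mem_univ k)] at h
  have e : ∑ l ∈ Finset.univ.erase k, w l * Real.log (Function.update z k t l) =
      ∑ l ∈ Finset.univ.erase k, w l * Real.log (z l) :=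
    Finset.sum_congr rfl fun l hl => by
      rw [Function.update_of_ne (Finset.ne_of_mem_erase hl)]
  rw [e] at h
  simp only [Function.update_self] at h
  linarith

/-- With a negative weight the energy would tend to `-∞` as the variable tends to `0`. Hence
estimates for given minimizers need no separate assumption on the signs of the weights. -/
theorem IsLogMinimizer.weight_nonneg (hΦ : Continuous Φ) {z : ι → ℝ} (hz : IsLogMinimizer Φ w z)
    (k : ι) : 0 ≤ w k := by
  by_contra! hk
  have h1 : Filter.Tendsto (fun t : ℝ => Φ (Function.update z k t) - w k * Real.log t)
      (nhdsWithin 0 (Set.Ioi 0)) Filter.atBot := by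
    have h2 : Filter.Tendsto (fun t : ℝ => Φ (Function.update z k t)) (nhdsWithin 0 (Set.Ioi 0))
        (nhds (Φ (Function.update z k 0))) := by
      have : Continuous fun t : ℝ => Φ (Function.update z k t) :=
        hΦ.comp (continuous_const.update k continuous_id)
      exact (this.tendsto 0).mono_left nhdsWithin_le_nhds
    have h3 := Real.tendsto_log_nhdsGT_zero.const_mul_atBot (neg_pos.2 hk)
    exact (h2.add_atBot h3).congr fun t => by ring
  have h4 := (h1.eventually (Filter.eventually_lt_atBot (Φ z - w k * Real.log (z k)))).and
    self_mem_nhdsWithin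
  obtain ⟨t, ht1, ht2⟩ := h4.exists
  exact absurd (hz.le_update k (Or.inl ht2)) (not_le.2 ht1)

/-- The Euler–Lagrange equation in one coordinate, in a form that covers vanishing weights. -/
theorem IsLogMinimizer.mul_deriv_eq {z : ι → ℝ} (hz : IsLogMinimizer Φ w z) (k : ι)
    (hw : 0 ≤ w k) {g : ℝ}
    (hg : HasDerivAt (fun t => Φ (Function.update z k t)) g (z k)) :
    0 ≤ z k ∧ 0 ≤ g ∧ z k * g = w k := by
  have hle : ∀ t : ℝ, (0 < t ∨ (w k = 0 ∧ t = 0)) →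
      Φ (Function.update z k (z k)) - w k * Real.log (z k) ≤
        Φ (Function.update z k t) - w k * Real.log t := fun t ht => by
    rw [Function.update_eq_self]; exact hz.le_update k ht
  rcases hz.1 k with hk | ⟨hwk, hzk⟩
  · have hd := hg.sub ((Real.hasDerivAt_log hk.ne').const_mul (w k))
    have hmin : IsLocalMin (fun t => Φ (Function.update z k t) - w k * Real.log t) (z k) := by
      filter_upwards [lt_mem_nhds hk] with t ht
      exact hle t (Or.inl ht)
    have h0 := hmin.hasDerivAt_eq_zero hd
    have hg' : g = w k * (z k)⁻¹ := by linarith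
    refine ⟨hk.le, ?_, ?_⟩
    · rw [hg']; positivity
    · rw [hg']; field_simp
  -- At the boundary value `0` only variations to the right are admissible, so the derivative is
  -- merely nonnegative.
  · refine ⟨hzk.ge, ?_, by rw [hzk, hwk, zero_mul]⟩
    have ht := (hasDerivWithinAt_iff_tendsto_slope' (s := Set.Ioi (z k)) (by simp)).1
      hg.hasDerivWithinAt
    refine ge_of_tendsto ht ?_
    filter_upwards [self_mem_nhdsWithin] with t ht
    have ht' : z k < t := ht
    rw [slope_def_field]
    refine div_nonneg ?_ (by linarith)
    have := hle t (Or.inl (by linarith))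
    rw [hwk] at this
    linarith

end LogMinimization

/-- Two nonnegative solutions of `x * g = w` vary in opposite directions. -/
theorem sub_mul_sub_nonpos {x y g h : ℝ} (hx : 0 ≤ x) (hy : 0 ≤ y) (hg : 0 ≤ g) (hh : 0 ≤ h)
    (e : x * g = y * h) : (g - h) * (x - y) ≤ 0 := by
  rcases le_total x y with hxy | hxy
  · rcases hx.eq_or_lt with h0 | h0
    · subst h0
      nlinarith
    · have : h ≤ g := by
        by_contra! hc
        nlinarith
      nlinarith
  · rcases hy.eq_or_lt with h0 | h0
    · subst h0
      nlinarith
    · have : g ≤ h := by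
        by_contra! hc
        nlinarith
      nlinarith

end HardEdge

/-! ### Combes–Thomas estimate for banded, uniformly positive systems. -/

namespace HardEdge

section CombesThomas

theorem summable_exp_neg_abs {ε : ℝ} (hε : 0 < ε) :
    Summable fun m : ℤ => Real.exp (-ε * |(m : ℝ)|) := by
  have h : Summable fun m : ℕ => Real.exp (-ε * (m : ℝ)) := by
    have := Real.summable_exp_nat_mul_iff.2 (neg_lt_zero.2 hε)
    exact this.congr fun m => by ring_nf
  refine Summable.of_nat_of_neg ?_ ?_
  · exact h.congr fun m => by simp
  · exact h.congr fun m => by simp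

theorem sum_exp_neg_abs_le {ι : Type*} [Fintype ι] {pos : ι → ℤ} (hpos : Function.Injective pos)
    {ε : ℝ} (hε : 0 < ε) (p : ℤ) :
    ∑ k, Real.exp (-ε * |((pos k - p : ℤ) : ℝ)|) ≤
      ∑' m : ℤ, Real.exp (-ε * |(m : ℝ)|) := by
  have hinj : Function.Injective fun k => pos k - p := fun a b h => hpos (by simpa using h)
  have := tsum_comp_le_tsum_of_inj (summable_exp_neg_abs hε) (fun _ => (Real.exp_pos _).le) hinj
  rwa [tsum_fintype] at this

theorem sum_near_le {ι : Type*} [Fintype ι] {pos : ι → ℤ} (hpos : Function.Injective pos)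
    (L : ℕ) (p : ℤ) : ∑ k, (if |pos k - p| ≤ L then (1 : ℝ) else 0) ≤ 2 * L + 1 := by
  rw [Finset.sum_boole]
  have h : (Finset.univ.filter fun k => |pos k - p| ≤ L).card ≤
      (Finset.Icc (p - L) (p + L)).card := by
    refine Finset.card_le_card_of_injOn pos (fun k hk => ?_) hpos.injOn
    have := abs_le.1 (Finset.mem_filter.1 hk).2
    exact Finset.mem_coe.2 (Finset.mem_Icc.2 (by omega))
  rw [Int.card_Icc] at h
  have h2 : (p + L + 1 - (p - L)).toNat = 2 * L + 1 := by omega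
  rw [h2] at h
  exact_mod_cast h

/-- Young's inequality with parameter `θ`, followed by the count of at most `2 * L + 1` neighbours
per position. -/
theorem sum_sum_near_le {ι : Type*} [Fintype ι] {pos : ι → ℤ} (hpos : Function.Injective pos)
    (L : ℕ) {θ : ℝ} (hθ : 0 < θ) (x y : ι → ℝ) :
    ∑ k, |x k| * ∑ l, (if |pos l - pos k| ≤ L then |y l| else 0) ≤
      (2 * L + 1) * (θ / 2 * ∑ k, x k ^ 2 + 1 / (2 * θ) * ∑ k, y k ^ 2) := by
  have h1 : ∀ k l, |x k| * (if |pos l - pos k| ≤ L then |y l| else 0) ≤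
      (θ / 2 * x k ^ 2) * (if |pos l - pos k| ≤ L then 1 else 0) +
      (1 / (2 * θ) * y l ^ 2) * (if |pos k - pos l| ≤ L then 1 else 0) := by
    intro k l
    rw [abs_sub_comm (pos k)]
    split_ifs
    · have : θ / 2 * x k ^ 2 + 1 / (2 * θ) * y l ^ 2 - |x k| * |y l| =
          (θ * |x k| - |y l|) ^ 2 / (2 * θ) := by
        rw [← sq_abs (x k), ← sq_abs (y l)]; field_simp; ring
      have h : 0 ≤ (θ * |x k| - |y l|) ^ 2 / (2 * θ) := by positivity
      linarith
    · simp
  calc _ ≤ ∑ k, ∑ l, ((θ / 2 * x k ^ 2) * (if |pos l - pos k| ≤ L then 1 else 0) +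
        (1 / (2 * θ) * y l ^ 2) * (if |pos k - pos l| ≤ L then 1 else 0)) := by
        refine Finset.sum_le_sum fun k _ => ?_
        rw [Finset.mul_sum]
        exact Finset.sum_le_sum fun l _ => h1 k l
    _ = ∑ k, (θ / 2 * x k ^ 2) * ∑ l, (if |pos l - pos k| ≤ L then (1 : ℝ) else 0) +
        ∑ l, (1 / (2 * θ) * y l ^ 2) * ∑ k, (if |pos k - pos l| ≤ L then (1 : ℝ) else 0) := by
        simp only [Finset.sum_add_distrib]
        congr 1
        · simp only [Finset.mul_sum]
        · rw [Finset.sum_comm]; simp only [Finset.mul_sum]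
    _ ≤ ∑ k, (θ / 2 * x k ^ 2) * (2 * L + 1) + ∑ l, (1 / (2 * θ) * y l ^ 2) * (2 * L + 1) := by
        gcongr with k _ l _
        · exact sum_near_le hpos L _
        · exact sum_near_le hpos L _
    _ = _ := by
        rw [← Finset.sum_mul, ← Finset.sum_mul, ← Finset.mul_sum, ← Finset.mul_sum]; ring

set_option maxHeartbeats 1000000 in
/-- Exponential decay for the solutions of uniformly positive definite banded systems. -/
theorem exists_combesThomas {κ C : ℝ} (hκ : 0 < κ) (hC : 0 < C) (L : ℕ) :
    ∃ ε K : ℝ, 0 < ε ∧ 0 < K ∧ ∀ {ι : Type} [Fintype ι] (pos : ι → ℤ) (A : ι → (ι → ℝ) → ℝ)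
      (T : Finset ι) (δ : ι → ℝ) (η B D : ℝ) (k₀ : ι), Function.Injective pos →
      (∀ k x y, A k (x + y) = A k x + A k y) → (∀ k (c : ℝ) x, A k (c • x) = c * A k x) →
      (∀ k x, |A k x| ≤ C * ∑ l, if |pos l - pos k| ≤ L then |x l| else 0) →
      (∀ x, κ * ∑ k, x k ^ 2 ≤ ∑ k, A k x * x k) →
      k₀ ∈ T → 0 ≤ η → 0 ≤ B →
      (∀ k ∉ T, |δ k| ≤ B) → (∀ k ∉ T, δ k ≠ 0 → D ≤ |((pos k - pos k₀ : ℤ) : ℝ)|) →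
      ∑ k ∈ T, Real.exp (-(2 * ε) * |((pos k - pos k₀ : ℤ) : ℝ)|) * (A k δ * δ k) ≤
        η * ∑ k ∈ T, Real.exp (-(2 * ε) * |((pos k - pos k₀ : ℤ) : ℝ)|) * |δ k| →
      |δ k₀| ≤ K * (η + B * Real.exp (-(ε / 2) * D)) := by
  classical
  have hN : (0 : ℝ) < 2 * L + 1 := by positivity
  -- Across a band of width `L` the exponential weight changes by a factor of at most `exp (ε * L)`.
  -- The rate `ε` is taken so small that commuting the weight with `A` costs at most `κ / 4`.
  obtain ⟨ε, hε, hω⟩ : ∃ ε : ℝ, 0 < ε ∧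
      C * (Real.exp (ε * L) - 1) * (2 * L + 1) ≤ κ / 4 := by
    have hc : Filter.Tendsto (fun ε : ℝ => C * (Real.exp (ε * L) - 1) * (2 * L + 1))
        (nhdsWithin 0 (Set.Ioi 0)) (nhds 0) := by
      have : Continuous fun ε : ℝ => C * (Real.exp (ε * L) - 1) * (2 * L + 1) := by fun_prop
      have h := this.tendsto 0
      simp only [zero_mul, Real.exp_zero, sub_self, mul_zero] at h
      exact h.mono_left nhdsWithin_le_nhds
    have h2 := (hc.eventually (gt_mem_nhds (show (0 : ℝ) < κ / 4 by positivity))).and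
      self_mem_nhdsWithin
    obtain ⟨ε, h, h'⟩ := h2.exists
    exact ⟨ε, h', h.le⟩
  set ω := Real.exp (ε * L) - 1 with hωdef
  have hω0 : 0 ≤ ω := by
    have := Real.add_one_le_exp (ε * L)
    have h2 : 0 ≤ ε * L := by positivity
    linarith
  set S := ∑' m : ℤ, Real.exp (-ε * |(m : ℝ)|) with hS
  have hS0 : 0 ≤ S := tsum_nonneg fun _ => (Real.exp_pos _).le
  set θ := κ / (4 * C * (2 * L + 1)) with hθdef
  have hθ : 0 < θ := by positivity
  set Q := C * ((2 * L + 1) * (1 / (2 * θ) * (Real.exp (ε * L) ^ 2 * S))) with hQ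
  have hQ0 : 0 ≤ Q := by positivity
  set K2 := 2 / κ * (2 / κ * S + Q) + 1 with hK2
  have hK20 : 1 ≤ K2 := by
    have : 0 ≤ 2 / κ * (2 / κ * S + Q) := by positivity
    linarith
  refine ⟨ε, K2, hε, by linarith, ?_⟩
  intro ι _ pos A T δ η B D k₀ hpos hadd hsmul hA hpd hk₀ hη hB hδB hδD hsum
  set f : ι → ℝ := fun k => Real.exp (-ε * |((pos k - pos k₀ : ℤ) : ℝ)|) with hf
  have hf0 : ∀ k, 0 < f k := fun k => Real.exp_pos _
  have hf1 : ∀ k, f k ≤ 1 := fun k => by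
    simp only [hf]; rw [Real.exp_le_one_iff]
    have : 0 ≤ ε * |((pos k - pos k₀ : ℤ) : ℝ)| := by positivity
    linarith
  have hfsq : ∀ k, Real.exp (-(2 * ε) * |((pos k - pos k₀ : ℤ) : ℝ)|) = f k ^ 2 := fun k => by
    simp only [hf]; rw [← Real.exp_nat_mul]; congr 1; push_cast; ring
  have hfS : ∑ k, f k ^ 2 ≤ S := by
    refine le_trans (Finset.sum_le_sum fun k _ => ?_) (sum_exp_neg_abs_le hpos hε (pos k₀))
    exact (pow_le_of_le_one (hf0 k).le (hf1 k) two_ne_zero)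
  have hfnear : ∀ k l, |pos l - pos k| ≤ L → f k ≤ Real.exp (ε * L) * f l := by
    intro k l h
    simp only [hf]
    rw [← Real.exp_add, Real.exp_le_exp]
    have h1 : |((pos l - pos k : ℤ) : ℝ)| ≤ L := by
      rw [← Int.cast_abs]; exact_mod_cast h
    have h2 : |((pos l - pos k₀ : ℤ) : ℝ)| ≤
        |((pos l - pos k : ℤ) : ℝ)| + |((pos k - pos k₀ : ℤ) : ℝ)| := by
      refine le_trans (le_of_eq ?_) (abs_add_le _ _)
      push_cast; congr 1; ring
    nlinarith
  simp only [hfsq] at hsum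
  -- `A` is tested on the weighted vector cut off to `T`. The difference `f k • δ - v` is a small
  -- commutator on `T` and is controlled by `b` outside `T`.
  set v : ι → ℝ := fun k => if k ∈ T then f k * δ k else 0 with hv
  set b : ι → ℝ := fun k => if k ∈ T then 0 else Real.exp (ε * L) * (f k * |δ k|) with hb
  have hA2 : ∀ k, |A k (f k • δ - v)| ≤
      C * ∑ l, (if |pos l - pos k| ≤ L then |ω * |v l| + b l| else 0) := by
    intro k
    refine (hA k _).trans (mul_le_mul_of_nonneg_left (Finset.sum_le_sum fun l _ => ?_) hC.le)
    split_ifs with h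
    · rw [Pi.sub_apply, Pi.smul_apply, smul_eq_mul]
      have h1 := hfnear k l h
      have h2 := hfnear l k (by rwa [abs_sub_comm])
      by_cases hl : l ∈ T
      · simp only [hv, hb, if_pos hl, add_zero]
        rw [← sub_mul, abs_mul, abs_of_nonneg (mul_nonneg hω0 (abs_nonneg _)), abs_mul,
          abs_of_pos (hf0 l), ← mul_assoc]
        refine mul_le_mul_of_nonneg_right ?_ (abs_nonneg _)
        rw [abs_le]
        have e1 : 1 ≤ Real.exp (ε * L) := by linarith
        constructor
        · have : (f k - f l) * Real.exp (ε * L) ≥ -(ω * f l) := by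
            simp only [hωdef]; nlinarith
          have h5 : f l - f k ≤ ω * f k := by simp only [hωdef]; nlinarith
          rcases le_total (f k) (f l) with h6 | h6
          · nlinarith
          · nlinarith [hf0 l]
        · simp only [hωdef]; nlinarith
      · simp only [hv, hb, if_neg hl, abs_zero, mul_zero, zero_add, sub_zero]
        rw [abs_mul, abs_of_pos (hf0 k)]
        refine le_trans ?_ (le_abs_self _)
        rw [← mul_assoc]
        exact mul_le_mul_of_nonneg_right h1 (abs_nonneg _)
    · exact le_rfl
  have hsplit : ∀ k, f k * A k δ = A k v + A k (f k • δ - v) := by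
    intro k
    rw [← hadd, ← hsmul]; congr 1; abel
  have e1 : ∑ k, A k v * v k = ∑ k ∈ T, f k ^ 2 * (A k δ * δ k) - ∑ k, A k (f k • δ - v) * v k := by
    have : ∑ k ∈ T, f k ^ 2 * (A k δ * δ k) = ∑ k, (f k * A k δ) * v k := by
      rw [← Finset.sum_filter_add_sum_filter_not Finset.univ (· ∈ T)
        (fun k => (f k * A k δ) * v k)]
      rw [Finset.sum_eq_zero (s := Finset.univ.filter fun k => ¬ k ∈ T)]
      · rw [add_zero, Finset.filter_mem_eq_inter, Finset.univ_inter]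
        refine Finset.sum_congr rfl fun k hk => ?_
        simp only [hv, if_pos hk]; ring
      · intro k hk
        simp only [hv, if_neg (Finset.mem_filter.1 hk).2, mul_zero]
    rw [this, ← Finset.sum_sub_distrib]
    refine Finset.sum_congr rfl fun k _ => ?_
    rw [hsplit]; ring
  have e2 : η * ∑ k ∈ T, f k ^ 2 * |δ k| ≤ κ / 8 * ∑ k, v k ^ 2 + 2 / κ * η ^ 2 * S := by
    have h1 : ∑ k ∈ T, η * (f k ^ 2 * |δ k|) ≤
        ∑ k ∈ T, (κ / 8 * v k ^ 2 + 2 / κ * η ^ 2 * f k ^ 2) := by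
      refine Finset.sum_le_sum fun k hk => ?_
      simp only [hv, if_pos hk]
      have : κ / 8 * (f k * δ k) ^ 2 + 2 / κ * η ^ 2 * f k ^ 2 - η * (f k ^ 2 * |δ k|) =
          (κ * |δ k| - 4 * η) ^ 2 * f k ^ 2 / (8 * κ) := by
        rw [mul_pow, ← sq_abs (δ k)]; field_simp; ring
      have h : 0 ≤ (κ * |δ k| - 4 * η) ^ 2 * f k ^ 2 / (8 * κ) := by positivity
      linarith
    rw [Finset.mul_sum]
    refine h1.trans ?_
    have h2 : ∑ k ∈ T, (κ / 8 * v k ^ 2 + 2 / κ * η ^ 2 * f k ^ 2) ≤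
        ∑ k, (κ / 8 * v k ^ 2 + 2 / κ * η ^ 2 * f k ^ 2) :=
      Finset.sum_le_univ_sum_of_nonneg fun k => by positivity
    refine h2.trans ?_
    rw [Finset.sum_add_distrib, ← Finset.mul_sum, ← Finset.mul_sum]
    gcongr
  -- Of the `κ` available, the commutator uses `κ / 4` by the choice of `ε`, the terms in `b` use `κ
  -- / 8` by the choice of `θ`, and `e2` uses `κ / 8`. Half of `κ` remains.
  have e3 : -∑ k, A k (f k • δ - v) * v k ≤ 3 * κ / 8 * ∑ k, v k ^ 2 +
      C * ((2 * L + 1) * (1 / (2 * θ) * ∑ k, b k ^ 2)) := by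
    have h1 : -∑ k, A k (f k • δ - v) * v k ≤
        C * ∑ k, |v k| * ∑ l, (if |pos l - pos k| ≤ L then |ω * |v l| + b l| else 0) := by
      rw [← Finset.sum_neg_distrib, Finset.mul_sum]
      refine Finset.sum_le_sum fun k _ => ?_
      have := mul_le_mul_of_nonneg_right (hA2 k) (abs_nonneg (v k))
      rw [← abs_mul] at this
      have h3 := neg_abs_le (A k (f k • δ - v) * v k)
      nlinarith
    have h2 : ∑ k, |v k| * ∑ l, (if |pos l - pos k| ≤ L then |ω * |v l| + b l| else 0) ≤
        ω * ∑ k, |v k| * ∑ l, (if |pos l - pos k| ≤ L then |v l| else 0) +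
        ∑ k, |v k| * ∑ l, (if |pos l - pos k| ≤ L then |b l| else 0) := by
      rw [Finset.mul_sum, ← Finset.sum_add_distrib]
      refine Finset.sum_le_sum fun k _ => ?_
      rw [mul_left_comm, ← mul_add]
      refine mul_le_mul_of_nonneg_left ?_ (abs_nonneg _)
      rw [Finset.mul_sum, ← Finset.sum_add_distrib]
      refine Finset.sum_le_sum fun l _ => ?_
      split_ifs
      · refine (abs_add_le _ _).trans ?_
        rw [abs_mul, abs_abs, abs_of_nonneg hω0]
      · simp
    have h3 := sum_sum_near_le hpos L one_pos v v
    have h4 := sum_sum_near_le hpos L hθ v b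
    have h5 : C * ((2 * L + 1) * (θ / 2)) = κ / 8 := by
      simp only [hθdef]; field_simp; ring
    have hv2 : 0 ≤ ∑ k, v k ^ 2 := Finset.sum_nonneg fun k _ => sq_nonneg _
    have h6 : C * (ω * ∑ k, |v k| * ∑ l, (if |pos l - pos k| ≤ L then |v l| else 0)) ≤
        κ / 4 * ∑ k, v k ^ 2 := by
      calc _ ≤ C * (ω * ((2 * L + 1) * (1 / 2 * ∑ k, v k ^ 2 + 1 / (2 * 1) * ∑ k, v k ^ 2))) := by
            gcongr
        _ = C * ω * (2 * L + 1) * ∑ k, v k ^ 2 := by ring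
        _ ≤ _ := by gcongr
    have h7 : C * ∑ k, |v k| * ∑ l, (if |pos l - pos k| ≤ L then |b l| else 0) ≤
        κ / 8 * ∑ k, v k ^ 2 + C * ((2 * L + 1) * (1 / (2 * θ) * ∑ k, b k ^ 2)) := by
      calc _ ≤ C * ((2 * L + 1) * (θ / 2 * ∑ k, v k ^ 2 + 1 / (2 * θ) * ∑ k, b k ^ 2)) := by
            gcongr
        _ = C * ((2 * L + 1) * (θ / 2)) * ∑ k, v k ^ 2 +
            C * ((2 * L + 1) * (1 / (2 * θ) * ∑ k, b k ^ 2)) := by ring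
        _ = _ := by rw [h5]
    have h8 := mul_le_mul_of_nonneg_left h2 hC.le
    rw [mul_add] at h8
    linarith
  -- Of the two factors `f k` in `b k ^ 2`, one provides the decay `exp (-ε * D)` and the other
  -- keeps the sum below `S`, whatever the number of coordinates.
  have e4 : ∑ k, b k ^ 2 ≤ Real.exp (ε * L) ^ 2 * S * (B ^ 2 * Real.exp (-ε * D)) := by
    have h1 : ∀ k, b k ^ 2 ≤ Real.exp (ε * L) ^ 2 * (B ^ 2 * Real.exp (-ε * D)) * f k := by
      intro k
      simp only [hb]
      split_ifs with hk
      · have := hf0 k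
        rw [zero_pow two_ne_zero]; positivity
      · by_cases h0 : δ k = 0
        · have := hf0 k
          rw [h0, abs_zero, mul_zero, mul_zero, zero_pow two_ne_zero]; positivity
        · have hD := hδD k hk h0
          have h2 : f k ≤ Real.exp (-ε * D) := by
            simp only [hf]; rw [Real.exp_le_exp]; nlinarith
          have h3 : |δ k| ^ 2 ≤ B ^ 2 := pow_le_pow_left₀ (abs_nonneg _) (hδB k hk) 2
          have hfk := hf0 k
          calc _ = Real.exp (ε * L) ^ 2 * (|δ k| ^ 2 * f k) * f k := by ring
            _ ≤ Real.exp (ε * L) ^ 2 * (B ^ 2 * Real.exp (-ε * D)) * f k := by gcongr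
    refine (Finset.sum_le_sum fun k _ => h1 k).trans ?_
    rw [← Finset.mul_sum]
    have h5 : ∑ k, f k ≤ S := sum_exp_neg_abs_le hpos hε (pos k₀)
    calc _ ≤ Real.exp (ε * L) ^ 2 * (B ^ 2 * Real.exp (-ε * D)) * S := by gcongr
      _ = _ := by ring
  have e5 : κ / 2 * ∑ k, v k ^ 2 ≤ 2 / κ * S * η ^ 2 + Q * (B ^ 2 * Real.exp (-ε * D)) := by
    have h1 := hpd v
    have h2 : C * ((2 * L + 1) * (1 / (2 * θ) * ∑ k, b k ^ 2)) ≤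
        Q * (B ^ 2 * Real.exp (-ε * D)) := by
      calc _ ≤ C * ((2 * L + 1) * (1 / (2 * θ) *
            (Real.exp (ε * L) ^ 2 * S * (B ^ 2 * Real.exp (-ε * D))))) := by gcongr
        _ = _ := by simp only [hQ]; ring
    linarith
  have e6 : δ k₀ ^ 2 ≤ ∑ k, v k ^ 2 := by
    have h1 : v k₀ ^ 2 ≤ ∑ k, v k ^ 2 :=
      Finset.single_le_sum (f := fun k => v k ^ 2) (fun k _ => sq_nonneg _) (Finset.mem_univ k₀)
    have h2 : v k₀ = δ k₀ := by simp [hv, hf, hk₀]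
    rwa [h2] at h1
  -- The estimate is for squares, so taking the root halves the decay rate.
  set E := B * Real.exp (-(ε / 2) * D) with hE
  have hE2 : E ^ 2 = B ^ 2 * Real.exp (-ε * D) := by
    simp only [hE]; rw [mul_pow, ← Real.exp_nat_mul]; congr 2; push_cast; ring
  have hE0 : 0 ≤ E := by positivity
  rw [← hE2] at e5
  have e7 : δ k₀ ^ 2 ≤ K2 * (η + E) ^ 2 := by
    have h1 : δ k₀ ^ 2 ≤ 2 / κ * (2 / κ * S * η ^ 2 + Q * E ^ 2) := by
      have h3 : κ / 2 * δ k₀ ^ 2 ≤ 2 / κ * S * η ^ 2 + Q * E ^ 2 :=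
        (mul_le_mul_of_nonneg_left e6 (by positivity)).trans e5
      calc δ k₀ ^ 2 = 2 / κ * (κ / 2 * δ k₀ ^ 2) := by field_simp
        _ ≤ _ := by gcongr
    have h2 : 2 / κ * (2 / κ * S * η ^ 2 + Q * E ^ 2) ≤
        2 / κ * ((2 / κ * S + Q) * (η + E) ^ 2) := by
      have : 0 ≤ 2 / κ * S := by positivity
      have h5 : 2 / κ * S * η ^ 2 ≤ 2 / κ * S * (η + E) ^ 2 := by gcongr; linarith
      have h6 : Q * E ^ 2 ≤ Q * (η + E) ^ 2 := by gcongr; linarith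
      have : 0 ≤ 2 / κ := by positivity
      gcongr
      linarith
    have h3 : 0 ≤ (η + E) ^ 2 := sq_nonneg _
    rw [hK2]
    nlinarith
  refine abs_le_of_sq_le_sq' ?_ (by positivity) |> abs_le.2
  rw [mul_pow]
  have : K2 ≤ K2 ^ 2 := by nlinarith
  nlinarith [sq_nonneg (η + E)]

end CombesThomas

end HardEdge

/-! ### The Hessian of the potential and nonlinear comparison of configurations. -/

namespace HardEdge

/-- The coefficients of the derivative of `V (x ^ 2)`. -/
noncomputable def dcoeff (V : ℝ[X]) (m : ℕ) : ℝ := 2 * ((m : ℝ) + 1) * V.coeff (m + 1)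

theorem force_eq (V : ℝ[X]) (r : ℤ → ℝ) (p : ℤ) :
    force V r p = ∑ m ∈ Finset.range V.natDegree, dcoeff V m * walk r (p + 1) (2 * m + 1) m := rfl

theorem force_congr {V : ℝ[X]} {r r' : ℤ → ℝ} {p : ℤ}
    (h : ∀ e : ℤ, |e - p| < 2 * V.natDegree → r e = r' e) : force V r p = force V r' p := by
  refine Finset.sum_congr rfl fun m hm => ?_
  have hm' := Finset.mem_range.1 hm
  rw [walk_congr (2 * m + 1) m fun e h1 h2 => h e (abs_lt.2 ?_)]
  push_cast at h1 h2
  constructor <;> linarith [(by exact_mod_cast hm' : (m : ℤ) < V.natDegree)]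

theorem abs_force_le {V : ℝ[X]} {r : ℤ → ℝ} {p : ℤ} {M : ℝ} (hM : 0 ≤ M)
    (h : ∀ e : ℤ, |e - p| < 2 * V.natDegree → |r e| ≤ M) :
    |force V r p| ≤ ∑ m ∈ Finset.range V.natDegree, |dcoeff V m| * (1 + M) ^ (2 * m + 1) := by
  rw [force_eq]
  refine (Finset.abs_sum_le_sum_abs _ _).trans (Finset.sum_le_sum fun m hm => ?_)
  have hm' := Finset.mem_range.1 hm
  rw [abs_mul]
  refine mul_le_mul_of_nonneg_left (abs_walk_le hM _ _ fun e h1 h2 => h e (abs_lt.2 ?_))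
    (abs_nonneg _)
  push_cast at h1 h2
  constructor <;> linarith [(by exact_mod_cast hm' : (m : ℤ) < V.natDegree)]

/-- The derivative of `force` at `r` in the direction `ε`. -/
noncomputable def dforce (V : ℝ[X]) (r ε : ℤ → ℝ) (p : ℤ) : ℝ :=
  ∑ m ∈ Finset.range V.natDegree, dcoeff V m * dwalk r ε (p + 1) (2 * m + 1) m

theorem dforce_add (V : ℝ[X]) (r ε ε' : ℤ → ℝ) (p : ℤ) :
    dforce V r (fun e => ε e + ε' e) p = dforce V r ε p + dforce V r ε' p := by
  simp only [dforce, dwalk_add, mul_add, Finset.sum_add_distrib]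

theorem dforce_const_mul (V : ℝ[X]) (r ε : ℤ → ℝ) (c : ℝ) (p : ℤ) :
    dforce V r (fun e => c * ε e) p = c * dforce V r ε p := by
  simp only [dforce, dwalk_const_mul, Finset.mul_sum]
  exact Finset.sum_congr rfl fun m _ => by ring

/-- A bound for the derivative of `force`. -/
noncomputable def dforceBound (V : ℝ[X]) (M : ℝ) : ℝ :=
  ∑ m ∈ Finset.range V.natDegree,
    |dcoeff V m| * (((2 * m + 1 : ℕ) : ℝ) * (1 + M) ^ (2 * m + 1))

theorem dforceBound_nonneg (V : ℝ[X]) {M : ℝ} (hM : 0 ≤ M) : 0 ≤ dforceBound V M :=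
  Finset.sum_nonneg fun m _ => by positivity

theorem abs_dforce_le {V : ℝ[X]} {r ε : ℤ → ℝ} {p : ℤ} {M η : ℝ} (hM : 0 ≤ M) (hη : 0 ≤ η)
    (h : ∀ e : ℤ, |e - p| < 2 * V.natDegree → |r e| ≤ M)
    (h' : ∀ e : ℤ, |e - p| < 2 * V.natDegree → |ε e| ≤ η) :
    |dforce V r ε p| ≤ dforceBound V M * η := by
  rw [dforce, dforceBound, Finset.sum_mul]
  refine (Finset.abs_sum_le_sum_abs _ _).trans (Finset.sum_le_sum fun m hm => ?_)
  have hm' := Finset.mem_range.1 hm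
  have hw : ∀ e : ℤ, p + 1 - ((2 * m + 1 : ℕ) : ℤ) < e → e < p + 1 + 2 * (m : ℤ) →
      |e - p| < 2 * V.natDegree := by
    intro e h1 h2
    push_cast at h1 h2
    refine abs_lt.2 ?_
    constructor <;> linarith [(by exact_mod_cast hm' : (m : ℤ) < V.natDegree)]
  rw [abs_mul, mul_assoc]
  exact mul_le_mul_of_nonneg_left (abs_dwalk_le hM hη _ _ (fun e h1 h2 => h e (hw e h1 h2))
    (fun e h1 h2 => h' e (hw e h1 h2))) (abs_nonneg _)

/-- A partial derivative of the potential as a function on the whole chain. -/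
noncomputable def gradSeq (V : ℝ[X]) (s : ℤ → ℝ) (p : ℤ) : ℝ := s p * force V (fun e => s e ^ 2) p

theorem grad_eq_gradSeq {n : ℕ} (V : ℝ[X]) (z : Config n) (k : Coord n) :
    grad V z k = gradSeq V (seq z) (pos k) := by
  rw [grad, gradSeq, seq_pos]

/-- The derivative of `gradSeq` at `s` in the direction `ε`. -/
noncomputable def dgradSeq (V : ℝ[X]) (s ε : ℤ → ℝ) (p : ℤ) : ℝ :=
  ε p * force V (fun e => s e ^ 2) p + s p * dforce V (fun e => s e ^ 2) (fun e => 2 * s e * ε e) p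

theorem dgradSeq_add (V : ℝ[X]) (s ε ε' : ℤ → ℝ) (p : ℤ) :
    dgradSeq V s (fun e => ε e + ε' e) p = dgradSeq V s ε p + dgradSeq V s ε' p := by
  simp only [dgradSeq, mul_add, dforce_add]; ring

theorem dgradSeq_const_mul (V : ℝ[X]) (s ε : ℤ → ℝ) (c : ℝ) (p : ℤ) :
    dgradSeq V s (fun e => c * ε e) p = c * dgradSeq V s ε p := by
  have h : (fun e => 2 * s e * (c * ε e)) = fun e => c * (2 * s e * ε e) := by
    funext e; ring
  simp only [dgradSeq, h, dforce_const_mul]; ring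

theorem hasDerivAt_gradSeq (V : ℝ[X]) {R : ℝ → ℤ → ℝ} {ε : ℤ → ℝ} {τ : ℝ}
    (h : ∀ e, HasDerivAt (fun t => R t e) (ε e) τ) (p : ℤ) :
    HasDerivAt (fun t => gradSeq V (R t) p) (dgradSeq V (R τ) ε p) τ := by
  have h2 : ∀ e, HasDerivAt (fun t => R t e ^ 2) (2 * R τ e * ε e) τ := fun e => by
    have := (h e).fun_pow 2
    exact hasDerivAt_of_eq this (fun _ => rfl) (by norm_num)
  have h3 : HasDerivAt (fun t => force V (fun e => R t e ^ 2) p)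
      (dforce V (fun e => R τ e ^ 2) (fun e => 2 * R τ e * ε e) p) τ := by
    unfold force dforce
    exact HasDerivAt.fun_sum fun m _ =>
      (hasDerivAt_walk (R := fun t e => R t e ^ 2) h2 _ _ _).const_mul _
  exact (h p).mul h3

/-- A bound for the derivative of `gradSeq`. -/
noncomputable def dgradBound (V : ℝ[X]) (M : ℝ) : ℝ :=
  (∑ m ∈ Finset.range V.natDegree, |dcoeff V m| * (1 + M ^ 2) ^ (2 * m + 1)) +
    M * (dforceBound V (M ^ 2) * (2 * M)) + 1

theorem dgradBound_pos (V : ℝ[X]) {M : ℝ} (hM : 0 ≤ M) : 0 < dgradBound V M := by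
  have h1 : 0 ≤ ∑ m ∈ Finset.range V.natDegree, |dcoeff V m| * (1 + M ^ 2) ^ (2 * m + 1) :=
    Finset.sum_nonneg fun m _ => by positivity
  have h2 := dforceBound_nonneg V (sq_nonneg M)
  unfold dgradBound
  positivity

theorem abs_dgradSeq_le {V : ℝ[X]} {s ε : ℤ → ℝ} {p : ℤ} {M : ℝ} (hM : ∀ e, |s e| ≤ M) :
    |dgradSeq V s ε p| ≤ dgradBound V M *
      ∑ e ∈ Finset.Icc (p - (2 * V.natDegree : ℕ)) (p + (2 * V.natDegree : ℕ)), |ε e| := by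
  have hM0 : 0 ≤ M := (abs_nonneg _).trans (hM 0)
  set η := ∑ e ∈ Finset.Icc (p - (2 * V.natDegree : ℕ)) (p + (2 * V.natDegree : ℕ)), |ε e| with hη
  have hη0 : 0 ≤ η := Finset.sum_nonneg fun e _ => abs_nonneg _
  have hle : ∀ e : ℤ, |e - p| ≤ 2 * V.natDegree → |ε e| ≤ η := by
    intro e he
    refine Finset.single_le_sum (f := fun e => |ε e|) (fun e _ => abs_nonneg _)
      (Finset.mem_Icc.2 ?_)
    have := abs_le.1 he
    push_cast
    constructor <;> linarith
  have hsq : ∀ e, |s e ^ 2| ≤ M ^ 2 := fun e => by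
    rw [abs_pow]; exact pow_le_pow_left₀ (abs_nonneg _) (hM e) 2
  have h1 := abs_force_le (V := V) (p := p) (sq_nonneg M) (fun e _ => hsq e)
  have h2 : |dforce V (fun e => s e ^ 2) (fun e => 2 * s e * ε e) p| ≤
      dforceBound V (M ^ 2) * (2 * M * η) := by
    refine abs_dforce_le (sq_nonneg M) (by positivity) (fun e _ => hsq e) fun e he => ?_
    rw [abs_mul, abs_mul, abs_two]
    have := hle e (le_of_lt he)
    have := hM e
    gcongr
  have h3 := hle p (by simp)
  set F := ∑ m ∈ Finset.range V.natDegree, |dcoeff V m| * (1 + M ^ 2) ^ (2 * m + 1) with hF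
  have h4 := hM p
  have h5 := dforceBound_nonneg V (sq_nonneg M)
  calc |dgradSeq V s ε p| ≤ |ε p| * |force V (fun e => s e ^ 2) p| +
        |s p| * |dforce V (fun e => s e ^ 2) (fun e => 2 * s e * ε e) p| := by
        rw [dgradSeq, ← abs_mul, ← abs_mul]; exact abs_add_le _ _
    _ ≤ η * F + M * (dforceBound V (M ^ 2) * (2 * M * η)) := by gcongr
    _ ≤ dgradBound V M * η := by rw [dgradBound, ← hF]; nlinarith

theorem sum_abs_seq_le {n : ℕ} (z : Config n) (p : ℤ) (L : ℕ) :
    ∑ e ∈ Finset.Icc (p - L) (p + L), |seq z e| ≤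
      ∑ l : Coord n, if |pos l - p| ≤ L then |z l| else 0 := by
  calc _ ≤ ∑ e ∈ Finset.Icc (p - L) (p + L), ∑ l : Coord n, if pos l = e then |z l| else 0 := by
        refine Finset.sum_le_sum fun e _ => (Finset.abs_sum_le_sum_abs _ _).trans (le_of_eq ?_)
        refine Finset.sum_congr rfl fun l _ => ?_
        split_ifs <;> simp
    _ = _ := by
        rw [Finset.sum_comm]
        refine Finset.sum_congr rfl fun l _ => ?_
        rw [Finset.sum_ite_eq]
        refine if_congr ?_ rfl rfl
        rw [Finset.mem_Icc, abs_le]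
        constructor <;> rintro ⟨h1, h2⟩ <;> constructor <;> linarith

variable {n : ℕ}

theorem abs_seq_le {z : Config n} {M : ℝ} (hM : 0 ≤ M) (h : ∀ k, |z k| ≤ M) (e : ℤ) :
    |seq z e| ≤ M := by
  by_cases he : ∃ k : Coord n, pos k = e
  · obtain ⟨k, rfl⟩ := he
    rw [seq_pos]; exact h k
  · rw [seq_eq_zero z fun k hk => he ⟨k, hk⟩, abs_zero]; exact hM

theorem hasDerivAt_grad (V : ℝ[X]) (z δ : Config n) (k : Coord n) (τ : ℝ) :
    HasDerivAt (fun t : ℝ => grad V (z + t • δ) k)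
      (dgradSeq V (seq (z + τ • δ)) (seq δ) (pos k)) τ := by
  simp only [grad_eq_gradSeq]
  refine hasDerivAt_gradSeq V (R := fun t => seq (z + t • δ)) (fun e => ?_) (pos k)
  simp only [seq_add_mul]
  have := ((hasDerivAt_id τ).mul_const (seq δ e)).const_add (seq z e)
  exact hasDerivAt_of_eq this (fun _ => rfl) (one_mul _)

theorem dgrad_pos {V : ℝ[X]} {κ : ℝ} (hV : StrongMono V κ) (z δ : Config n) :
    κ * ∑ k, δ k ^ 2 ≤ ∑ k, dgradSeq V (seq z) (seq δ) (pos k) * δ k := by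
  have hd : HasDerivAt (fun t : ℝ => ∑ k, grad V (z + t • δ) k * δ k)
      (∑ k, dgradSeq V (seq z) (seq δ) (pos k) * δ k) 0 := by
    refine HasDerivAt.fun_sum fun k _ => ?_
    have := (hasDerivAt_grad V z δ k 0).mul_const (δ k)
    simpa using this
  have ht := (hasDerivWithinAt_iff_tendsto_slope' (s := Set.Ioi (0 : ℝ)) (by simp)).1
      hd.hasDerivWithinAt
  refine ge_of_tendsto ht ?_
  filter_upwards [self_mem_nhdsWithin] with t ht
  have ht' : 0 < t := ht
  rw [slope_def_field, le_div_iff₀ (by linarith), zero_smul, add_zero, sub_zero]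
  have h := grad_strongMono hV (z + t • δ) z
  simp only [Pi.add_apply, Pi.smul_apply, smul_eq_mul, add_sub_cancel_left] at h
  have e1 : ∑ k, (t * δ k) ^ 2 = t * (t * ∑ k, δ k ^ 2) := by
    simp only [Finset.mul_sum]; exact Finset.sum_congr rfl fun k _ => by ring
  have e2 : ∑ k, (grad V (z + t • δ) k - grad V z k) * (t * δ k) =
      t * (∑ k, grad V (z + t • δ) k * δ k - ∑ k, grad V z k * δ k) := by
    rw [← Finset.sum_sub_distrib]
    simp only [Finset.mul_sum]; exact Finset.sum_congr rfl fun k _ => by ring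
  rw [e1, e2] at h
  have := le_of_mul_le_mul_left (h.trans' (le_of_eq (by ring)) :
      t * (κ * (∑ k, δ k ^ 2) * t) ≤ _) ht'
  exact this

/-- Two configurations whose gradients nearly satisfy the same equations on `T` are close on `T`,
with an exponentially small influence of their difference off `T`. -/
theorem exists_comparison {V : ℝ[X]} {κ : ℝ} (hκ : 0 < κ) (hV : StrongMono V κ) {M : ℝ}
    (hM : 0 ≤ M) : ∃ ε K : ℝ, 0 < ε ∧ 0 < K ∧ ∀ {n : ℕ} (U U' : Config n) (T : Finset (Coord n))
      (η B D : ℝ) (k₀ : Coord n), (∀ k, |U k| ≤ M) → (∀ k, |U' k| ≤ M) →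
      k₀ ∈ T → 0 ≤ η → 0 ≤ B →
      (∀ k ∉ T, |U k - U' k| ≤ B) →
      (∀ k ∉ T, U k ≠ U' k → D ≤ |((pos k - pos k₀ : ℤ) : ℝ)|) →
      (∀ k ∈ T, (grad V U k - grad V U' k) * (U k - U' k) ≤ η * |U k - U' k|) →
      |U k₀ - U' k₀| ≤ K * (η + B * Real.exp (-(ε / 2) * D)) := by
  obtain ⟨ε, K, hε, hK, h⟩ := exists_combesThomas hκ (dgradBound_pos V hM) (2 * V.natDegree)
  refine ⟨ε, K, hε, hK, ?_⟩
  intro n U U' T η B D k₀ hU hU' hk₀ hη hB hB' hD hT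
  set δ : Config n := U - U' with hδ
  set f : Coord n → ℝ := fun k => Real.exp (-(2 * ε) * |((pos k - pos k₀ : ℤ) : ℝ)|) with hf
  have hd : ∀ τ : ℝ, HasDerivAt (fun t : ℝ => ∑ k ∈ T, f k * (grad V (U' + t • δ) k * δ k))
      (∑ k ∈ T, f k * (dgradSeq V (seq (U' + τ • δ)) (seq δ) (pos k) * δ k)) τ := by
    intro τ
    exact HasDerivAt.fun_sum fun k _ => ((hasDerivAt_grad V U' δ k τ).mul_const (δ k)).const_mul _
  -- The mean value theorem for this scalar weighted sum gives one intermediate configuration for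
  -- all coordinates. This is why `exists_combesThomas` assumes a bound on the weighted sum only and
  -- not on the individual `A k δ`.
  obtain ⟨τ, hτ, hslope⟩ := exists_hasDerivAt_eq_slope _ _ zero_lt_one
    (fun τ _ => (hd τ).continuousAt.continuousWithinAt) fun τ _ => hd τ
  set ζ := U' + τ • δ with hζ
  have hζM : ∀ e, |seq ζ e| ≤ M := by
    refine abs_seq_le hM fun k => ?_
    have e : ζ k = (1 - τ) * U' k + τ * U k := by
      simp only [hζ, hδ, Pi.add_apply, Pi.smul_apply, Pi.sub_apply, smul_eq_mul]; ring
    have h1 : 0 ≤ 1 - τ := by linarith [hτ.2]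
    rw [e]
    calc _ ≤ (1 - τ) * |U' k| + τ * |U k| := by
          refine (abs_add_le _ _).trans (le_of_eq ?_)
          rw [abs_mul, abs_mul, abs_of_nonneg h1, abs_of_pos hτ.1]
      _ ≤ (1 - τ) * M + τ * M := by
          have := hτ.1
          have := hU k
          have := hU' k
          gcongr
      _ = M := by ring
  refine h pos (fun k x => dgradSeq V (seq ζ) (seq x) (pos k)) T δ η B D k₀ pos_injective
    (fun k x y => ?_) (fun k c x => ?_) (fun k x => ?_) (dgrad_pos hV ζ) hk₀ hη hB hB'
    (fun k hk hne => hD k hk fun he => hne (by simp [hδ, he])) ?_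
  · rw [← dgradSeq_add]
    congr 1
    funext e
    have := seq_add_mul x y 1 e
    rwa [one_smul, one_mul] at this
  · rw [← dgradSeq_const_mul]
    congr 1
    funext e
    have := seq_add_mul 0 x c e
    rw [zero_add] at this
    rw [this, show seq (0 : Config n) e = 0 by simp [seq], zero_add]
  · exact (abs_dgradSeq_le hζM).trans (mul_le_mul_of_nonneg_left
      (sum_abs_seq_le x (pos k) (2 * V.natDegree)) (dgradBound_pos V hM).le)
  · rw [hslope, one_smul, zero_smul, add_zero, sub_zero, div_one,
      ← Finset.sum_sub_distrib, Finset.mul_sum]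
    refine Finset.sum_le_sum fun k hk => ?_
    have h1 := hT k hk
    have e : U' + δ = U := by simp [hδ]
    rw [e]
    have hfk : 0 < f k := Real.exp_pos _
    have h2 := mul_le_mul_of_nonneg_left h1 hfk.le
    have h3 : δ k = U k - U' k := rfl
    rw [h3]
    simp only [hf] at h2 ⊢
    linarith

end HardEdge

/-! ### A priori bounds, Euler–Lagrange equations, existence and uniqueness. -/

namespace HardEdge

theorem eval_derivative_comp_sq (V : ℝ[X]) (x : ℝ) :
    (derivative (V.comp (X ^ 2))).eval x =
      ∑ m ∈ Finset.range V.natDegree, dcoeff V m * x ^ (2 * m + 1) := by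
  rw [derivative_comp_sq, eval_finsetSum]
  simp [dcoeff]

/-- The sum is the derivative of `x ↦ V (x ^ 2)` at `x = √y`, divided by `x`; this derivative
vanishes at `0`. -/
theorem le_sum_dcoeff_mul_pow {V : ℝ[X]} {κ : ℝ} (hV : StrongMono V κ) {y : ℝ} (hy : 0 < y) :
    κ ≤ ∑ m ∈ Finset.range V.natDegree, dcoeff V m * y ^ m := by
  have h := hV (Real.sqrt y) 0
  have h0 : (derivative (V.comp (X ^ 2))).eval 0 = 0 := by
    rw [eval_derivative_comp_sq]; simp
  have h1 : (derivative (V.comp (X ^ 2))).eval (Real.sqrt y) =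
      Real.sqrt y * ∑ m ∈ Finset.range V.natDegree, dcoeff V m * y ^ m := by
    rw [eval_derivative_comp_sq, Finset.mul_sum]
    refine Finset.sum_congr rfl fun m _ => ?_
    rw [pow_succ, pow_mul, Real.sq_sqrt hy.le]; ring
  rw [h0, h1, sub_zero, sub_zero, mul_comm (Real.sqrt y), mul_assoc, Real.sq_sqrt hy.le,
    Real.mul_self_sqrt hy.le] at h
  exact le_of_mul_le_mul_right h hy

theorem natDegree_pos_of_strongMono {V : ℝ[X]} {κ : ℝ} (hκ : 0 < κ) (hV : StrongMono V κ) :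
    0 < V.natDegree := by
  by_contra! h
  have := le_sum_dcoeff_mul_pow hV one_pos
  rw [Nat.le_zero.1 h] at this
  simp at this
  linarith

/-- A polynomial that stays above `κ > 0` on the positive axis cannot have a negative leading
coefficient. The sign is what makes the top-degree force confining. -/
theorem dcoeff_last_pos {V : ℝ[X]} {κ : ℝ} (hκ : 0 < κ) (hV : StrongMono V κ) :
    0 < dcoeff V (V.natDegree - 1) := by
  have hd := natDegree_pos_of_strongMono hκ hV
  have hd' : V.natDegree - 1 + 1 = V.natDegree := by omega
  have hlc : V.coeff V.natDegree ≠ 0 := by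
    rw [coeff_natDegree, leadingCoeff_ne_zero]
    rintro rfl
    simp at hd
  have hne : dcoeff V (V.natDegree - 1) ≠ 0 := by
    rw [dcoeff, hd']; positivity
  by_contra! hle
  set Q : ℝ[X] := ∑ m ∈ Finset.range V.natDegree, C (dcoeff V m) * X ^ m with hQ
  have hQe : ∀ y, Q.eval y = ∑ m ∈ Finset.range V.natDegree, dcoeff V m * y ^ m := by
    intro y; rw [hQ, eval_finsetSum]; simp
  have hcoeff : Q.coeff (V.natDegree - 1) = dcoeff V (V.natDegree - 1) := by
    rw [hQ, finsetSum_coeff]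
    simp only [coeff_C_mul_X_pow]
    rw [Finset.sum_ite_eq, if_pos (Finset.mem_range.2 (by omega))]
  have hdeg : Q.natDegree = V.natDegree - 1 := by
    refine le_antisymm ?_ (le_natDegree_of_ne_zero (by rw [hcoeff]; exact hne))
    refine natDegree_sum_le_of_forall_le _ _ fun m hm => ?_
    refine (natDegree_C_mul_X_pow_le _ _).trans ?_
    have := Finset.mem_range.1 hm
    omega
  have hlead : Q.leadingCoeff = dcoeff V (V.natDegree - 1) := by
    rw [leadingCoeff, hdeg, hcoeff]
  rcases Nat.eq_zero_or_pos (V.natDegree - 1) with h0 | h0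
  · have h1 := le_sum_dcoeff_mul_pow hV one_pos
    rw [show V.natDegree = 1 by omega] at h1
    rw [h0] at hle
    simp at h1
    linarith
  · have ht := Q.tendsto_atBot_of_leadingCoeff_nonpos
      (natDegree_pos_iff_degree_pos.1 (by omega)) (by rw [hlead]; exact hle)
    obtain ⟨y, h1, h2⟩ := ((ht.eventually (Filter.eventually_lt_atBot κ)).and
      (Filter.eventually_gt_atTop 0)).exists
    have := le_sum_dcoeff_mul_pow hV h2
    rw [← hQe] at this
    linarith

/-- Solutions of the Euler–Lagrange equations are bounded in terms of the prescribed values. -/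
theorem exists_bound {V : ℝ[X]} {κ : ℝ} (hκ : 0 < κ) (hV : StrongMono V κ) (w c : ℝ) :
    ∃ M : ℝ, 0 ≤ M ∧ ∀ {n : ℕ} (z : Config n) (T : Finset (Coord n)),
      (∀ k ∉ T, |z k| ≤ c) → (∀ k ∈ T, z k * grad V z k ≤ w) → ∀ k, |z k| ≤ M := by
  obtain ⟨d, hd⟩ : ∃ d, V.natDegree = d + 1 :=
    ⟨V.natDegree - 1, by have := natDegree_pos_of_strongMono hκ hV; omega⟩
  have hc := dcoeff_last_pos hκ hV
  rw [hd, Nat.add_sub_cancel] at hc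
  set C1 := ∑ m ∈ Finset.range d, |dcoeff V m| * 2 ^ (2 * m + 1) with hC1
  have hC10 : 0 ≤ C1 := Finset.sum_nonneg fun m _ => by positivity
  set M := max (max c 1) ((C1 + |w|) / dcoeff V d) with hM
  have hM1 : 1 ≤ M := (le_max_right c 1).trans (le_max_left _ _)
  refine ⟨M, by linarith, ?_⟩
  intro n z T hT hw k
  have : Nonempty (Coord n) := ⟨k⟩
  -- At a coordinate of largest modulus, `R = z l ^ 2` bounds all squares. The walk crossing only
  -- this edge makes the top-degree term at least `dcoeff V d * R ^ d`, while the term of index `m`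
  -- is at most a multiple of `R ^ m`; so the equation at `l` bounds `R`.
  obtain ⟨l, hl⟩ := Finite.exists_max fun k => |z k|
  refine (hl k).trans ?_
  by_cases hlT : l ∈ T
  · set R := z l ^ 2 with hR
    by_cases hR1 : R ≤ 1
    · have : |z l| ≤ 1 := by rw [← sq_le_one_iff_abs_le_one]; exact hR1
      linarith
    push Not at hR1
    have hr0 : ∀ e, 0 ≤ seq z e ^ 2 := fun e => sq_nonneg _
    have hrR : ∀ e, seq z e ^ 2 ≤ R := fun e => by
      rw [hR, sq_le_sq]; exact abs_seq_le (abs_nonneg _) hl e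
    have hforce : dcoeff V d * R ^ d -
        ∑ m ∈ Finset.range d, |dcoeff V m| * (2 ^ (2 * m + 1) * R ^ m)
        ≤ force V (fun e => seq z e ^ 2) (pos l) := by
      rw [force_eq, hd, Finset.sum_range_succ, sub_eq_neg_add, ← Finset.sum_neg_distrib]
      refine add_le_add (Finset.sum_le_sum fun m _ => ?_) ?_
      · have h1 := walk_le hr0 hrR (pos l + 1) (2 * m + 1) m
        have h2 := walk_nonneg hr0 (pos l + 1) (2 * m + 1) m
        have h3 := neg_abs_le (dcoeff V m)
        have h4 := mul_le_mul_of_nonneg_left h1 (abs_nonneg (dcoeff V m))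
        nlinarith
      · have h1 := pow_le_walk hr0 (pos l) d
        rw [seq_pos] at h1
        exact mul_le_mul_of_nonneg_left h1 hc.le
    have hsum : R * ∑ m ∈ Finset.range d, |dcoeff V m| * (2 ^ (2 * m + 1) * R ^ m) ≤
        C1 * R ^ d := by
      rw [Finset.mul_sum, hC1, Finset.sum_mul]
      refine Finset.sum_le_sum fun m hm => ?_
      have h1 : R ^ (m + 1) ≤ R ^ d :=
        pow_le_pow_right₀ hR1.le (by have := Finset.mem_range.1 hm; omega)
      calc _ = |dcoeff V m| * 2 ^ (2 * m + 1) * R ^ (m + 1) := by ring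
        _ ≤ _ := by gcongr
    have h1 : R * force V (fun e => seq z e ^ 2) (pos l) ≤ w := by
      have := hw l hlT
      rw [grad] at this
      rw [hR, sq, mul_assoc]; exact this
    have h2 : dcoeff V d * R * R ^ d ≤ (C1 + |w|) * R ^ d := by
      have h3 := mul_le_mul_of_nonneg_left hforce (by linarith : 0 ≤ R)
      have h4 : |w| ≤ |w| * R ^ d := le_mul_of_one_le_right (abs_nonneg _) (one_le_pow₀ hR1.le)
      have h5 := le_abs_self w
      nlinarith
    have h3 : R ≤ (C1 + |w|) / dcoeff V d := by
      rw [le_div_iff₀ hc, mul_comm]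
      exact le_of_mul_le_mul_right h2 (by positivity)
    have h4 : |z l| ≤ R := by
      have h5 : |z l| ^ 2 = R := sq_abs _
      nlinarith [abs_nonneg (z l)]
    exact (h4.trans h3).trans (le_max_right _ _)
  · exact (hT l hlT).trans ((le_max_left c 1).trans (le_max_left _ _))

variable {n : ℕ}

theorem one_le_site (k : Coord n) : 1 ≤ site k := by rcases k with k | k <;> simp [site]

theorem site_le (k : Coord n) : site k ≤ n := by rcases k with k | k <;> simp only [site] <;> omega

theorem abs_site_sub_le (k l : Coord n) : |(site k : ℤ) - site l| ≤ |pos k - pos l| := by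
  rcases k with k | k <;> rcases l with l | l <;> simp only [site, pos] <;> push_cast <;>
    rw [abs_le] <;> rcases abs_cases (2 * (k : ℤ) - 2 * l) <;>
    rcases abs_cases (2 * (k : ℤ) - (2 * l + 1)) <;>
    rcases abs_cases (2 * (k : ℤ) + 1 - 2 * l) <;>
    rcases abs_cases (2 * (k : ℤ) + 1 - (2 * l + 1)) <;> constructor <;> omega

theorem abs_site_sub_le_of_abs_pos_sub_le {k l : Coord n} {d : ℕ}
    (h : |pos k - pos l| ≤ 2 * d) : |(site k : ℤ) - site l| ≤ d := by
  rw [abs_le] at h ⊢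
  rcases k with k | k <;> rcases l with l | l <;> simp only [site, pos] at h ⊢ <;>
    constructor <;> omega

theorem weight_le {β a : ℝ} (hβ : 1 ≤ β) (k : Coord n) : weight β a k ≤ 1 + |a| := by
  have hn : (1 : ℝ) ≤ n := by
    have := (one_le_site k).trans (site_le k)
    exact_mod_cast this
  have h0 : 0 ≤ 1 / (n * β) := by positivity
  have h1 : ((site k : ℕ) : ℝ) / n ≤ 1 := by
    rw [div_le_one (by linarith)]; exact_mod_cast site_le k
  have h2 : a / n ≤ |a| := by
    rw [div_le_iff₀ (by linarith)]
    nlinarith [le_abs_self a, abs_nonneg a]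
  have h3 := abs_nonneg a
  rcases k with k | k
  · simp only [site, weight] at h1 ⊢
    push_cast at h1
    linarith
  · simp only [site, weight] at h1 ⊢
    push_cast at h1
    linarith

/-- For `β ≥ 1` and `a > -1` only the weight of `x₁`, which is `(1 + a - 1 / β) / n`, can be
negative. -/
theorem weight_nonneg {β a : ℝ} (hβ : 1 ≤ β) (ha : -1 < a) (k : Coord n)
    (h : 0 ≤ 1 + a - 1 / β ∨ 2 ≤ site k) : 0 ≤ weight β a k := by
  have hn : (0 : ℝ) < n := by
    have := (one_le_site k).trans (site_le k)
    exact_mod_cast this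
  have hβ1 : 1 / β ≤ 1 := by rw [div_le_one (by linarith)]; exact hβ
  have e : 1 / (n * β) = 1 / β / n := by field_simp
  rcases k with k | k
  · have hk : 0 ≤ (k : ℝ) + 1 + a - 1 / β := by
      rcases h with h | h
      · have : (0 : ℝ) ≤ k := Nat.cast_nonneg _
        linarith
      · simp only [site] at h
        have : (1 : ℝ) ≤ (k : ℕ) := by exact_mod_cast (by omega : 1 ≤ (k : ℕ))
        linarith
    have : weight β a (Sum.inl k : Coord n) = ((k : ℝ) + 1 + a - 1 / β) / n := by
      simp only [weight]; rw [e]; ring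
    rw [this]; positivity
  · have hk : 0 ≤ (k : ℝ) + 1 - 1 / β := by
      have : (0 : ℝ) ≤ k := Nat.cast_nonneg _
      linarith
    have : weight β a (Sum.inr k : Coord n) = ((k : ℝ) + 1 - 1 / β) / n := by
      simp only [weight]; rw [e]; ring
    rw [this]; positivity

theorem hasDerivAt_potential_single (V : ℝ[X]) (z : Config n) (k : Coord n) :
    HasDerivAt (fun t : ℝ => potential V (z + (t - z k) • Pi.single k 1)) (grad V z k) (z k) := by
  have h := hasDerivAt_potential V z (Pi.single k 1) (z k - z k)
  have h2 := h.comp_sub_const (z k) (z k)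
  refine hasDerivAt_of_eq h2 (fun _ => rfl) ?_
  rw [sub_self, zero_smul, add_zero, Finset.sum_eq_single k]
  · simp
  · intro l _ hl
    rw [Pi.single_eq_of_ne hl, mul_zero]
  · simp

/-- The Euler–Lagrange equations at the coordinate `k`. -/
def IsCritical (V : ℝ[X]) (β a : ℝ) (z : Config n) (k : Coord n) : Prop :=
  0 ≤ weight β a k ∧ 0 ≤ z k ∧ 0 ≤ grad V z k ∧ z k * grad V z k = weight β a k

theorem isMinimizer_iff {V : ℝ[X]} {β a : ℝ} {z : Config n} :
    IsMinimizer V β a z ↔ IsLogMinimizer (potential V) (weight β a) z := Iff.rfl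

theorem IsMinimizer.isCritical {V : ℝ[X]} {β a : ℝ} {z : Config n} (hz : IsMinimizer V β a z)
    (k : Coord n) : IsCritical V β a z k := by
  have hz' := isMinimizer_iff.1 hz
  have hw := hz'.weight_nonneg (continuous_potential V) k
  refine ⟨hw, hz'.mul_deriv_eq k hw ?_⟩
  refine hasDerivAt_of_eq (hasDerivAt_potential_single V z k) (fun t => ?_) rfl
  congr 1
  funext l
  by_cases hl : l = k
  · subst hl; simp
  · simp [Function.update_of_ne hl, Pi.single_eq_of_ne hl]

section Conditional

variable {d i₀ i₁ : ℕ}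

theorem glue_of_mem (q : Values n (boundary n d i₀ i₁)) (u : Values n (Finset.Icc i₀ i₁))
    {k : Coord n} (h : site k ∈ Finset.Icc i₀ i₁) : glue q u k = u ⟨k, h⟩ := dif_pos h

theorem glue_of_mem_boundary (q : Values n (boundary n d i₀ i₁))
    (u : Values n (Finset.Icc i₀ i₁)) {k : Coord n} (h : site k ∉ Finset.Icc i₀ i₁)
    (h' : site k ∈ boundary n d i₀ i₁) : glue q u k = q ⟨k, h'⟩ := by
  rw [glue, dif_neg h, dif_pos h']

theorem glue_of_notMem (q : Values n (boundary n d i₀ i₁))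
    (u : Values n (Finset.Icc i₀ i₁)) {k : Coord n} (h : site k ∉ Finset.Icc i₀ i₁)
    (h' : site k ∉ boundary n d i₀ i₁) : glue q u k = 0 := by
  rw [glue, dif_neg h, dif_neg h']

theorem abs_glue_le {q : Values n (boundary n d i₀ i₁)} {u : Values n (Finset.Icc i₀ i₁)}
    {k : Coord n} (h : site k ∉ Finset.Icc i₀ i₁) : |glue q u k| ≤ ‖q‖ := by
  by_cases h' : site k ∈ boundary n d i₀ i₁
  · rw [glue_of_mem_boundary q u h h', ← Real.norm_eq_abs]
    exact norm_le_pi_norm q _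
  · rw [glue_of_notMem q u h h', abs_zero]
    exact norm_nonneg _

theorem abs_glue_sub_glue_le {q q' : Values n (boundary n d i₀ i₁)}
    {u u' : Values n (Finset.Icc i₀ i₁)} {k : Coord n} (h : site k ∉ Finset.Icc i₀ i₁) :
    |glue q u k - glue q' u' k| ≤ ‖q - q'‖ := by
  by_cases h' : site k ∈ boundary n d i₀ i₁
  · rw [glue_of_mem_boundary q u h h', glue_of_mem_boundary q' u' h h', ← Real.norm_eq_abs]
    exact norm_le_pi_norm (q - q') _
  · rw [glue_of_notMem q u h h', glue_of_notMem q' u' h h', sub_zero, abs_zero]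
    exact norm_nonneg _

theorem continuous_glue (q : Values n (boundary n d i₀ i₁)) :
    Continuous (glue (i₀ := i₀) (i₁ := i₁) q) := by
  refine continuous_pi fun k => ?_
  by_cases h : site k ∈ Finset.Icc i₀ i₁
  · simp only [glue_of_mem q _ h]; fun_prop
  · by_cases h' : site k ∈ boundary n d i₀ i₁
    · simp only [glue_of_mem_boundary q _ h h']; exact continuous_const
    · simp only [glue_of_notMem q _ h h']; exact continuous_const

/-- The force at an edge sees chain positions at distance less than `2 * V.natDegree`, hence indices
at distance at most `V.natDegree`: for an edge in `I` these all lie in `I` or `∂I`. -/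
theorem grad_glue_restrict (V : ℝ[X]) (z : Config n) {k : Coord n}
    (hk : site k ∈ Finset.Icc i₀ i₁) :
    grad V (glue (restrict z (boundary n V.natDegree i₀ i₁)) (restrict z (Finset.Icc i₀ i₁))) k =
      grad V z k := by
  have hglue : ∀ l : Coord n, |(site l : ℤ) - site k| ≤ V.natDegree →
      glue (restrict z (boundary n V.natDegree i₀ i₁)) (restrict z (Finset.Icc i₀ i₁)) l = z l := by
    intro l hl
    by_cases h : site l ∈ Finset.Icc i₀ i₁
    · rw [glue_of_mem _ _ h]; rfl
    · rw [glue_of_mem_boundary _ _ h]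
      · rfl
      · rw [boundary, Finset.mem_filter, Finset.mem_Icc]
        rw [Finset.mem_Icc] at h hk
        refine ⟨⟨one_le_site l, site_le l⟩, ?_⟩
        have := abs_le.1 hl
        omega
  rw [grad, grad, hglue k (by simp)]
  congr 1
  refine force_congr fun e he => ?_
  by_cases h : ∃ l : Coord n, pos l = e
  · obtain ⟨l, rfl⟩ := h
    rw [seq_pos, seq_pos, hglue l (abs_site_sub_le_of_abs_pos_sub_le (le_of_lt he))]
  · push Not at h
    rw [seq_eq_zero _ h, seq_eq_zero _ h]

variable {V : ℝ[X]} {β a : ℝ} {q : Values n (boundary n V.natDegree i₀ i₁)}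

theorem isCondMinimizer_iff {u : Values n (Finset.Icc i₀ i₁)} :
    IsCondMinimizer V β a q u ↔
      IsLogMinimizer (fun u => potential V (glue q u)) (fun k => weight β a k.1) u := Iff.rfl

theorem IsCondMinimizer.isCritical {u : Values n (Finset.Icc i₀ i₁)}
    (hu : IsCondMinimizer V β a q u) {k : Coord n} (hk : site k ∈ Finset.Icc i₀ i₁) :
    IsCritical V β a (glue q u) k := by
  have hu' := isCondMinimizer_iff.1 hu
  have hw := hu'.weight_nonneg ((continuous_potential V).comp (continuous_glue q)) ⟨k, hk⟩
  refine ⟨hw, ?_⟩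
  rw [glue_of_mem q u hk]
  refine hu'.mul_deriv_eq ⟨k, hk⟩ hw ?_
  have h := hasDerivAt_potential_single V (glue q u) k
  rw [glue_of_mem q u hk] at h
  refine hasDerivAt_of_eq h (fun t => ?_) rfl
  congr 1
  funext l
  by_cases hl : site l ∈ Finset.Icc i₀ i₁
  · simp only [Pi.add_apply, Pi.smul_apply, glue_of_mem q _ hl]
    by_cases hlk : l = k
    · subst hlk; simp
    · rw [Function.update_of_ne (by simpa using hlk), Pi.single_eq_of_ne hlk]; simp
  · have hlk : l ≠ k := fun h => hl (h ▸ hk)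
    simp only [Pi.add_apply, Pi.smul_apply, Pi.single_eq_of_ne hlk, smul_zero, add_zero]
    simp only [glue, dif_neg hl]

theorem IsCritical.sub_mul_sub_nonpos {z z' : Config n} {k : Coord n}
    (h : IsCritical V β a z k) (h' : IsCritical V β a z' k) :
    (grad V z k - grad V z' k) * (z k - z' k) ≤ 0 :=
  HardEdge.sub_mul_sub_nonpos h.2.1 h'.2.1 h.2.2.1 h'.2.2.1 (h.2.2.2.trans h'.2.2.2.symm)

/-- Between two minimizers the gradients are strongly monotone, while the Euler–Lagrange equations
give the opposite sign in every coordinate; so the distance is zero. -/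
theorem existsUnique_isMinimizer {κ : ℝ} (hκ : 0 < κ) (hV : StrongMono V κ) (hβ : 1 ≤ β)
    (ha : -1 < a) (h : 0 ≤ 1 + a - 1 / β) : ∃! z : Config n, IsMinimizer V β a z := by
  obtain ⟨z, hz⟩ := exists_isLogMinimizer (continuous_potential (n := n) V)
    (fun k => weight_nonneg hβ ha k (Or.inl h)) (half_pos hκ) (potential_zero_add_le hV)
  refine ⟨z, hz, fun y hy => ?_⟩
  have h1 := grad_strongMono hV y z
  have h2 : ∑ k, (grad V y k - grad V z k) * (y k - z k) ≤ 0 :=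
    Finset.sum_nonpos fun k _ =>
      (IsMinimizer.isCritical hy k).sub_mul_sub_nonpos (IsMinimizer.isCritical hz k)
  have h3 : ∑ k, (y k - z k) ^ 2 ≤ 0 := by
    by_contra! hc
    nlinarith
  funext k
  have h4 := (Finset.sum_eq_zero_iff_of_nonneg fun k _ => sq_nonneg (y k - z k)).1
    (le_antisymm h3 (Finset.sum_nonneg fun k _ => sq_nonneg _)) k (Finset.mem_univ k)
  exact sub_eq_zero.1 (pow_eq_zero_iff two_ne_zero |>.1 h4)

theorem existsUnique_isCondMinimizer {κ : ℝ} (hκ : 0 < κ) (hV : StrongMono V κ) (hβ : 1 ≤ β)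
    (ha : -1 < a) (h : 0 ≤ 1 + a - 1 / β ∨ 2 ≤ i₀) :
    ∃! u : Values n (Finset.Icc i₀ i₁), IsCondMinimizer V β a q u := by
  have hw : ∀ k : {k : Coord n // site k ∈ Finset.Icc i₀ i₁}, 0 ≤ weight β a k.1 := fun k =>
    weight_nonneg hβ ha k.1 (h.imp_right fun h => h.trans (Finset.mem_Icc.1 k.2).1)
  have hcoer : ∀ u : Values n (Finset.Icc i₀ i₁),
      potential V (0 : Config n) + κ / 2 * ∑ k, u k ^ 2 ≤ potential V (glue q u) := by
    intro u
    refine le_trans ?_ (potential_zero_add_le hV (glue q u))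
    gcongr
    calc ∑ k, u k ^ 2 = ∑ k : {k : Coord n // site k ∈ Finset.Icc i₀ i₁}, glue q u k.1 ^ 2 :=
          Finset.sum_congr rfl fun k _ => by rw [glue_of_mem q u k.2]
      _ = ∑ k ∈ Finset.univ.filter fun k : Coord n => site k ∈ Finset.Icc i₀ i₁,
            glue q u k ^ 2 := by
          rw [Finset.sum_subtype (p := fun k : Coord n => site k ∈ Finset.Icc i₀ i₁)
            (Finset.univ.filter fun k : Coord n => site k ∈ Finset.Icc i₀ i₁)
            (fun k => by simp) (fun k => glue q u k ^ 2)]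
      _ ≤ _ := Finset.sum_le_univ_sum_of_nonneg fun k => sq_nonneg _
  obtain ⟨z, hz⟩ := exists_isLogMinimizer ((continuous_potential V).comp (continuous_glue q))
    hw (half_pos hκ) hcoer
  refine ⟨z, hz, fun y hy => ?_⟩
  have h1 := grad_strongMono hV (glue q y) (glue q z)
  have h2 : ∑ k, (grad V (glue q y) k - grad V (glue q z) k) * (glue q y k - glue q z k) ≤ 0 :=
    Finset.sum_nonpos fun k _ => by
      by_cases hk : site k ∈ Finset.Icc i₀ i₁
      · exact (IsCondMinimizer.isCritical hy hk).sub_mul_sub_nonpos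
          (IsCondMinimizer.isCritical hz hk)
      · simp only [glue, dif_neg hk, sub_self, mul_zero, le_refl]
  have h3 : ∑ k, (glue q y k - glue q z k) ^ 2 ≤ 0 := by
    by_contra! hc
    nlinarith
  funext k
  have h4 := (Finset.sum_eq_zero_iff_of_nonneg fun k _ =>
    sq_nonneg (glue q y k - glue q z k)).1
    (le_antisymm h3 (Finset.sum_nonneg fun k _ => sq_nonneg _)) k.1 (Finset.mem_univ k.1)
  rw [glue_of_mem q y k.2, glue_of_mem q z k.2] at h4
  exact sub_eq_zero.1 (pow_eq_zero_iff two_ne_zero |>.1 h4)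

end Conditional

end HardEdge

/-! ### Exponential decay of the influence of the boundary values. -/

namespace HardEdge

/-- Only `x_i` and `y_i` have index `i`, so `isLeft` injects the relevant coordinates into `Bool`.
-/
theorem deviation_le {n i₀ i₁ i : ℕ} {u : Values n (Finset.Icc i₀ i₁)} {z : Config n} {B : ℝ}
    (hB : 0 ≤ B) (h : ∀ k, site k.1 = i → |u k - z k.1| ≤ B) : deviation u z i ≤ 2 * B := by
  rw [deviation, ← Finset.sum_filter]
  have hcard : (Finset.univ.filter fun k : {k : Coord n // site k ∈ Finset.Icc i₀ i₁} =>
      site k.1 = i).card ≤ (Finset.univ : Finset Bool).card := by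
    refine Finset.card_le_card_of_injOn (fun k => k.1.isLeft)
      (fun _ _ => Finset.mem_coe.2 (Finset.mem_univ _)) ?_
    intro k hk l hl hkl
    have h1 := (Finset.mem_filter.1 hk).2
    have h2 := (Finset.mem_filter.1 hl).2
    obtain ⟨k, hk'⟩ := k
    obtain ⟨l, hl'⟩ := l
    rcases k with k | k <;> rcases l with l | l <;> simp [site] at h1 h2 hkl ⊢ <;>
      (have e : k = l := Fin.ext (by omega)
       subst e
       rfl)
  have h2 := Finset.sum_le_card_nsmul (Finset.univ.filter
    fun k : {k : Coord n // site k ∈ Finset.Icc i₀ i₁} => site k.1 = i)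
    (fun k => |u k - z k.1|) B fun k hk => h k (Finset.mem_filter.1 hk).2
  refine h2.trans ?_
  rw [nsmul_eq_mul]
  refine mul_le_mul_of_nonneg_right ?_ hB
  rw [Finset.card_univ, Fintype.card_bool] at hcard
  exact_mod_cast hcard

/-- `exists_comparison` with `T` the coordinates in `I`. Glued configurations agree outside `I ∪
∂I`, where both vanish, and distances of indices are at most distances on the chain. The result is
stated for all larger `c` so that constants can be merged. -/
theorem exists_cond_comparison {V : ℝ[X]} {κ : ℝ} (hκ : 0 < κ) (hV : StrongMono V κ) {M : ℝ}
    (hM : 0 ≤ M) : ∃ c₀ : ℝ, 0 < c₀ ∧ ∀ c ≥ c₀, ∀ {n i₀ i₁ : ℕ}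
      (q q' : Values n (boundary n V.natDegree i₀ i₁)) (u u' : Values n (Finset.Icc i₀ i₁))
      (η : ℝ), 0 ≤ η → (∀ k, |glue q u k| ≤ M) → (∀ k, |glue q' u' k| ≤ M) →
      (∀ k : Coord n, site k ∈ Finset.Icc i₀ i₁ →
        (grad V (glue q u) k - grad V (glue q' u') k) * (glue q u k - glue q' u' k) ≤
          η * |glue q u k - glue q' u' k|) →
      ∀ k, |u k - u' k| ≤ c * (η + ‖q - q'‖ *
        Real.exp (-distBoundary n V.natDegree i₀ i₁ (site k.1) / c)) := by
  obtain ⟨ε, K, hε, hK, h⟩ := exists_comparison hκ hV hM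
  refine ⟨max K (2 / ε), lt_max_of_lt_left hK, ?_⟩
  intro c hc n i₀ i₁ q q' u u' η hη hU hU' hT k
  have hcK : K ≤ c := (le_max_left _ _).trans hc
  have hcε : 2 / ε ≤ c := (le_max_right _ _).trans hc
  have hc0 : 0 < c := hK.trans_le hcK
  set D := distBoundary n V.natDegree i₀ i₁ (site k.1) with hD
  have hD0 : 0 ≤ D := Metric.infDist_nonneg
  have hmain := h (glue q u) (glue q' u')
    (Finset.univ.filter fun k : Coord n => site k ∈ Finset.Icc i₀ i₁) η ‖q - q'‖ D k.1 hU hU'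
    (Finset.mem_filter.2 ⟨Finset.mem_univ _, k.2⟩) hη (norm_nonneg _)
    (fun l hl => abs_glue_sub_glue_le fun hl' => hl (Finset.mem_filter.2 ⟨Finset.mem_univ _, hl'⟩))
    (fun l hl hne => ?_) (fun l hl => hT l (Finset.mem_filter.1 hl).2)
  · rw [glue_of_mem q u k.2, glue_of_mem q' u' k.2] at hmain
    refine hmain.trans ?_
    gcongr
    rw [neg_mul, neg_div, neg_le_neg_iff, div_le_iff₀ hc0]
    rw [div_le_iff₀ hε] at hcε
    nlinarith
  · have hl' : site l ∉ Finset.Icc i₀ i₁ := fun hl' =>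
      hl (Finset.mem_filter.2 ⟨Finset.mem_univ _, hl'⟩)
    have hb : site l ∈ boundary n V.natDegree i₀ i₁ := by
      by_contra hb
      exact hne (by rw [glue_of_notMem _ _ hl' hb, glue_of_notMem _ _ hl' hb])
    refine (Metric.infDist_le_dist_of_mem (Finset.mem_coe.2 hb)).trans ?_
    rw [Nat.dist_eq, abs_sub_comm, ← Int.cast_abs]
    have h1 := abs_site_sub_le l k.1
    exact_mod_cast h1

theorem abs_glue_restrict_le {n d i₀ i₁ : ℕ} {z : Config n} {M : ℝ} (hM : 0 ≤ M)
    (hz : ∀ k, |z k| ≤ M) (k : Coord n) :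
    |glue (restrict z (boundary n d i₀ i₁)) (restrict z (Finset.Icc i₀ i₁)) k| ≤ M := by
  by_cases h1 : site k ∈ Finset.Icc i₀ i₁
  · rw [glue_of_mem _ _ h1]; exact hz k
  · by_cases h2 : site k ∈ boundary n d i₀ i₁
    · rw [glue_of_mem_boundary _ _ h1 h2]; exact hz k
    · rw [glue_of_notMem _ _ h1 h2, abs_zero]; exact hM

/-- Minimizers are bounded uniformly in `n`. -/
theorem exists_minimizer_bound {V : ℝ[X]} {κ : ℝ} (hκ : 0 < κ) (hV : StrongMono V κ) {β : ℝ}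
    (hβ : 1 ≤ β) (a c' : ℝ) : ∃ M : ℝ, 0 ≤ M ∧
      (∀ {n : ℕ} (z : Config n), IsMinimizer V β a z → ∀ k, |z k| ≤ M) ∧
      ∀ {n i₀ i₁ : ℕ} (q : Values n (boundary n V.natDegree i₀ i₁))
        (u : Values n (Finset.Icc i₀ i₁)), ‖q‖ ≤ c' →
        IsCondMinimizer V β a q u → ∀ k, |glue q u k| ≤ M := by
  obtain ⟨M, hM, hbound⟩ := exists_bound hκ hV (1 + |a|) c'
  refine ⟨M, hM, fun z hz => ?_, fun {n i₀ i₁} q u hq hu => ?_⟩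
  · exact hbound z Finset.univ (fun k hk => absurd (Finset.mem_univ k) hk)
      fun k _ => (hz.isCritical k).2.2.2.trans_le (weight_le hβ k)
  · exact hbound (glue q u) (Finset.univ.filter fun k => site k ∈ Finset.Icc i₀ i₁)
      (fun k hk => (abs_glue_le fun hk' =>
        hk (Finset.mem_filter.2 ⟨Finset.mem_univ _, hk'⟩)).trans hq)
      fun k hk => (hu.isCritical (Finset.mem_filter.1 hk).2).2.2.2.trans_le (weight_le hβ k)

theorem exists_decay {V : ℝ[X]} {κ : ℝ} (hκ : 0 < κ) (hV : StrongMono V κ) {β : ℝ} (hβ : 1 ≤ β)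
    (a c' : ℝ) : ∃ c₀ : ℝ, 0 < c₀ ∧ ∀ c ≥ c₀, ∀ {n i₀ i₁ : ℕ}
      (q : Values n (boundary n V.natDegree i₀ i₁)), ‖q‖ ≤ c' →
      ∀ (z : Config n) (u : Values n (Finset.Icc i₀ i₁)),
      IsMinimizer V β a z → IsCondMinimizer V β a q u → ∀ i,
        deviation u z i ≤
          c * ‖q - restrict z (boundary n V.natDegree i₀ i₁)‖ *
            Real.exp (-distBoundary n V.natDegree i₀ i₁ i / c) := by
  obtain ⟨M, hM, hbound⟩ := exists_minimizer_bound hκ hV hβ a c'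
  obtain ⟨c₀, hc₀, h⟩ := exists_cond_comparison hκ hV hM
  refine ⟨2 * c₀, by positivity, ?_⟩
  intro c hc n i₀ i₁ q hq z u hz hu i
  have hu' := hbound.2 q u hq hu
  have hzg := abs_glue_restrict_le (d := V.natDegree) (i₀ := i₀) (i₁ := i₁) hM
    (hbound.1 z hz)
  have hc2 : 0 < c := by linarith
  refine (deviation_le (B := c₀ * (0 + ‖q - restrict z (boundary n V.natDegree i₀ i₁)‖ *
    Real.exp (-distBoundary n V.natDegree i₀ i₁ i / c₀))) (by positivity) fun k hk => ?_).trans ?_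
  · have := h c₀ le_rfl q (restrict z _) u (restrict z _) 0 le_rfl hu' hzg (fun l hl => ?_) k
    · rw [hk] at this; exact this
    · rw [grad_glue_restrict V z hl, zero_mul, glue_of_mem (restrict z _) _ hl]
      exact (hu.isCritical hl).sub_mul_sub_nonpos (hz.isCritical l)
  · have hD0 : 0 ≤ distBoundary n V.natDegree i₀ i₁ i := Metric.infDist_nonneg
    rw [zero_add, ← mul_assoc, ← mul_assoc]
    gcongr ?_ * _ * Real.exp ?_
    rw [neg_div, neg_div, neg_le_neg_iff]
    gcongr
    linarith

end HardEdge

/-! ### The coarse equation, the function `φ` and the integral of `1 / φ`. -/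

namespace HardEdge

theorem integral_four_mul_sin_sq_pow (r : ℝ) (m : ℕ) :
    ∫ x in (0 : ℝ)..Real.pi, (4 * r * Real.sin x ^ 2) ^ m =
      Real.pi * (((2 * m).choose m : ℕ) * r ^ m) := by
  have h : ∀ m : ℕ, (4 : ℝ) ^ m * ∏ i ∈ Finset.range m, (2 * (i : ℝ) + 1) / (2 * i + 2) =
      (m.centralBinom : ℕ) := by
    intro m
    induction m with
    | zero => simp
    | succ m ih =>
      have h1 := Nat.succ_mul_centralBinom_succ m
      have h2 : ((m : ℝ) + 1) * ((m + 1).centralBinom : ℕ) =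
          2 * (2 * m + 1) * (m.centralBinom : ℕ) := by
        exact_mod_cast h1
      have h3 : ((m : ℝ) + 1) ≠ 0 := by positivity
      refine mul_left_cancel₀ h3 ?_
      rw [h2, ← ih, Finset.prod_range_succ]
      field_simp
      ring
  simp only [mul_pow, ← pow_mul]
  rw [intervalIntegral.integral_const_mul, integral_sin_pow_even,
    ← Nat.centralBinom_eq_two_mul_choose,
    ← h m]
  ring

/-- Over `[0, π]` the mean of `(4 r sin² x) ^ m` is the central binomial coefficient times `r ^ m`.
The right-hand side is therefore an average of values of the polynomial in `h`, at nonnegative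
points. -/
theorem le_sum_mul_centralBinom {c : ℕ → ℝ} {κ : ℝ} {d : ℕ}
    (h : ∀ y : ℝ, 0 ≤ y → κ ≤ ∑ m ∈ Finset.range d, c m * y ^ m) {r : ℝ} (hr : 0 ≤ r) :
    κ ≤ ∑ m ∈ Finset.range d, c m * (((2 * m).choose m : ℕ) * r ^ m) := by
  have hc : Continuous fun x : ℝ => ∑ m ∈ Finset.range d, c m * (4 * r * Real.sin x ^ 2) ^ m := by
    fun_prop
  have h1 : ∫ _x in (0 : ℝ)..Real.pi, κ ≤
      ∫ x in (0 : ℝ)..Real.pi, ∑ m ∈ Finset.range d, c m * (4 * r * Real.sin x ^ 2) ^ m :=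
    intervalIntegral.integral_mono_on Real.pi_pos.le
      (continuous_const.intervalIntegrable _ _) (hc.intervalIntegrable _ _)
      fun x _ => h _ (by positivity)
  rw [intervalIntegral.integral_const, sub_zero, smul_eq_mul,
    intervalIntegral.integral_finsetSum fun m _ => Continuous.intervalIntegrable (by fun_prop) _ _]
    at h1
  simp only [intervalIntegral.integral_const_mul, integral_four_mul_sin_sq_pow] at h1
  have h2 : ∑ m ∈ Finset.range d, c m * (Real.pi * (((2 * m).choose m : ℕ) * r ^ m)) =
      Real.pi * ∑ m ∈ Finset.range d, c m * (((2 * m).choose m : ℕ) * r ^ m) := by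
    rw [Finset.mul_sum]; exact Finset.sum_congr rfl fun m _ => by ring
  rw [h2] at h1
  exact le_of_mul_le_mul_left h1 Real.pi_pos

/-- `coarse V s = h (s ^ 2)` for this polynomial `h`. -/
noncomputable def coarsePoly (V : ℝ[X]) : ℝ[X] :=
  ∑ m ∈ Finset.range V.natDegree, C (dcoeff V m * ((2 * m + 1).choose m : ℕ)) * X ^ (m + 1)

/-- The polynomial `b` with `∫ u in 0..t, 1 / φ u = 2 * φ t * b (φ t ^ 2)`. -/
noncomputable def altPoly (V : ℝ[X]) : ℝ[X] :=
  ∑ m ∈ Finset.range V.natDegree, C (dcoeff V m * ((2 * m).choose m : ℕ)) * X ^ m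

theorem eval_coarsePoly (V : ℝ[X]) (r : ℝ) : (coarsePoly V).eval r =
    ∑ m ∈ Finset.range V.natDegree, dcoeff V m * ((2 * m + 1).choose m : ℕ) * r ^ (m + 1) := by
  rw [coarsePoly, eval_finsetSum]; simp

theorem eval_altPoly (V : ℝ[X]) (r : ℝ) : (altPoly V).eval r =
    ∑ m ∈ Finset.range V.natDegree, dcoeff V m * ((2 * m).choose m : ℕ) * r ^ m := by
  rw [altPoly, eval_finsetSum]; simp

theorem succ_mul_choose_two_mul_succ (m : ℕ) :
    ((m : ℝ) + 1) * ((2 * m + 1).choose m : ℕ) = (2 * m + 1) * ((2 * m).choose m : ℕ) := by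
  have h := Nat.add_one_mul_choose_eq (2 * m) m
  rw [Nat.choose_symm_half] at h
  have h2 : ((2 * m + 1 : ℕ) : ℝ) * ((2 * m).choose m : ℕ) =
      ((2 * m + 1).choose m : ℕ) * ((m + 1 : ℕ) : ℝ) := by exact_mod_cast h
  push_cast at h2 ⊢
  linarith

theorem eval_derivative_coarsePoly (V : ℝ[X]) (r : ℝ) : (derivative (coarsePoly V)).eval r =
    ∑ m ∈ Finset.range V.natDegree,
      ((2 * m + 1 : ℝ) * dcoeff V m) * (((2 * m).choose m : ℕ) * r ^ m) := by
  rw [coarsePoly, derivative_sum, eval_finsetSum]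
  refine Finset.sum_congr rfl fun m _ => ?_
  rw [derivative_C_mul_X_pow, Nat.add_sub_cancel, eval_mul, eval_C, eval_pow, eval_X]
  have := succ_mul_choose_two_mul_succ m
  push_cast
  linear_combination (dcoeff V m * r ^ m) * this

theorem coarse_eq (V : ℝ[X]) (s : ℝ) : coarse V s = (coarsePoly V).eval (s ^ 2) := by
  rw [coarse, eval_coarsePoly, Finset.range_eq_Ico, Finset.sum_Ico_eq_sum_range,
    ← Finset.Ico_add_one_right_eq_Icc, Finset.sum_Ico_eq_sum_range]
  refine Finset.sum_congr rfl fun m _ => ?_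
  have h1 : (2 * (m + 1)).choose (m + 1) = 2 * (2 * m + 1).choose m := by
    rw [show 2 * (m + 1) = (2 * m + 1) + 1 by ring, Nat.choose_succ_succ, ← Nat.choose_symm_half]
    ring
  rw [add_comm 1 m, h1, zero_add, dcoeff]
  push_cast
  ring

variable {V : ℝ[X]} {κ : ℝ}

theorem le_sum_dcoeff_mul_pow' (hV : StrongMono V κ) {y : ℝ} (hy : 0 ≤ y) :
    κ ≤ ∑ m ∈ Finset.range V.natDegree, dcoeff V m * y ^ m := by
  have hc : Continuous fun y : ℝ => ∑ m ∈ Finset.range V.natDegree, dcoeff V m * y ^ m := by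
    fun_prop
  refine ge_of_tendsto ((hc.tendsto y).mono_left (nhdsWithin_le_nhds (s := Set.Ioi y))) ?_
  filter_upwards [self_mem_nhdsWithin] with x hx
  exact le_sum_dcoeff_mul_pow hV (hy.trans_lt hx)

/-- The sum is the second derivative of `x ↦ V (x ^ 2)` at `√y`. -/
theorem le_sum_second (hV : StrongMono V κ) {y : ℝ} (hy : 0 ≤ y) :
    κ ≤ ∑ m ∈ Finset.range V.natDegree, ((2 * m + 1 : ℝ) * dcoeff V m) * y ^ m := by
  set x := Real.sqrt y with hx
  have hd : HasDerivAt (fun x : ℝ => ∑ m ∈ Finset.range V.natDegree, dcoeff V m * x ^ (2 * m + 1))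
      (∑ m ∈ Finset.range V.natDegree, ((2 * m + 1 : ℝ) * dcoeff V m) * y ^ m) x := by
    refine HasDerivAt.fun_sum fun m _ => ?_
    have := (hasDerivAt_pow (2 * m + 1) x).const_mul (dcoeff V m)
    refine hasDerivAt_of_eq this (fun _ => rfl) ?_
    rw [Nat.add_sub_cancel, pow_mul, hx, Real.sq_sqrt hy]
    push_cast; ring
  have ht := (hasDerivWithinAt_iff_tendsto_slope' (s := Set.Ioi x) (by simp)).1
      hd.hasDerivWithinAt
  refine ge_of_tendsto ht ?_
  filter_upwards [self_mem_nhdsWithin] with t ht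
  have ht' : 0 < t - x := sub_pos.2 ht
  rw [slope_def_field, le_div_iff₀ ht', ← eval_derivative_comp_sq, ← eval_derivative_comp_sq]
  have := hV t x
  rw [sq, ← mul_assoc] at this
  exact le_of_mul_le_mul_right this ht'

theorem le_eval_altPoly (hV : StrongMono V κ) {r : ℝ} (hr : 0 ≤ r) : κ ≤ (altPoly V).eval r := by
  rw [eval_altPoly]
  simp only [mul_assoc]
  exact le_sum_mul_centralBinom (fun y hy => le_sum_dcoeff_mul_pow' hV hy) hr

theorem le_eval_derivative_coarsePoly (hV : StrongMono V κ) {r : ℝ} (hr : 0 ≤ r) :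
    κ ≤ (derivative (coarsePoly V)).eval r := by
  rw [eval_derivative_coarsePoly]
  exact le_sum_mul_centralBinom (fun y hy => le_sum_second hV hy) hr

theorem mul_sub_le_coarsePoly (hV : StrongMono V κ) {x y : ℝ} (hx : 0 ≤ x) (hxy : x ≤ y) :
    κ * (y - x) ≤ (coarsePoly V).eval y - (coarsePoly V).eval x := by
  refine Convex.mul_sub_le_image_sub_of_le_deriv (convex_Ici 0)
    (coarsePoly V).continuous.continuousOn
    (coarsePoly V).differentiable.differentiableOn (fun z hz => ?_) x hx y (hx.trans hxy) hxy
  rw [interior_Ici] at hz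
  rw [Polynomial.deriv]
  exact le_eval_derivative_coarsePoly hV (le_of_lt hz)

theorem eval_coarsePoly_zero (V : ℝ[X]) : (coarsePoly V).eval 0 = 0 := by
  rw [eval_coarsePoly]; simp

theorem coarsePoly_injOn (hκ : 0 < κ) (hV : StrongMono V κ) {x y : ℝ} (hx : 0 ≤ x) (hy : 0 ≤ y)
    (h : (coarsePoly V).eval x = (coarsePoly V).eval y) : x = y := by
  rcases le_total x y with hxy | hxy
  · have := mul_sub_le_coarsePoly hV hx hxy
    nlinarith
  · have := mul_sub_le_coarsePoly hV hy hxy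
    nlinarith

theorem phi_spec (hκ : 0 < κ) (hV : StrongMono V κ) {t : ℝ} (ht : 0 ≤ t) :
    0 ≤ phi V t ∧ (coarsePoly V).eval (phi V t ^ 2) = t := by
  obtain ⟨r, hr, hrt⟩ : ∃ r ∈ Set.Icc 0 (t / κ), (coarsePoly V).eval r = t := by
    have h0 : 0 ≤ t / κ := by positivity
    have h1 := mul_sub_le_coarsePoly hV le_rfl h0
    rw [eval_coarsePoly_zero, sub_zero, sub_zero, mul_div_cancel₀ _ hκ.ne'] at h1
    exact intermediate_value_Icc h0 (coarsePoly V).continuous.continuousOn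
      ⟨by rw [eval_coarsePoly_zero]; exact ht, h1⟩
  have hset : {s : ℝ | 0 ≤ s ∧ t = coarse V s} = {Real.sqrt r} := by
    ext s
    simp only [Set.mem_ofPred_eq, Set.mem_singleton_iff, coarse_eq]
    constructor
    · rintro ⟨hs, hst⟩
      have := coarsePoly_injOn hκ hV (sq_nonneg s) hr.1 (hst.symm.trans hrt.symm)
      rw [← this, Real.sqrt_sq hs]
    · rintro rfl
      exact ⟨Real.sqrt_nonneg r, by rw [Real.sq_sqrt hr.1, hrt]⟩
  rw [phi, hset, csInf_singleton, Real.sq_sqrt hr.1]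
  exact ⟨Real.sqrt_nonneg r, hrt⟩

/-- `φ²` inverts a polynomial of slope at least `κ`, so it is Lipschitz up to `t = 0`, unlike `φ`.
This is why the later expansions are made for squares. -/
theorem abs_phi_sq_sub_le (hκ : 0 < κ) (hV : StrongMono V κ) {s t : ℝ} (hs : 0 ≤ s) (ht : 0 ≤ t) :
    κ * |phi V s ^ 2 - phi V t ^ 2| ≤ |s - t| := by
  have h1 := (phi_spec hκ hV hs).2
  have h2 := (phi_spec hκ hV ht).2
  rcases le_total (phi V s ^ 2) (phi V t ^ 2) with h | h
  · have := mul_sub_le_coarsePoly hV (sq_nonneg _) h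
    rw [h1, h2] at this
    rw [abs_sub_comm, abs_of_nonneg (by linarith), abs_sub_comm]
    exact this.trans (le_abs_self _)
  · have := mul_sub_le_coarsePoly hV (sq_nonneg _) h
    rw [h1, h2] at this
    rw [abs_of_nonneg (by linarith)]
    exact this.trans (le_abs_self _)

theorem phi_zero (hκ : 0 < κ) (hV : StrongMono V κ) : phi V 0 = 0 := by
  have h := (phi_spec hκ hV le_rfl).2
  have := coarsePoly_injOn hκ hV (sq_nonneg _) le_rfl (h.trans (eval_coarsePoly_zero V).symm)
  exact pow_eq_zero_iff two_ne_zero |>.1 this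

theorem phi_sq_le (hκ : 0 < κ) (hV : StrongMono V κ) {t : ℝ} (ht : 0 ≤ t) :
    phi V t ^ 2 ≤ t / κ := by
  have := abs_phi_sq_sub_le hκ hV ht le_rfl
  rw [phi_zero hκ hV, sub_zero, abs_of_nonneg ht, zero_pow two_ne_zero, sub_zero,
    abs_of_nonneg (sq_nonneg _)] at this
  rw [le_div_iff₀ hκ, mul_comm]; exact this

theorem phi_pos (hκ : 0 < κ) (hV : StrongMono V κ) {t : ℝ} (ht : 0 < t) : 0 < phi V t := by
  obtain ⟨h1, h2⟩ := phi_spec hκ hV ht.le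
  refine lt_of_le_of_ne h1 fun h => ?_
  rw [← h, zero_pow two_ne_zero, eval_coarsePoly_zero] at h2
  linarith

theorem continuousOn_phi_sq (hκ : 0 < κ) (hV : StrongMono V κ) :
    ContinuousOn (fun t => phi V t ^ 2) (Set.Ici 0) := by
  have : LipschitzOnWith (Real.toNNReal κ⁻¹) (fun t => phi V t ^ 2) (Set.Ici 0) := by
    refine LipschitzOnWith.of_dist_le_mul fun s hs t ht => ?_
    have := abs_phi_sq_sub_le hκ hV hs ht
    rw [Real.dist_eq, Real.dist_eq, Real.coe_toNNReal _ (by positivity), inv_mul_eq_div,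
      le_div_iff₀ hκ, mul_comm]
    exact this
  exact this.continuousOn

theorem continuousOn_phi (hκ : 0 < κ) (hV : StrongMono V κ) :
    ContinuousOn (phi V) (Set.Ici 0) :=
  (continuousOn_phi_sq hκ hV).sqrt.congr fun _ ht => (Real.sqrt_sq (phi_spec hκ hV ht).1).symm

theorem hasDerivAt_phi (hκ : 0 < κ) (hV : StrongMono V κ) {t : ℝ} (ht : 0 < t) :
    HasDerivAt (phi V) ((2 * phi V t * (derivative (coarsePoly V)).eval (phi V t ^ 2))⁻¹) t := by
  have hpos := phi_pos hκ hV ht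
  have hD := le_eval_derivative_coarsePoly hV (sq_nonneg (phi V t))
  have hev : ∀ᶠ y in nhds t, 0 ≤ y := (lt_mem_nhds ht).mono fun _ h => h.le
  have h1 : HasDerivAt (fun t => phi V t ^ 2)
      ((derivative (coarsePoly V)).eval (phi V t ^ 2))⁻¹ t := by
    refine HasDerivAt.of_local_left_inverse (f := fun r => (coarsePoly V).eval r)
      ((continuousOn_phi_sq hκ hV).continuousAt (Ici_mem_nhds ht)) ((coarsePoly V).hasDerivAt _)
      (by linarith) ?_
    filter_upwards [hev] with y hy
    exact (phi_spec hκ hV hy).2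
  have h2 := h1.sqrt (by positivity)
  refine (h2.congr_of_eventuallyEq ?_).congr_deriv ?_
  · filter_upwards [hev] with y hy
    exact (Real.sqrt_sq (phi_spec hκ hV hy).1).symm
  · rw [Real.sqrt_sq hpos.le]; field_simp

/-- The derivative of `s ↦ 2 s b(s²)` is `2 h'(s²)`, with `b = altPoly V` and `h = coarsePoly V`,
while `φ' = 1 / (2 φ h'(φ²))`; their product is `1 / φ`. -/
theorem integral_inv_phi (hκ : 0 < κ) (hV : StrongMono V κ) {t : ℝ} (ht : 0 ≤ t) :
    ∫ u in (0 : ℝ)..t, 1 / phi V u = 2 * phi V t * (altPoly V).eval (phi V t ^ 2) := by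
  have hB : ∀ s : ℝ, HasDerivAt (fun s : ℝ => 2 * s * (altPoly V).eval (s ^ 2))
      (2 * (derivative (coarsePoly V)).eval (s ^ 2)) s := by
    intro s
    have : HasDerivAt (fun s : ℝ => ∑ m ∈ Finset.range V.natDegree,
        2 * (dcoeff V m * ((2 * m).choose m : ℕ)) * s ^ (2 * m + 1))
        (∑ m ∈ Finset.range V.natDegree, 2 * (dcoeff V m * ((2 * m).choose m : ℕ)) *
          (((2 * m + 1 : ℕ) : ℝ) * s ^ (2 * m))) s :=
      HasDerivAt.fun_sum fun m _ => (hasDerivAt_pow (2 * m + 1) s).const_mul _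
    refine hasDerivAt_of_eq this (fun s => ?_) ?_
    · rw [eval_altPoly, Finset.mul_sum]
      exact Finset.sum_congr rfl fun m _ => by rw [← pow_mul]; ring
    · rw [eval_derivative_coarsePoly, Finset.mul_sum]
      exact Finset.sum_congr rfl fun m _ => by rw [← pow_mul]; push_cast; ring
  have hcont : ContinuousOn (fun u => 2 * phi V u * (altPoly V).eval (phi V u ^ 2))
      (Set.Icc 0 t) := by
    have h := (continuousOn_phi hκ hV).mono (Set.Icc_subset_Ici_self : Set.Icc 0 t ⊆ _)
    exact (continuousOn_const.mul h).mul ((altPoly V).continuous.comp_continuousOn (h.pow 2))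
  have hderiv : ∀ u ∈ Set.Ioo 0 t, HasDerivAt
      (fun u => 2 * phi V u * (altPoly V).eval (phi V u ^ 2)) (1 / phi V u) u := by
    intro u hu
    have hpos := phi_pos hκ hV hu.1
    have hD := le_eval_derivative_coarsePoly hV (sq_nonneg (phi V u))
    have hD0 : (derivative (coarsePoly V)).eval (phi V u ^ 2) ≠ 0 := by linarith
    refine ((hB (phi V u)).comp u (hasDerivAt_phi hκ hV hu.1)).congr_deriv ?_
    field_simp
  -- The singularity at `0` is integrable because `1 / φ` is a nonnegative derivative of a function
  -- continuous up to `0`.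
  have hint : IntervalIntegrable (fun u => 1 / phi V u) MeasureTheory.volume 0 t := by
    rw [intervalIntegrable_iff_integrableOn_Ioc_of_le ht]
    exact intervalIntegral.integrableOn_deriv_of_nonneg hcont hderiv fun u hu =>
      (one_div_pos.2 (phi_pos hκ hV hu.1)).le
  rw [intervalIntegral.integral_eq_sub_of_hasDerivAt_of_le ht hcont hderiv hint, phi_zero hκ hV]
  ring

end HardEdge

/-! ### The fine minimizer and the expansion of its square. -/

namespace HardEdge

theorem exists_polynomial_bounds (f : ℝ[X]) (R : ℝ) : ∃ C : ℝ, 0 < C ∧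
    ∀ x ∈ Set.Icc 0 R, ∀ y ∈ Set.Icc 0 R, |f.eval x| ≤ C ∧ |f.eval y - f.eval x| ≤ C * |y - x| ∧
      |f.eval y - f.eval x - (derivative f).eval x * (y - x)| ≤ C * (y - x) ^ 2 := by
  have hb : ∀ g : ℝ[X], ∃ C : ℝ, ∀ x ∈ Set.Icc 0 R, |g.eval x| ≤ C := fun g =>
    isCompact_Icc.exists_bound_of_continuousOn g.continuous.continuousOn
  have hlip : ∀ (g : ℝ[X]) (C : ℝ) (x y : ℝ), (∀ z ∈ Set.uIcc x y, |(derivative g).eval z| ≤ C) →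
      |g.eval y - g.eval x| ≤ C * |y - x| := by
    intro g C x y h
    exact Convex.norm_image_sub_le_of_norm_deriv_le (fun z _ => g.differentiableAt)
      (fun z hz => by rw [Polynomial.deriv]; exact h z hz) (convex_uIcc x y)
      Set.left_mem_uIcc Set.right_mem_uIcc
  obtain ⟨C0, h0⟩ := hb f
  obtain ⟨C1, h1⟩ := hb (derivative f)
  obtain ⟨C2, h2⟩ := hb (derivative (derivative f))
  refine ⟨|C0| + |C1| + |C2| + 1, by positivity, ?_⟩
  intro x hx y hy
  have hsub : ∀ z ∈ Set.uIcc x y, z ∈ Set.Icc 0 R := fun z hz => Set.uIcc_subset_Icc hx hy hz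
  have e0 := le_abs_self C0
  have e1 := le_abs_self C1
  have e2 := le_abs_self C2
  have p0 := abs_nonneg C0
  have p1 := abs_nonneg C1
  have p2 := abs_nonneg C2
  refine ⟨(h0 x hx).trans (by linarith), ?_, ?_⟩
  · refine (hlip f C1 x y fun z hz => h1 z (hsub z hz)).trans ?_
    gcongr
    linarith
  · have hd : ∀ z ∈ Set.uIcc x y,
        |(derivative (f - C ((derivative f).eval x) * X)).eval z| ≤ |C2| * |y - x| := by
      intro z hz
      have h3 := hlip (derivative f) |C2| x z fun w hw =>
        (h2 w (hsub w (Set.uIcc_subset_uIcc_left hz hw))).trans e2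
      have h4 : |z - x| ≤ |y - x| := Set.abs_sub_left_of_mem_uIcc hz
      simp only [derivative_sub, derivative_C_mul, derivative_X, mul_one, eval_sub, eval_C]
      exact h3.trans (by gcongr)
    have h5 := hlip (f - C ((derivative f).eval x) * X) _ x y hd
    simp only [eval_sub, eval_mul, eval_C, eval_X] at h5
    have h6 : f.eval y - f.eval x - (derivative f).eval x * (y - x) =
        f.eval y - (derivative f).eval x * y - (f.eval x - (derivative f).eval x * x) := by ring
    rw [h6]
    refine h5.trans ?_
    rw [mul_assoc, ← abs_mul, ← sq, abs_of_nonneg (sq_nonneg (y - x))]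
    gcongr
    linarith

/-- `1` for the variables `x` and `-1` for the variables `y`. -/
def sgn {n : ℕ} : Coord n → ℝ
  | Sum.inl _ => 1
  | Sum.inr _ => -1

/-- The correction to `φ²` of order `1 / n`, as a function of `r = φ²`. -/
noncomputable def sqCorr (V : ℝ[X]) (β a σ r : ℝ) : ℝ :=
  (a - 2 / β) / (2 * (derivative (coarsePoly V)).eval r) +
    σ * ((a + 1 / 2) / (2 * (altPoly V).eval r) - 1 / (4 * (derivative (coarsePoly V)).eval r))

/-- The correction of order `1 / n` in the fine minimizer. -/
noncomputable def corr {n : ℕ} (V : ℝ[X]) (β a : ℝ) (k : Coord n) (t : ℝ) : ℝ :=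
  (corrSum V β a t + sgn k * corrDiff V a t) / 2

/-- The macroscopic position of a coordinate. -/
noncomputable def time {n : ℕ} (k : Coord n) : ℝ := (site k : ℝ) / n

variable {n : ℕ}

theorem abs_sgn (k : Coord n) : |sgn k| = 1 := by rcases k with k | k <;> simp [sgn]

theorem fine_eq (V : ℝ[X]) (β a : ℝ) (k : Coord n) :
    fine n V β a k = phi V (time k) + corr V β a k (time k) / n := by
  rcases k with k | k <;> simp only [fine, time, corr, sgn, site, corrX, corrY] <;> push_cast
  · ring
  · ring

theorem weight_eq (β a : ℝ) (k : Coord n) :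
    weight β a k = time k + ((1 + sgn k) / 2 * a - 1 / β) / n := by
  rcases k with k | k <;> simp only [weight, time, sgn, site] <;> push_cast
  · rw [mul_comm (n : ℝ) β, ← div_div 1 β]; ring
  · rw [mul_comm (n : ℝ) β, ← div_div 1 β]; ring

theorem site_eq (k : Coord n) : (site k : ℝ) = (pos k : ℝ) / 2 + 3 / 4 + sgn k / 4 := by
  rcases k with k | k <;> simp only [site, pos, sgn] <;> push_cast <;> ring

theorem sgn_eq (k l : Coord n) : sgn l = (-1) ^ (pos l - pos k) * sgn k := by
  rcases k with k | k <;> rcases l with l | l <;> simp only [pos, sgn]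
  · rw [Even.neg_one_zpow ⟨(l : ℤ) - k, by ring⟩]; ring
  · rw [Odd.neg_one_zpow ⟨(l : ℤ) - k, by ring⟩]; ring
  · rw [Odd.neg_one_zpow ⟨(l : ℤ) - k - 1, by ring⟩]; ring
  · rw [Even.neg_one_zpow ⟨(l : ℤ) - k, by ring⟩]; ring

theorem one_le_cast_of_coord (k : Coord n) : (1 : ℝ) ≤ n := by
  have := (one_le_site k).trans (site_le k)
  exact_mod_cast this

theorem time_pos (k : Coord n) : 0 < time k := by
  have h1 := one_le_cast_of_coord k
  have h2 : (1 : ℝ) ≤ site k := by exact_mod_cast one_le_site k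
  unfold time; positivity

theorem time_le_one (k : Coord n) : time k ≤ 1 := by
  have h1 := one_le_cast_of_coord k
  rw [time, div_le_one (by linarith)]; exact_mod_cast site_le k

variable {V : ℝ[X]} {κ : ℝ}

/-- The correction itself may blow up like `1 / φ` at `t = 0`; its effect on the square is a bounded
function of `φ²`. -/
theorem two_mul_phi_mul_corr (hκ : 0 < κ) (hV : StrongMono V κ) (β a : ℝ) (k : Coord n) {t : ℝ}
    (ht : 0 < t) :
    2 * phi V t * corr V β a k t = sqCorr V β a (sgn k) (phi V t ^ 2) := by
  have hpos := phi_pos hκ hV ht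
  have h1 := le_eval_derivative_coarsePoly hV (sq_nonneg (phi V t))
  have h2 := le_eval_altPoly hV (sq_nonneg (phi V t))
  have h1' : (derivative (coarsePoly V)).eval (phi V t ^ 2) ≠ 0 := by linarith
  have h2' : (altPoly V).eval (phi V t ^ 2) ≠ 0 := by linarith
  rw [corr, corrSum, corrDiff, integral_inv_phi hκ hV ht.le, (hasDerivAt_phi hκ hV ht).deriv,
    sqCorr]
  field_simp
  ring

theorem abs_sqCorr_le (hκ : 0 < κ) (hV : StrongMono V κ) (β a : ℝ) {σ r : ℝ} (hσ : |σ| = 1)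
    (hr : 0 ≤ r) : |sqCorr V β a σ r| ≤ (|a - 2 / β| + |a + 1 / 2| + 1) / κ := by
  have h1 := le_eval_derivative_coarsePoly hV hr
  have h2 := le_eval_altPoly hV hr
  have e1 : |(a - 2 / β) / (2 * (derivative (coarsePoly V)).eval r)| ≤ |a - 2 / β| / κ := by
    rw [abs_div, abs_of_pos (by linarith : 0 < 2 * (derivative (coarsePoly V)).eval r)]
    gcongr
    linarith
  have e2 : |(a + 1 / 2) / (2 * (altPoly V).eval r)| ≤ |a + 1 / 2| / κ := by
    rw [abs_div, abs_of_pos (by linarith : 0 < 2 * (altPoly V).eval r)]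
    gcongr
    linarith
  have e3 : |1 / (4 * (derivative (coarsePoly V)).eval r)| ≤ 1 / κ := by
    rw [abs_div, abs_one, abs_of_pos (by linarith : 0 < 4 * (derivative (coarsePoly V)).eval r)]
    gcongr
    linarith
  calc _ ≤ |(a - 2 / β) / (2 * (derivative (coarsePoly V)).eval r)| +
        |σ| * (|(a + 1 / 2) / (2 * (altPoly V).eval r)| +
          |1 / (4 * (derivative (coarsePoly V)).eval r)|) := by
        refine (abs_add_le _ _).trans (add_le_add le_rfl ?_)
        rw [abs_mul]
        exact mul_le_mul_of_nonneg_left (abs_sub _ _) (abs_nonneg _)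
    _ ≤ |a - 2 / β| / κ + 1 * (|a + 1 / 2| / κ + 1 / κ) := by rw [hσ]; gcongr
    _ = _ := by ring

/-- The fine minimizer, without the correction where this is not small. -/
noncomputable def modFine (n : ℕ) (V : ℝ[X]) (β a : ℝ) (k : Coord n) : ℝ :=
  if |corr V β a k (time k)| / n ≤ phi V (time k) / 2 then
    phi V (time k) + corr V β a k (time k) / n
  else phi V (time k)

-- The correction is at most of order `1 / (n φ)`. Where it is relatively small, the error in the
-- square is the squared correction; where it exceeds `φ / 2`, one has `φ² = O(1 / n)`, and dropping
-- it costs no more than the claimed errors.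
set_option maxHeartbeats 1000000 in
theorem exists_modFine_bounds (hκ : 0 < κ) (hV : StrongMono V κ) (β a : ℝ) :
    ∃ C : ℝ, 0 < C ∧ ∀ {n : ℕ} (k : Coord n),
      0 < modFine n V β a k ∧ Real.sqrt (time k) ≤ C * modFine n V β a k ∧
      modFine n V β a k ^ 2 ≤ C * time k ∧
      |modFine n V β a k ^ 2 - (phi V (time k) ^ 2 +
        sqCorr V β a (sgn k) (phi V (time k) ^ 2) / n)| ≤ C / (n * site k) ∧
      |modFine n V β a k - fine n V β a k| ≤ C / (n * site k * Real.sqrt (time k)) := by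
  obtain ⟨L, hL, hLip⟩ := exists_polynomial_bounds (coarsePoly V) (1 / κ)
  set E := (|a - 2 / β| + |a + 1 / 2| + 1) / κ with hE
  have hE0 : 0 < E := by positivity
  refine ⟨2 * (L + 1) + 9 / (4 * κ) + E ^ 2 * L + L * E * E + E * (L * E) * (L + 1),
    by positivity, ?_⟩
  intro n k
  set t := time k with ht
  have ht0 : 0 < t := time_pos k
  have ht1 : t ≤ 1 := time_le_one k
  have hn : (1 : ℝ) ≤ n := one_le_cast_of_coord k
  have hn0 : (0 : ℝ) < n := by linarith
  have hj : (1 : ℝ) ≤ site k := by exact_mod_cast one_le_site k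
  have hj0 : (0 : ℝ) < site k := by linarith
  have hjt : (site k : ℝ) = n * t := by rw [ht, time]; field_simp
  set φ := phi V t with hφ
  have hφ0 : 0 < φ := phi_pos hκ hV ht0
  have hρ1 : φ ^ 2 ≤ t / κ := phi_sq_le hκ hV ht0.le
  have hρ2 : φ ^ 2 ≤ 1 / κ := hρ1.trans (by gcongr)
  have htρ : t ≤ L * φ ^ 2 := by
    have := (hLip 0 ⟨le_rfl, by positivity⟩ (φ ^ 2) ⟨sq_nonneg _, hρ2⟩).2.1
    rw [(phi_spec hκ hV ht0.le).2, eval_coarsePoly_zero, sub_zero, sub_zero,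
      abs_of_pos ht0, abs_of_nonneg (sq_nonneg _)] at this
    exact this
  have hsqrt : Real.sqrt t ≤ (L + 1) * φ := by
    rw [Real.sqrt_le_left (by positivity)]
    have : 0 ≤ φ ^ 2 := sq_nonneg _
    nlinarith
  set x := corr V β a k t with hx
  have hcorr : 2 * φ * x = sqCorr V β a (sgn k) (φ ^ 2) := two_mul_phi_mul_corr hκ hV β a k ht0
  have habs : 2 * φ * |x| ≤ E := by
    have := abs_sqCorr_le hκ hV β a (abs_sgn k) (sq_nonneg φ)
    rw [← hcorr, abs_mul, abs_of_pos (by positivity : 0 < 2 * φ)] at this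
    exact this
  set C := 2 * (L + 1) + 9 / (4 * κ) + E ^ 2 * L + L * E * E + E * (L * E) * (L + 1) with hC
  have p1 : 0 ≤ 9 / (4 * κ) := by positivity
  have p2 : 0 ≤ E ^ 2 * L := by positivity
  have p3 : 0 ≤ L * E * E := by positivity
  have p4 : 0 ≤ E * (L * E) * (L + 1) := by positivity
  have hC1 : 2 * (L + 1) ≤ C := by linarith
  have hC2 : 9 / (4 * κ) ≤ C := by linarith
  have hC3 : E ^ 2 * L ≤ C := by linarith
  have hC4 : L * E * E ≤ C := by linarith
  have hC5 : E * (L * E) * (L + 1) ≤ C := by linarith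
  have hCpos : 0 < C := by linarith
  clear_value C E
  have hfine : fine n V β a k = φ + x / n := fine_eq V β a k
  rw [← hcorr, hfine]
  by_cases hcase : |x| / n ≤ φ / 2
  · have hF : modFine n V β a k = φ + x / n := if_pos hcase
    rw [hF]
    have hxn : |x / n| ≤ φ / 2 := by rwa [abs_div, abs_of_pos hn0]
    obtain ⟨h1, h2⟩ := abs_le.1 hxn
    refine ⟨by linarith, ?_, ?_, ?_, ?_⟩
    · calc Real.sqrt t ≤ (L + 1) * φ := hsqrt
        _ ≤ 2 * (L + 1) * (φ + x / n) := by nlinarith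
        _ ≤ C * (φ + x / n) := by
            have : 0 ≤ φ + x / n := by linarith
            gcongr
    · calc (φ + x / n) ^ 2 ≤ (3 / 2 * φ) ^ 2 := by gcongr <;> linarith
        _ = 9 / 4 * φ ^ 2 := by ring
        _ ≤ 9 / 4 * (t / κ) := by gcongr
        _ = 9 / (4 * κ) * t := by field_simp
        _ ≤ C * t := by gcongr
    · have e : (φ + x / n) ^ 2 - (φ ^ 2 + 2 * φ * x / n) = x ^ 2 / n ^ 2 := by field_simp; ring
      rw [e, abs_of_nonneg (by positivity), hjt, div_le_div_iff₀ (by positivity) (by positivity)]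
      have h3 : (2 * φ * |x|) ^ 2 ≤ E ^ 2 := by gcongr
      have h4 : x ^ 2 * t ≤ E ^ 2 * L := by
        rw [mul_pow, sq_abs] at h3
        have h5 : x ^ 2 * t ≤ x ^ 2 * (L * φ ^ 2) := by gcongr
        have h6 : L * (4 * φ ^ 2 * x ^ 2) ≤ L * E ^ 2 := by
          gcongr
          linarith
        have h7 : 0 ≤ L * (φ ^ 2 * x ^ 2) := by positivity
        nlinarith
      calc x ^ 2 * (n * (n * t)) = (x ^ 2 * t) * n ^ 2 := by ring
        _ ≤ (E ^ 2 * L) * n ^ 2 := by gcongr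
        _ ≤ C * n ^ 2 := by gcongr
    · rw [sub_self, abs_zero]; positivity
  · have hF : modFine n V β a k = φ := if_neg hcase
    push Not at hcase
    rw [hF]
    have h1 : φ ^ 2 ≤ E / n := by
      rw [le_div_iff₀ hn0]
      rw [lt_div_iff₀ hn0] at hcase
      nlinarith
    -- The correction is dropped only at boundedly many indices next to the left end, so factors of
    -- `site k` cost a constant there.
    have hjE : (site k : ℝ) ≤ L * E := by
      rw [hjt]
      rw [le_div_iff₀ hn0] at h1
      nlinarith
    refine ⟨hφ0, ?_, ?_, ?_, ?_⟩
    · refine hsqrt.trans ?_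
      gcongr
      linarith
    · calc φ ^ 2 ≤ t / κ := hρ1
        _ = 1 / κ * t := by ring
        _ ≤ C * t := by
            gcongr
            have : 1 / κ ≤ 9 / (4 * κ) := by
              rw [div_le_div_iff₀ hκ (by positivity)]; linarith
            linarith
    · have e : φ ^ 2 - (φ ^ 2 + 2 * φ * x / n) = -(2 * φ * x / n) := by ring
      rw [e, abs_neg, abs_div, abs_mul, abs_of_pos (by positivity : 0 < 2 * φ), abs_of_pos hn0,
        div_le_div_iff₀ hn0 (by positivity)]
      calc 2 * φ * |x| * (n * site k) ≤ E * (n * (L * E)) := by gcongr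
        _ = (L * E * E) * n := by ring
        _ ≤ C * n := by gcongr
    · have e : φ - (φ + x / n) = -(x / n) := by ring
      rw [e, abs_neg, abs_div, abs_of_pos hn0, div_le_div_iff₀ hn0 (by positivity)]
      calc |x| * (n * site k * Real.sqrt t) ≤ |x| * (n * (L * E) * ((L + 1) * φ)) := by gcongr
        _ = (2 * φ * |x|) * (L * E) * (L + 1) / 2 * n := by ring
        _ ≤ E * (L * E) * (L + 1) / 2 * n := by gcongr
        _ ≤ C * n := by gcongr; linarith

end HardEdge

/-! ### First-order expansion of the force around a constant profile. -/

namespace HardEdge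

/-- A bound for the second order remainder of `force`. -/
noncomputable def forceRemBound (V : ℝ[X]) (M : ℝ) : ℝ :=
  ∑ m ∈ Finset.range V.natDegree,
    |dcoeff V m| * (((2 * m + 1 : ℕ) : ℝ) ^ 2 * (1 + M) ^ (2 * m + 1))

theorem forceRemBound_nonneg (V : ℝ[X]) {M : ℝ} (hM : 0 ≤ M) : 0 ≤ forceRemBound V M :=
  Finset.sum_nonneg fun m _ => by positivity

theorem abs_force_sub_sub_le {V : ℝ[X]} {r ε : ℤ → ℝ} {p : ℤ} {M N η : ℝ} (hM : 0 ≤ M)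
    (hη : 0 ≤ η) (hN : M + η ≤ N)
    (h : ∀ e : ℤ, |e - p| < 2 * V.natDegree → |r e| ≤ M)
    (h' : ∀ e : ℤ, |e - p| < 2 * V.natDegree → |ε e| ≤ η) :
    |force V (fun e => r e + ε e) p - force V r p - dforce V r ε p| ≤
      forceRemBound V N * η ^ 2 := by
  rw [force_eq, force_eq, dforce, forceRemBound, Finset.sum_mul, ← Finset.sum_sub_distrib,
    ← Finset.sum_sub_distrib]
  refine (Finset.abs_sum_le_sum_abs _ _).trans (Finset.sum_le_sum fun m hm => ?_)
  have hm' := Finset.mem_range.1 hm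
  have hw : ∀ e : ℤ, p + 1 - ((2 * m + 1 : ℕ) : ℤ) < e → e < p + 1 + 2 * (m : ℤ) →
      |e - p| < 2 * V.natDegree := by
    intro e h1 h2
    push_cast at h1 h2
    refine abs_lt.2 ?_
    constructor <;> linarith [(by exact_mod_cast hm' : (m : ℤ) < V.natDegree)]
  rw [← mul_sub, ← mul_sub, abs_mul, mul_assoc]
  refine mul_le_mul_of_nonneg_left ((abs_walk_sub_sub_le hM hη _ _ (fun e h1 h2 => h e (hw e h1 h2))
    (fun e h1 h2 => h' e (hw e h1 h2))).trans ?_) (abs_nonneg _)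
  exact mul_le_mul_of_nonneg_right (mul_le_mul_of_nonneg_left
    (pow_le_pow_left₀ (by linarith) (by linarith) _) (by positivity)) (sq_nonneg _)

theorem mul_force_const (V : ℝ[X]) (ρ : ℝ) (p : ℤ) :
    ρ * force V (fun _ => ρ) p = (coarsePoly V).eval ρ := by
  rw [force_eq, eval_coarsePoly, Finset.mul_sum]
  refine Finset.sum_congr rfl fun m _ => ?_
  rw [walk_const]; ring

theorem force_const_add (V : ℝ[X]) (ρ : ℝ) (p : ℤ) :
    force V (fun _ => ρ) p + ρ * dforce V (fun _ => ρ) (fun _ => 1) p =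
      (derivative (coarsePoly V)).eval ρ := by
  rw [force_eq, dforce, eval_derivative_coarsePoly, Finset.mul_sum, ← Finset.sum_add_distrib]
  refine Finset.sum_congr rfl fun m _ => ?_
  rw [walk_const, dwalk_const_const]
  have h := succ_mul_choose_two_mul_succ m
  cases m with
  | zero => simp
  | succ m =>
    rw [Nat.add_sub_cancel]
    linear_combination (dcoeff V (m + 1) * ρ ^ (m + 1)) * h

/-- For walks from `p + 1` to `p` the average starting point of an upward step is exactly `p`. Hence
the slope of `φ²` does not enter at order `1 / n`. -/
theorem dforce_const_linear (V : ℝ[X]) (ρ : ℝ) (p : ℤ) :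
    dforce V (fun _ => ρ) (fun e => ((e - p : ℤ) : ℝ)) p = 0 := by
  refine Finset.sum_eq_zero fun m _ => ?_
  have h : (fun e : ℤ => ((e - p : ℤ) : ℝ)) = fun e : ℤ => (e : ℝ) + (-(p : ℝ)) * 1 := by
    funext e; push_cast; ring
  rw [h, dwalk_add _ (fun e : ℤ => (e : ℝ)) (fun _ : ℤ => -(p : ℝ) * 1),
    dwalk_const_mul _ (fun _ : ℤ => 1), dwalk_const_linear, dwalk_const_const]
  push_cast
  ring

/-- By Pascal's rule: the alternating derivative removes one of the two summands of the coefficient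
`(2m + 1).choose m` and leaves the central one. -/
theorem force_const_add_alternating (V : ℝ[X]) (ρ : ℝ) (p : ℤ) :
    force V (fun _ => ρ) p + ρ * dforce V (fun _ => ρ) (fun e => (-1 : ℝ) ^ (e - p)) p =
      (altPoly V).eval ρ := by
  rw [force_eq, dforce, eval_altPoly, Finset.mul_sum, ← Finset.sum_add_distrib]
  refine Finset.sum_congr rfl fun m _ => ?_
  have h : (fun e : ℤ => (-1 : ℝ) ^ (e - p)) = fun e => (-1) * (-1 : ℝ) ^ (e - (p + 1)) := by
    funext e
    rw [show e - p = e - (p + 1) + 1 by ring, zpow_add_one₀ (by norm_num)]; ring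
  rw [h, dwalk_const_mul, walk_const]
  cases m with
  | zero => simp [(dwalk_const_alternating ρ (p + 1) 0).2.1]
  | succ m =>
    rw [(dwalk_const_alternating ρ (p + 1) (m + 1)).2.2 m, Nat.choose_succ_succ (2 * (m + 1)) m]
    push_cast
    ring

variable {V : ℝ[X]} {κ : ℝ}

theorem phi_sq_mem (hκ : 0 < κ) (hV : StrongMono V κ) {t : ℝ} (ht : 0 ≤ t) (ht1 : t ≤ 1) :
    phi V t ^ 2 ∈ Set.Icc 0 (1 / κ) :=
  ⟨sq_nonneg _, (phi_sq_le hκ hV ht).trans (by gcongr)⟩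

theorem abs_phi_sq_sub_le_div (hκ : 0 < κ) (hV : StrongMono V κ) {s t : ℝ} (hs : 0 ≤ s)
    (ht : 0 ≤ t) : |phi V s ^ 2 - phi V t ^ 2| ≤ |s - t| / κ := by
  rw [le_div_iff₀ hκ, mul_comm]; exact abs_phi_sq_sub_le hκ hV hs ht

theorem exists_phi_sq_taylor (hκ : 0 < κ) (hV : StrongMono V κ) : ∃ C : ℝ, 0 < C ∧
    ∀ s ∈ Set.Icc (0 : ℝ) 1, ∀ t ∈ Set.Icc (0 : ℝ) 1,
      |phi V s ^ 2 - phi V t ^ 2 - (s - t) / (derivative (coarsePoly V)).eval (phi V t ^ 2)| ≤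
        C * (s - t) ^ 2 := by
  obtain ⟨L, hL, h⟩ := exists_polynomial_bounds (coarsePoly V) (1 / κ)
  refine ⟨L / κ ^ 3, by positivity, ?_⟩
  intro s hs t ht
  have h1 := (h _ (phi_sq_mem hκ hV ht.1 ht.2) _ (phi_sq_mem hκ hV hs.1 hs.2)).2.2
  rw [(phi_spec hκ hV hs.1).2, (phi_spec hκ hV ht.1).2] at h1
  have h2 := abs_phi_sq_sub_le_div hκ hV hs.1 ht.1
  have hD := le_eval_derivative_coarsePoly hV (sq_nonneg (phi V t))
  set D := (derivative (coarsePoly V)).eval (phi V t ^ 2)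
  set x := phi V s ^ 2 - phi V t ^ 2
  have hD0 : 0 < D := by linarith
  have e : x - (s - t) / D = -((s - t - D * x) / D) := by field_simp; ring
  rw [e, abs_neg, abs_div, abs_of_pos hD0]
  have h3 : x ^ 2 ≤ (s - t) ^ 2 / κ ^ 2 := by
    rw [← sq_abs x, ← sq_abs (s - t), ← div_pow]
    exact pow_le_pow_left₀ (abs_nonneg _) h2 2
  calc |s - t - D * x| / D ≤ (L * x ^ 2) / κ := by gcongr
    _ ≤ (L * ((s - t) ^ 2 / κ ^ 2)) / κ := by gcongr
    _ = _ := by field_simp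

theorem abs_inv_sub_inv_le {x y κ : ℝ} (hκ : 0 < κ) (hx : κ ≤ x) (hy : κ ≤ y) :
    |x⁻¹ - y⁻¹| ≤ |x - y| / κ ^ 2 := by
  have hx0 : 0 < x := by linarith
  have hy0 : 0 < y := by linarith
  rw [inv_sub_inv hx0.ne' hy0.ne', abs_div, abs_of_pos (mul_pos hx0 hy0), abs_sub_comm]
  gcongr
  nlinarith

theorem exists_sqCorr_lipschitz (hκ : 0 < κ) (hV : StrongMono V κ) (β a : ℝ) : ∃ C : ℝ, 0 < C ∧
    ∀ σ : ℝ, |σ| = 1 → ∀ s ∈ Set.Icc (0 : ℝ) 1, ∀ t ∈ Set.Icc (0 : ℝ) 1,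
      |sqCorr V β a σ (phi V s ^ 2) - sqCorr V β a σ (phi V t ^ 2)| ≤ C * |s - t| := by
  obtain ⟨L, hL, h⟩ := exists_polynomial_bounds (derivative (coarsePoly V)) (1 / κ)
  obtain ⟨L', hL', h'⟩ := exists_polynomial_bounds (altPoly V) (1 / κ)
  refine ⟨(|a - 2 / β| / 2 + 1 / 4) * (L / κ / κ ^ 2) + |a + 1 / 2| / 2 * (L' / κ / κ ^ 2),
    by positivity, ?_⟩
  intro σ hσ s hs t ht
  have hms := phi_sq_mem hκ hV hs.1 hs.2
  have hmt := phi_sq_mem hκ hV ht.1 ht.2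
  have h1 := (h _ hmt _ hms).2.1
  have h1' := (h' _ hmt _ hms).2.1
  have h2 := abs_phi_sq_sub_le_div hκ hV hs.1 ht.1
  have h3 := abs_inv_sub_inv_le hκ (le_eval_derivative_coarsePoly hV hms.1)
    (le_eval_derivative_coarsePoly hV hmt.1)
  have h4 := abs_inv_sub_inv_le hκ (le_eval_altPoly hV hms.1) (le_eval_altPoly hV hmt.1)
  simp only [sqCorr]
  set D := (derivative (coarsePoly V)).eval (phi V s ^ 2)
  set D' := (derivative (coarsePoly V)).eval (phi V t ^ 2)
  set A := (altPoly V).eval (phi V s ^ 2)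
  set A' := (altPoly V).eval (phi V t ^ 2)
  have e : (a - 2 / β) / (2 * D) + σ * ((a + 1 / 2) / (2 * A) - 1 / (4 * D)) -
      ((a - 2 / β) / (2 * D') + σ * ((a + 1 / 2) / (2 * A') - 1 / (4 * D'))) =
      (a - 2 / β) * (D⁻¹ - D'⁻¹) / 2 + σ * ((a + 1 / 2) * (A⁻¹ - A'⁻¹) / 2 -
        (D⁻¹ - D'⁻¹) / 4) := by
    simp only [div_eq_mul_inv, mul_inv]; ring
  rw [e]
  have b1 : |D⁻¹ - D'⁻¹| ≤ L / κ / κ ^ 2 * |s - t| := by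
    calc _ ≤ |D - D'| / κ ^ 2 := h3
      _ ≤ (L * (|s - t| / κ)) / κ ^ 2 := by
          gcongr
          exact h1.trans (by gcongr)
      _ = _ := by ring
  have b2 : |A⁻¹ - A'⁻¹| ≤ L' / κ / κ ^ 2 * |s - t| := by
    calc _ ≤ |A - A'| / κ ^ 2 := h4
      _ ≤ (L' * (|s - t| / κ)) / κ ^ 2 := by
          gcongr
          exact h1'.trans (by gcongr)
      _ = _ := by ring
  calc _ ≤ |a - 2 / β| * |D⁻¹ - D'⁻¹| / 2 + |σ| * (|a + 1 / 2| * |A⁻¹ - A'⁻¹| / 2 +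
        |D⁻¹ - D'⁻¹| / 4) := by
        refine (abs_add_le _ _).trans (add_le_add (le_of_eq ?_) ?_)
        · rw [abs_div, abs_mul, abs_two]
        · rw [abs_mul]
          refine mul_le_mul_of_nonneg_left ((abs_sub _ _).trans (le_of_eq ?_)) (abs_nonneg _)
          rw [abs_div, abs_mul, abs_two, abs_div, abs_of_pos (by norm_num : (0 : ℝ) < 4)]
    _ ≤ |a - 2 / β| * (L / κ / κ ^ 2 * |s - t|) / 2 +
        1 * (|a + 1 / 2| * (L' / κ / κ ^ 2 * |s - t|) / 2 + (L / κ / κ ^ 2 * |s - t|) / 4) := by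
        rw [hσ]; gcongr
    _ = _ := by ring

/-- The symmetric part of the correction to `φ²` around the variable with sign `σ`. -/
noncomputable def meanCorr (V : ℝ[X]) (β a σ r : ℝ) : ℝ :=
  (a - 2 / β) / (2 * (derivative (coarsePoly V)).eval r) -
    σ / (4 * (derivative (coarsePoly V)).eval r)

/-- The alternating part of the correction to `φ²` around the variable with sign `σ`. -/
noncomputable def altCorr (V : ℝ[X]) (a σ r : ℝ) : ℝ :=
  σ * (a + 1 / 2) / (2 * (altPoly V).eval r)

/-- The expansion to order `1 / n` of the squares of the fine minimizer around the edge `p`. -/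
noncomputable def localCorr (V : ℝ[X]) (β a σ r : ℝ) (p e : ℤ) : ℝ :=
  1 / (2 * (derivative (coarsePoly V)).eval r) * ((e - p : ℤ) : ℝ) +
    (meanCorr V β a σ r * 1 + altCorr V a σ r * (-1) ^ (e - p))

/-- Three errors add up: that of the square of `modFine` at `l`, the Taylor remainder of `φ²`, and
the variation of `sqCorr`. All are `O(1 / (n * site k))`, since `site k ≤ n` and `site k ≤ (d + 1) *
site l`, with `d` the degree. -/
theorem exists_modFine_expansion (hκ : 0 < κ) (hV : StrongMono V κ) (β a : ℝ) :
    ∃ C : ℝ, 0 < C ∧ ∀ {n : ℕ} (k l : Coord n), |(site l : ℤ) - site k| ≤ V.natDegree →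
      |modFine n V β a l ^ 2 - phi V (time k) ^ 2 -
        localCorr V β a (sgn k) (phi V (time k) ^ 2) (pos k) (pos l) / n| ≤ C / (n * site k) := by
  obtain ⟨C₁, hC₁, h₁⟩ := exists_modFine_bounds hκ hV β a
  obtain ⟨C₂, hC₂, h₂⟩ := exists_phi_sq_taylor hκ hV
  obtain ⟨C₃, hC₃, h₃⟩ := exists_sqCorr_lipschitz hκ hV β a
  set d : ℝ := (V.natDegree : ℝ) with hd
  have hd0 : 0 ≤ d := Nat.cast_nonneg _
  refine ⟨C₁ * (d + 1) + C₂ * d ^ 2 + C₃ * d, by positivity, ?_⟩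
  intro n k l hkl
  have hn : (1 : ℝ) ≤ n := one_le_cast_of_coord k
  have hn0 : (0 : ℝ) < n := by linarith
  have hk : (1 : ℝ) ≤ site k := by exact_mod_cast one_le_site k
  have hl : (1 : ℝ) ≤ site l := by exact_mod_cast one_le_site l
  have hkn : (site k : ℝ) ≤ n := by exact_mod_cast site_le k
  have hkl' : |(site l : ℝ) - site k| ≤ d := by
    rw [hd]
    have : ((|(site l : ℤ) - site k| : ℤ) : ℝ) ≤ ((V.natDegree : ℤ) : ℝ) := by exact_mod_cast hkl
    push_cast at this
    exact this
  have htk : time k ∈ Set.Icc (0 : ℝ) 1 := ⟨(time_pos k).le, time_le_one k⟩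
  have htl : time l ∈ Set.Icc (0 : ℝ) 1 := ⟨(time_pos l).le, time_le_one l⟩
  have hst : time l - time k = (site l - site k) / n := by simp only [time]; ring
  have hD := le_eval_derivative_coarsePoly hV (sq_nonneg (phi V (time k)))
  have hA := le_eval_altPoly hV (sq_nonneg (phi V (time k)))
  have b1 := (h₁ l).2.2.2.1
  have b2 := h₂ _ htl _ htk
  have b3 := h₃ (sgn l) (abs_sgn l) _ htl _ htk
  -- The time difference is `(pos l - pos k) / (2n) + (sgn l - sgn k) / (4n)`. Its part in `sgn l`
  -- cancels the term `-1 / (4 h')` of `sqCorr`, with `h = coarsePoly V`; what depends on `k` alone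
  -- goes into `meanCorr`.
  have key : localCorr V β a (sgn k) (phi V (time k) ^ 2) (pos k) (pos l) / n =
      (time l - time k) / (derivative (coarsePoly V)).eval (phi V (time k) ^ 2) +
        sqCorr V β a (sgn l) (phi V (time k) ^ 2) / n := by
    have e1 : (-1 : ℝ) ^ (pos l - pos k) * sgn k = sgn l := (sgn_eq k l).symm
    simp only [localCorr, meanCorr, altCorr, sqCorr, hst, site_eq]
    push_cast
    set D := (derivative (coarsePoly V)).eval (phi V (time k) ^ 2)
    set A := (altPoly V).eval (phi V (time k) ^ 2)
    have hD0 : D ≠ 0 := by linarith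
    have hA0 : A ≠ 0 := by linarith
    field_simp
    linear_combination (4 * D * (2 * a + 1)) * e1
  rw [key]
  set X := modFine n V β a l ^ 2
  set ρl := phi V (time l) ^ 2
  set ρ := phi V (time k) ^ 2
  set T := (time l - time k) / (derivative (coarsePoly V)).eval ρ
  set Sl := sqCorr V β a (sgn l) ρl
  set S := sqCorr V β a (sgn l) ρ
  have e : X - ρ - (T + S / n) = (X - (ρl + Sl / n)) + (ρl - ρ - T) + (Sl - S) / n := by ring
  rw [e]
  have hnk : 0 < (n : ℝ) * site k := by positivity
  have c1 : |X - (ρl + Sl / n)| ≤ C₁ * (d + 1) / (n * site k) := by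
    refine b1.trans ?_
    rw [div_le_div_iff₀ (by positivity) hnk]
    have : (site k : ℝ) ≤ (d + 1) * site l := by nlinarith [(abs_le.1 hkl').1]
    calc C₁ * (n * site k) ≤ C₁ * (n * ((d + 1) * site l)) := by gcongr
      _ = _ := by ring
  have hinv : 1 / (n : ℝ) ^ 2 ≤ 1 / (n * site k) := by
    rw [sq]; gcongr
  have c2 : |ρl - ρ - T| ≤ C₂ * d ^ 2 / (n * site k) := by
    refine b2.trans ?_
    rw [hst, div_pow]
    have : ((site l : ℝ) - site k) ^ 2 ≤ d ^ 2 := by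
      rw [← sq_abs]; exact pow_le_pow_left₀ (abs_nonneg _) hkl' 2
    calc C₂ * (((site l : ℝ) - site k) ^ 2 / n ^ 2) ≤ C₂ * (d ^ 2 / n ^ 2) := by gcongr
      _ = C₂ * d ^ 2 * (1 / n ^ 2) := by ring
      _ ≤ C₂ * d ^ 2 * (1 / (n * site k)) := by gcongr
      _ = _ := by ring
  have c3 : |(Sl - S) / n| ≤ C₃ * d / (n * site k) := by
    rw [abs_div, abs_of_pos hn0]
    rw [hst, abs_div, abs_of_pos hn0] at b3
    calc |Sl - S| / n ≤ (C₃ * (d / n)) / n := by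
          gcongr
          exact b3.trans (by gcongr)
      _ = C₃ * d * (1 / n ^ 2) := by ring
      _ ≤ C₃ * d * (1 / (n * site k)) := by gcongr
      _ = _ := by ring
  calc _ ≤ |X - (ρl + Sl / n)| + |ρl - ρ - T| + |(Sl - S) / n| :=
        (abs_add_le _ _).trans (add_le_add (abs_add_le _ _) le_rfl)
    _ ≤ C₁ * (d + 1) / (n * site k) + C₂ * d ^ 2 / (n * site k) + C₃ * d / (n * site k) := by
        gcongr
    _ = _ := by ring

end HardEdge

/-! ### The linearized equation at order `1 / n`. -/

namespace HardEdge

theorem exists_pos_eq {n : ℕ} {e : ℤ} (h0 : 0 ≤ e) (h1 : e + 2 ≤ 2 * n) :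
    ∃ l : Coord n, pos l = e := by
  obtain ⟨m, hm | hm⟩ := Int.even_or_odd' e
  · refine ⟨Sum.inl ⟨m.toNat, by omega⟩, ?_⟩
    simp only [pos]
    omega
  · refine ⟨Sum.inr ⟨m.toNat, by omega⟩, ?_⟩
    simp only [pos]
    omega

theorem abs_neg_one_zpow_eq (m : ℤ) : |(-1 : ℝ) ^ m| = 1 := by simp [abs_zpow]

variable {V : ℝ[X]} {κ : ℝ}

theorem abs_meanCorr_le (hκ : 0 < κ) (hV : StrongMono V κ) (β a : ℝ) {σ r : ℝ} (hσ : |σ| = 1)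
    (hr : 0 ≤ r) : |meanCorr V β a σ r| ≤ (|a - 2 / β| + 1) / κ := by
  have h1 := le_eval_derivative_coarsePoly hV hr
  rw [meanCorr]
  refine (abs_sub _ _).trans ?_
  rw [abs_div, abs_div, hσ, abs_of_pos (by linarith : 0 < 2 * (derivative (coarsePoly V)).eval r),
    abs_of_pos (by linarith : 0 < 4 * (derivative (coarsePoly V)).eval r), add_div]
  gcongr <;> linarith

theorem abs_altCorr_le (hκ : 0 < κ) (hV : StrongMono V κ) (a : ℝ) {σ r : ℝ} (hσ : |σ| = 1)
    (hr : 0 ≤ r) : |altCorr V a σ r| ≤ |a + 1 / 2| / κ := by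
  have h1 := le_eval_altPoly hV hr
  rw [altCorr, abs_div, abs_mul, hσ, one_mul,
    abs_of_pos (by linarith : 0 < 2 * (altPoly V).eval r)]
  gcongr
  linarith

theorem abs_localCorr_le (hκ : 0 < κ) (hV : StrongMono V κ) (β a : ℝ) {σ r : ℝ} (hσ : |σ| = 1)
    (hr : 0 ≤ r) {p e : ℤ} {d : ℝ} (he : |((e - p : ℤ) : ℝ)| ≤ d) :
    |localCorr V β a σ r p e| ≤ (d + (|a - 2 / β| + 1) + |a + 1 / 2|) / κ := by
  have h1 := le_eval_derivative_coarsePoly hV hr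
  have h2 := abs_meanCorr_le hκ hV β a hσ hr
  have h3 := abs_altCorr_le hκ hV a hσ hr
  have hd : 0 ≤ d := (abs_nonneg _).trans he
  rw [localCorr, mul_one]
  have h4 : |1 / (2 * (derivative (coarsePoly V)).eval r) * ((e - p : ℤ) : ℝ)| ≤ d / κ := by
    rw [abs_mul, abs_div, abs_one,
      abs_of_pos (by linarith : 0 < 2 * (derivative (coarsePoly V)).eval r)]
    calc _ ≤ 1 / κ * d := by gcongr; linarith
      _ = _ := by ring
  calc _ ≤ |1 / (2 * (derivative (coarsePoly V)).eval r) * ((e - p : ℤ) : ℝ)| +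
        (|meanCorr V β a σ r| + |altCorr V a σ r * (-1) ^ (e - p)|) :=
        (abs_add_le _ _).trans (add_le_add le_rfl (abs_add_le _ _))
    _ = |1 / (2 * (derivative (coarsePoly V)).eval r) * ((e - p : ℤ) : ℝ)| +
        (|meanCorr V β a σ r| + |altCorr V a σ r|) := by
        rw [abs_mul (altCorr V a σ r), abs_neg_one_zpow_eq, mul_one]
    _ ≤ d / κ + ((|a - 2 / β| + 1) / κ + |a + 1 / 2| / κ) := by gcongr
    _ = _ := by ring

theorem dforce_localCorr (V : ℝ[X]) (β a σ r ρ : ℝ) (p : ℤ) :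
    dforce V (fun _ => ρ) (localCorr V β a σ r p) p =
      meanCorr V β a σ r * dforce V (fun _ => ρ) (fun _ => 1) p +
        altCorr V a σ r * dforce V (fun _ => ρ) (fun e => (-1 : ℝ) ^ (e - p)) p := by
  have h : localCorr V β a σ r p = fun e : ℤ =>
      1 / (2 * (derivative (coarsePoly V)).eval r) * ((e - p : ℤ) : ℝ) +
        (meanCorr V β a σ r * 1 + altCorr V a σ r * (-1) ^ (e - p)) := rfl
  rw [h, dforce_add _ _
      (fun e : ℤ => 1 / (2 * (derivative (coarsePoly V)).eval r) * ((e - p : ℤ) : ℝ))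
      (fun e : ℤ => meanCorr V β a σ r * 1 + altCorr V a σ r * (-1) ^ (e - p)),
    dforce_add _ _ (fun _ : ℤ => meanCorr V β a σ r * 1)
      (fun e : ℤ => altCorr V a σ r * (-1) ^ (e - p)),
    dforce_const_mul _ _ (fun e : ℤ => ((e - p : ℤ) : ℝ)), dforce_const_linear,
    dforce_const_mul _ _ (fun _ : ℤ => (1 : ℝ)),
    dforce_const_mul _ _ (fun e : ℤ => (-1 : ℝ) ^ (e - p))]
  ring

/-- The equation satisfied by the corrections of order `1 / n`. -/
theorem localCorr_equation (hκ : 0 < κ) (hV : StrongMono V κ) (β a σ : ℝ) {ρ : ℝ} (hρ : 0 ≤ ρ)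
    (p : ℤ) :
    (meanCorr V β a σ ρ + altCorr V a σ ρ) * force V (fun _ => ρ) p +
      ρ * dforce V (fun _ => ρ) (localCorr V β a σ ρ p) p = (1 + σ) / 2 * a - 1 / β := by
  have h1 := force_const_add V ρ p
  have h2 := force_const_add_alternating V ρ p
  have h3 := le_eval_derivative_coarsePoly hV hρ
  have h4 := le_eval_altPoly hV hρ
  have e : (meanCorr V β a σ ρ + altCorr V a σ ρ) * force V (fun _ => ρ) p +
      ρ * dforce V (fun _ => ρ) (localCorr V β a σ ρ p) p =
      meanCorr V β a σ ρ * (derivative (coarsePoly V)).eval ρ +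
        altCorr V a σ ρ * (altPoly V).eval ρ := by
    rw [dforce_localCorr, ← h1, ← h2]; ring
  rw [e, meanCorr, altCorr]
  have h3' : (derivative (coarsePoly V)).eval ρ ≠ 0 := by linarith
  have h4' : (altPoly V).eval ρ ≠ 0 := by linarith
  rcases eq_or_ne β 0 with rfl | hβ
  · field_simp
    ring
  · field_simp
    ring

end HardEdge

/-! ### The residual of the fine minimizer. -/

namespace HardEdge

/-- A bound for `force`. -/
noncomputable def forceBound (V : ℝ[X]) (M : ℝ) : ℝ :=
  ∑ m ∈ Finset.range V.natDegree, |dcoeff V m| * (1 + M) ^ (2 * m + 1)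

theorem forceBound_nonneg (V : ℝ[X]) {M : ℝ} (hM : 0 ≤ M) : 0 ≤ forceBound V M :=
  Finset.sum_nonneg fun m _ => by positivity

/-- Product of two first-order expansions in `N` with remainders of order `S`. It is applied with `N
= 1 / n` and `S = 1 / (n * site k)`, so the cross term in `N ^ 2` is harmless. -/
theorem abs_mul_sub_le_of_expansion {r x ρ s f g N S A B D K K₁ K₂ : ℝ}
    (hN0 : 0 ≤ N) (hN1 : N ≤ 1) (hN : N ^ 2 ≤ S)
    (hs : |s| ≤ B) (hf : |f| ≤ A) (hg : |g| ≤ D) (hr : |r| ≤ K)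
    (h₁ : |r - (ρ + s * N)| ≤ K₁ * S) (h₂ : |x - (f + g * N)| ≤ K₂ * S) :
    |r * x - (ρ * f + (s * f + ρ * g) * N)| ≤ (K * K₂ + K₁ * (A + D) + B * D) * S := by
  have hK : 0 ≤ K := (abs_nonneg _).trans hr
  have hB : 0 ≤ B := (abs_nonneg _).trans hs
  have hD : 0 ≤ D := (abs_nonneg _).trans hg
  have hKS : 0 ≤ K₁ * S := (abs_nonneg _).trans h₁
  have hgN : |f + g * N| ≤ A + D := by
    refine (abs_add_le _ _).trans ?_
    rw [abs_mul, abs_of_nonneg hN0]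
    nlinarith [abs_nonneg g]
  have e : r * x - (ρ * f + (s * f + ρ * g) * N) =
      r * (x - (f + g * N)) + (r - (ρ + s * N)) * (f + g * N) + s * g * N ^ 2 := by ring
  rw [e]
  calc _ ≤ |r| * |x - (f + g * N)| + |r - (ρ + s * N)| * |f + g * N| + |s| * |g| * N ^ 2 := by
        refine (abs_add_le _ _).trans (add_le_add ((abs_add_le _ _).trans (le_of_eq ?_))
          (le_of_eq ?_))
        · rw [abs_mul, abs_mul]
        · rw [abs_mul, abs_mul, abs_of_nonneg (sq_nonneg N)]
    _ ≤ K * (K₂ * S) + K₁ * S * (A + D) + B * D * S := by gcongr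
    _ = _ := by ring

variable {V : ℝ[X]} {κ : ℝ}

/-- Away from the left end, `modFine` nearly solves the equations of the minimizer. -/
theorem exists_residual_bulk (hκ : 0 < κ) (hV : StrongMono V κ) (β a : ℝ) :
    ∃ C : ℝ, 0 < C ∧ ∀ {n : ℕ} (k : Coord n), V.natDegree < site k → site k + V.natDegree ≤ n →
      |modFine n V β a k ^ 2 * force V (fun e => seq (modFine n V β a) e ^ 2) (pos k) -
        weight β a k| ≤ C / (n * site k) := by
  obtain ⟨C₁, hC₁, h₁⟩ := exists_modFine_bounds hκ hV β a
  obtain ⟨C₂, hC₂, h₂⟩ := exists_modFine_expansion hκ hV β a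
  set d : ℝ := (V.natDegree : ℝ) with hd
  set B := (2 * d + (|a - 2 / β| + 1) + |a + 1 / 2|) / κ with hB
  set D := dforceBound V (1 / κ) with hD
  set A := forceBound V (1 / κ) with hA
  set R := forceRemBound V (1 / κ + (B + C₂)) with hR
  have hκ1 : 0 ≤ 1 / κ := by positivity
  have hB0 : 0 ≤ B := by positivity
  have hD0 : 0 ≤ D := dforceBound_nonneg V hκ1
  have hA0 : 0 ≤ A := forceBound_nonneg V hκ1
  have hR0 : 0 ≤ R := forceRemBound_nonneg V (by positivity)
  refine ⟨C₁ * (R * (B + C₂) ^ 2 + D * C₂) + C₂ * (A + D * B) + B * (D * B) + 1,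
    by positivity, ?_⟩
  intro n k hk hkn
  have hn : (1 : ℝ) ≤ n := one_le_cast_of_coord k
  have hn0 : (0 : ℝ) < n := by linarith
  have hj : (1 : ℝ) ≤ site k := by exact_mod_cast one_le_site k
  have hjn : (site k : ℝ) ≤ n := by exact_mod_cast site_le k
  set ρ := phi V (time k) ^ 2 with hρ
  have hρm := phi_sq_mem hκ hV (time_pos k).le (time_le_one k)
  set σ := sgn k
  have hσ : |σ| = 1 := abs_sgn k
  set L := localCorr V β a σ ρ (pos k) with hL
  set r : ℤ → ℝ := fun e => seq (modFine n V β a) e ^ 2 with hr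
  set S : ℝ := 1 / (n * site k) with hS
  have hS0 : 0 ≤ S := by positivity
  have hN : (1 / n : ℝ) ^ 2 ≤ S := by
    rw [div_pow, one_pow, sq, hS]; gcongr
  have hSN : S ≤ 1 / n := by
    rw [hS]
    gcongr
    nlinarith
  have hN1 : (1 / n : ℝ) ≤ 1 := by rw [div_le_one hn0]; exact hn
  have hwin : ∀ e : ℤ, |e - pos k| < 2 * V.natDegree → |r e - ρ - L e / n| ≤ C₂ * S := by
    intro e he
    -- Both bounds on the index enter here: the whole window of the force lies on the chain, where
    -- the expansion is available.
    have hpk : 2 * (V.natDegree : ℤ) ≤ pos k ∧ pos k + 2 * V.natDegree + 1 ≤ 2 * n := by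
      rcases k with k | k <;> simp only [pos, site] at hk hkn ⊢ <;> omega
    have he' := abs_lt.1 he
    obtain ⟨l, rfl⟩ := exists_pos_eq (n := n) (e := e) (by linarith) (by linarith)
    have := h₂ k l (abs_site_sub_le_of_abs_pos_sub_le he.le)
    simp only [hr, seq_pos]
    rwa [hS, mul_one_div]
  have hLe : ∀ e : ℤ, |e - pos k| < 2 * V.natDegree → |L e| ≤ B := by
    intro e he
    refine abs_localCorr_le hκ hV β a hσ hρm.1 ?_
    have : ((|e - pos k| : ℤ) : ℝ) ≤ ((2 * V.natDegree : ℤ) : ℝ) := by exact_mod_cast he.le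
    push_cast at this ⊢
    exact this
  have hε : ∀ e : ℤ, |e - pos k| < 2 * V.natDegree → |r e - ρ| ≤ (B + C₂) * (1 / n) := by
    intro e he
    have e1 : r e - ρ = (r e - ρ - L e / n) + L e * (1 / n) := by ring
    rw [e1]
    refine (abs_add_le _ _).trans ?_
    rw [abs_mul, abs_of_nonneg (by positivity : (0 : ℝ) ≤ 1 / n)]
    calc _ ≤ C₂ * S + B * (1 / n) := by gcongr; exacts [hwin e he, hLe e he]
      _ ≤ C₂ * (1 / n) + B * (1 / n) := by gcongr
      _ = _ := by ring
  have hself : |pos k - pos k| < 2 * (V.natDegree : ℤ) := by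
    have := natDegree_pos_of_strongMono hκ hV
    rw [sub_self, abs_zero]; omega
  have hp : L (pos k) = meanCorr V β a σ ρ + altCorr V a σ ρ := by
    simp [hL, localCorr]
  have hρabs : ∀ e : ℤ, |e - pos k| < 2 * V.natDegree → |ρ| ≤ 1 / κ := fun e _ => by
    rw [abs_of_nonneg hρm.1]; exact hρm.2
  have hforce : |force V r (pos k) - (force V (fun _ => ρ) (pos k) +
      dforce V (fun _ => ρ) L (pos k) * (1 / n))| ≤ (R * (B + C₂) ^ 2 + D * C₂) * S := by
    have q1 := abs_force_sub_sub_le (V := V) (r := fun _ => ρ) (ε := fun e => r e - ρ) (p := pos k)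
      (N := 1 / κ + (B + C₂)) (η := (B + C₂) * (1 / n)) hκ1 (by positivity)
      (by
        have : (B + C₂) * (1 / n) ≤ (B + C₂) * 1 := by gcongr
        linarith) hρabs hε
    have q2 := abs_dforce_le (V := V) (r := fun _ => ρ) (ε := fun e => r e - ρ - L e / n)
      (p := pos k) (η := C₂ * S) hκ1 (by positivity) hρabs hwin
    have e1 : (fun e => ρ + (r e - ρ)) = r := by funext e; ring
    have e2 : (fun e => r e - ρ) = fun e => (r e - ρ - L e / n) + (1 / n) * L e := by
      funext e; ring
    rw [e1, e2, dforce_add _ _ (fun e => r e - ρ - L e / n) (fun e => (1 / n) * L e),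
      dforce_const_mul] at q1
    set X := dforce V (fun _ => ρ) (fun e => r e - ρ - L e / n) (pos k)
    set Y := dforce V (fun _ => ρ) L (pos k)
    set F := force V (fun _ => ρ) (pos k)
    set G := force V r (pos k)
    have e3 : G - (F + Y * (1 / n)) = (G - F - (X + 1 / n * Y)) + X := by ring
    rw [e3]
    calc _ ≤ R * ((B + C₂) * (1 / n)) ^ 2 + D * (C₂ * S) :=
          (abs_add_le _ _).trans (add_le_add q1 q2)
      _ = R * (B + C₂) ^ 2 * (1 / n) ^ 2 + D * C₂ * S := by ring
      _ ≤ R * (B + C₂) ^ 2 * S + D * C₂ * S := by gcongr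
      _ = _ := by ring
  have hsq : |modFine n V β a k ^ 2| ≤ C₁ := by
    rw [abs_of_nonneg (sq_nonneg _)]
    refine (h₁ k).2.2.1.trans ?_
    have := time_le_one k
    nlinarith
  have hmain := abs_mul_sub_le_of_expansion (r := modFine n V β a k ^ 2) (ρ := ρ)
    (s := L (pos k)) (by positivity : (0 : ℝ) ≤ 1 / n) hN1 hN (hLe _ hself)
    (abs_force_le hκ1 hρabs) (abs_dforce_le hκ1 hB0 hρabs hLe) hsq
    (by
      have := hwin _ hself
      simp only [hr, seq_pos] at this
      rwa [show modFine n V β a k ^ 2 - (ρ + L (pos k) * (1 / n)) =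
        modFine n V β a k ^ 2 - ρ - L (pos k) / n by ring]) hforce
  -- Order zero gives `time k` by the definition of `φ`, and order `1 / n` gives the rest of the
  -- weight. Only the remainders survive.
  rw [hp, localCorr_equation hκ hV β a σ hρm.1, mul_force_const,
    (phi_spec hκ hV (time_pos k).le).2] at hmain
  rw [weight_eq, div_eq_mul_one_div _ (n : ℝ), div_eq_mul_one_div _ ((n : ℝ) * site k)]
  refine hmain.trans ?_
  refine mul_le_mul_of_nonneg_right ?_ hS0
  exact (le_add_of_nonneg_right zero_le_one)

theorem exists_residual (hκ : 0 < κ) (hV : StrongMono V κ) (β a : ℝ) :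
    ∃ C : ℝ, 0 < C ∧ ∀ {n : ℕ} (k : Coord n), site k + V.natDegree ≤ n →
      |modFine n V β a k ^ 2 * force V (fun e => seq (modFine n V β a) e ^ 2) (pos k) -
        weight β a k| ≤ C / (n * site k) := by
  obtain ⟨C₁, hC₁, h₁⟩ := exists_modFine_bounds hκ hV β a
  obtain ⟨C₂, hC₂, h₂⟩ := exists_residual_bulk hκ hV β a
  set d : ℝ := (V.natDegree : ℝ) with hd
  set A := forceBound V C₁ with hA
  have hA0 : 0 ≤ A := forceBound_nonneg V hC₁.le
  set K := C₁ * A + 1 + |a| + |1 / β| with hK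
  have hK0 : 0 < K := by positivity
  refine ⟨C₂ + K * d ^ 2, by positivity, ?_⟩
  intro n k hkn
  have hn : (1 : ℝ) ≤ n := one_le_cast_of_coord k
  have hn0 : (0 : ℝ) < n := by linarith
  have hj : (1 : ℝ) ≤ site k := by exact_mod_cast one_le_site k
  rcases lt_or_ge V.natDegree (site k) with hk | hk
  · refine (h₂ k hk hkn).trans ?_
    gcongr
    nlinarith [mul_nonneg hK0.le (sq_nonneg d)]
  -- Among the first `d` indices the product and the weight are each `O(1 / n)`, which is as good as
  -- `1 / (n * site k)` up to a constant; no cancellation is needed.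
  · have hjd : (site k : ℝ) ≤ d := by rw [hd]; exact_mod_cast hk
    have hsq : ∀ e, |seq (modFine n V β a) e ^ 2| ≤ C₁ := by
      intro e
      rw [abs_of_nonneg (sq_nonneg _)]
      by_cases he : ∃ l : Coord n, pos l = e
      · obtain ⟨l, rfl⟩ := he
        rw [seq_pos]
        refine (h₁ l).2.2.1.trans ?_
        have := time_le_one l
        nlinarith
      · rw [seq_eq_zero _ fun l hl => he ⟨l, hl⟩]
        simpa using hC₁.le
    have hf := abs_force_le (V := V) (p := pos k) hC₁.le fun e _ => hsq e
    have hF2 := (h₁ k).2.2.1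
    have ht := time_pos k
    have hs : |(1 + sgn k) / 2 * a| ≤ |a| := by
      rcases k with k | k <;> simp [sgn]
    have hw : |weight β a k| ≤ (site k + |a| + |1 / β|) / n := by
      rw [weight_eq]
      refine (abs_add_le _ _).trans ?_
      rw [abs_of_pos ht, abs_div, abs_of_pos hn0, time, ← add_div, add_assoc]
      gcongr
      exact (abs_sub _ _).trans (by gcongr)
    have ha0 := abs_nonneg a
    have hb0 := abs_nonneg (1 / β)
    calc _ ≤ modFine n V β a k ^ 2 * |force V (fun e => seq (modFine n V β a) e ^ 2) (pos k)| +
          |weight β a k| := by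
          refine (abs_sub _ _).trans (add_le_add (le_of_eq ?_) le_rfl)
          rw [abs_mul, abs_of_nonneg (sq_nonneg _)]
      _ ≤ C₁ * time k * A + (site k + |a| + |1 / β|) / n := by
          gcongr
          exact hf
      _ = (C₁ * A * site k + site k * 1 + |a| + |1 / β|) / n := by rw [time]; ring
      _ ≤ (C₁ * A * d + d * 1 + |a| * d + |1 / β| * d) / n := by
          have : (1 : ℝ) ≤ d := hj.trans hjd
          gcongr
          · exact le_mul_of_one_le_right ha0 this
          · exact le_mul_of_one_le_right hb0 this
      _ = K * d / n := by rw [hK]; ring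
      _ ≤ (C₂ + K * d ^ 2) / (n * site k) := by
          rw [div_le_div_iff₀ hn0 (by positivity)]
          calc K * d * (n * site k) ≤ K * d * (n * d) := by gcongr
            _ = (K * d ^ 2) * n := by ring
            _ ≤ (C₂ + K * d ^ 2) * n := by
                gcongr
                linarith

end HardEdge

/-! ### Approximation of conditional minimizers by the fine minimizer. -/

namespace HardEdge

theorem site_mul_sqrt_time {n : ℕ} (k : Coord n) :
    n * site k * Real.sqrt (time k) = Real.sqrt (n * (site k : ℝ) ^ 3) := by
  have hn : (0 : ℝ) < n := zero_lt_one.trans_le (one_le_cast_of_coord k)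
  have h : (n : ℝ) * (site k : ℝ) ^ 3 = (n * site k) ^ 2 * time k := by
    rw [time]; field_simp
  rw [h, Real.sqrt_mul (sq_nonneg _), Real.sqrt_sq (by positivity)]

/-- Compares the error at a boundary index `j ≥ i₀ - d` with the one at `i₀`, using `i₀ ≤ (d + 1) *
j`. -/
theorem inv_sqrt_mul_cube_le {n i j m : ℝ} (hn : 0 < n) (hi : 0 < i) (hj : 0 < j) (hm : 1 ≤ m)
    (h : i ≤ m * j) : 1 / Real.sqrt (n * j ^ 3) ≤ m ^ 2 * (1 / Real.sqrt (n * i ^ 3)) := by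
  have h1 : Real.sqrt (n * i ^ 3) ≤ m ^ 2 * Real.sqrt (n * j ^ 3) := by
    rw [Real.sqrt_le_left (by positivity), mul_pow, Real.sq_sqrt (by positivity)]
    calc n * i ^ 3 ≤ n * (m * j) ^ 3 := by gcongr
      _ = m ^ 3 * (n * j ^ 3) := by ring
      _ ≤ m ^ 4 * (n * j ^ 3) := by gcongr; norm_num
      _ = _ := by ring
  rw [mul_one_div, div_le_div_iff₀ (Real.sqrt_pos.2 (by positivity))
    (Real.sqrt_pos.2 (by positivity)), one_mul]
  exact h1

theorem exists_fine_approximation {V : ℝ[X]} {κ : ℝ} (hκ : 0 < κ) (hV : StrongMono V κ) {β : ℝ}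
    (hβ : 1 ≤ β) (a c' : ℝ) : ∃ c₀ : ℝ, 0 < c₀ ∧ ∀ c ≥ c₀, ∀ {n i₀ i₁ : ℕ}, 1 ≤ i₀ → i₀ ≤ i₁ →
      i₁ + V.natDegree ≤ n → ∀ (q : Values n (boundary n V.natDegree i₀ i₁)), ‖q‖ ≤ c' →
      ∀ (u : Values n (Finset.Icc i₀ i₁)), IsCondMinimizer V β a q u → ∀ i,
        deviation u (fine n V β a) i ≤
          c * max (1 / Real.sqrt ((n : ℝ) * (i₀ : ℝ) ^ 3))
            (‖q - restrict (fine n V β a) (boundary n V.natDegree i₀ i₁)‖ *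
              Real.exp (-distBoundary n V.natDegree i₀ i₁ i / c)) := by
  obtain ⟨M, hM, hbound⟩ := exists_minimizer_bound hκ hV hβ a c'
  obtain ⟨C₁, hC₁, h₁⟩ := exists_modFine_bounds hκ hV β a
  obtain ⟨C₂, hC₂, h₂⟩ := exists_residual hκ hV β a
  have hM' : 0 ≤ max M (C₁ + 1) := le_max_of_le_left hM
  obtain ⟨c₀, hc₀, h⟩ := exists_cond_comparison hκ hV hM'
  set m : ℝ := (V.natDegree : ℝ) + 1 with hm
  have hm1 : 1 ≤ m := by rw [hm]; linarith [Nat.cast_nonneg (α := ℝ) V.natDegree]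
  set K := c₀ * (C₂ * C₁) + c₀ * (C₁ * m ^ 2) + C₁ * m ^ 2 + c₀ with hK
  have hK0 : 0 < K := by positivity
  have hKc : c₀ ≤ 2 * K := by
    have : 0 ≤ c₀ * (C₂ * C₁) + c₀ * (C₁ * m ^ 2) + C₁ * m ^ 2 := by positivity
    linarith
  refine ⟨2 * K, by positivity, ?_⟩
  intro c hc n i₀ i₁ hi₀ hi₀₁ hi₁ q hq u hu i
  have hn0 : (0 : ℝ) < n := by
    have : 0 < n := by omega
    exact_mod_cast this
  have hi0 : (0 : ℝ) < i₀ := by exact_mod_cast hi₀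
  have hc0 : 0 < c := by linarith
  set F := modFine n V β a with hF
  set S := 1 / Real.sqrt ((n : ℝ) * (i₀ : ℝ) ^ 3) with hS
  have hS0 : 0 ≤ S := by positivity
  set Q := ‖q - restrict (fine n V β a) (boundary n V.natDegree i₀ i₁)‖ with hQ
  have hsite : ∀ k : Coord n, (0 : ℝ) < site k := fun k => by exact_mod_cast one_le_site k
  have hFfine : ∀ k : Coord n, (i₀ : ℝ) ≤ m * site k → |F k - fine n V β a k| ≤ C₁ * m ^ 2 * S := by
    intro k hk
    have h3 := (h₁ k).2.2.2.2
    rw [site_mul_sqrt_time, div_eq_mul_one_div] at h3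
    refine h3.trans ?_
    rw [mul_assoc]
    exact mul_le_mul_of_nonneg_left (inv_sqrt_mul_cube_le hn0 hi0 (hsite k) hm1 hk) hC₁.le
  have hFM : ∀ k, |F k| ≤ C₁ + 1 := by
    intro k
    have h3 := (h₁ k).1
    have h4 : F k ^ 2 ≤ C₁ := (h₁ k).2.2.1.trans (by nlinarith [time_le_one k])
    rw [abs_of_pos h3]
    nlinarith [sq_nonneg (F k - 1)]
  -- Replacing the fine minimizer by `F` changes the prescribed values on `∂I` by `O(S)` only.
  have hq' : ‖q - restrict F (boundary n V.natDegree i₀ i₁)‖ ≤ Q + C₁ * m ^ 2 * S := by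
    have e : q - restrict F (boundary n V.natDegree i₀ i₁) =
        (q - restrict (fine n V β a) (boundary n V.natDegree i₀ i₁)) -
          (restrict F (boundary n V.natDegree i₀ i₁) -
            restrict (fine n V β a) (boundary n V.natDegree i₀ i₁)) := by abel
    rw [e]
    refine (norm_sub_le _ _).trans (add_le_add le_rfl ?_)
    refine (pi_norm_le_iff_of_nonneg (by positivity)).2 fun k => ?_
    refine hFfine k.1 ?_
    have hk := (Finset.mem_filter.1 k.2).2
    have hk1 : (1 : ℝ) ≤ site k.1 := by exact_mod_cast one_le_site k.1
    have : (i₀ : ℝ) ≤ site k.1 + V.natDegree := by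
      have : i₀ ≤ site k.1 + V.natDegree := by omega
      exact_mod_cast this
    nlinarith [Nat.cast_nonneg (α := ℝ) V.natDegree]
  have hin : ∀ k : Coord n, site k ∈ Finset.Icc i₀ i₁ → (i₀ : ℝ) ≤ site k := fun k hk => by
    exact_mod_cast (Finset.mem_Icc.1 hk).1
  have hcomp := h c₀ le_rfl q (restrict F _) u (restrict F _) (C₂ * C₁ * S) (by positivity)
    (fun k => (hbound.2 q u hq hu k).trans (le_max_left _ _))
    (abs_glue_restrict_le hM' fun k => (hFM k).trans (le_max_right _ _)) fun k hk => ?_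
  · set E := Real.exp (-distBoundary n V.natDegree i₀ i₁ i / c₀) with hE
    have hD0 : 0 ≤ distBoundary n V.natDegree i₀ i₁ i := Metric.infDist_nonneg
    have hE1 : E ≤ 1 := Real.exp_le_one_iff.2 (div_nonpos_of_nonpos_of_nonneg (by linarith) hc₀.le)
    have hEc : E ≤ Real.exp (-distBoundary n V.natDegree i₀ i₁ i / c) := by
      rw [hE, Real.exp_le_exp, neg_div, neg_div, neg_le_neg_iff]
      gcongr
      linarith
    set E' := Real.exp (-distBoundary n V.natDegree i₀ i₁ i / c)
    have hmax : 0 ≤ max S (Q * E') := le_max_of_le_left hS0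
    calc _ ≤ 2 * (K * max S (Q * E')) := deviation_le (by positivity) fun k hk => ?_
      _ = (2 * K) * max S (Q * E') := by ring
      _ ≤ c * max S (Q * E') := by gcongr
    have h3 := hcomp k
    rw [hk] at h3
    have h4 : |u k - F k.1| ≤ c₀ * (C₂ * C₁ * S + (Q + C₁ * m ^ 2 * S) * E) :=
      h3.trans (by gcongr)
    have h5 := hFfine k.1 ((hin k.1 k.2).trans (le_mul_of_one_le_left (hsite _).le hm1))
    have e : u k - fine n V β a k.1 = (u k - F k.1) + (F k.1 - fine n V β a k.1) := by ring
    rw [e]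
    calc _ ≤ c₀ * (C₂ * C₁ * S + (Q + C₁ * m ^ 2 * S) * E) + C₁ * m ^ 2 * S :=
          (abs_add_le _ _).trans (add_le_add h4 h5)
      _ = c₀ * (C₂ * C₁) * S + c₀ * (C₁ * m ^ 2) * (S * E) + C₁ * m ^ 2 * S + c₀ * (Q * E) := by
          ring
      _ ≤ c₀ * (C₂ * C₁) * max S (Q * E') + c₀ * (C₁ * m ^ 2) * max S (Q * E') +
          C₁ * m ^ 2 * max S (Q * E') + c₀ * max S (Q * E') := by
          have g1 : S ≤ max S (Q * E') := le_max_left _ _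
          have g2 : S * E ≤ max S (Q * E') := (mul_le_of_le_one_right hS0 hE1).trans g1
          have g3 : Q * E ≤ max S (Q * E') :=
            (mul_le_mul_of_nonneg_left hEc (norm_nonneg _)).trans (le_max_right _ _)
          gcongr
      _ = _ := by rw [hK]; ring
  · have hcrit := hu.isCritical hk
    rw [grad_glue_restrict V F hk, glue_of_mem (restrict F _) _ hk]
    change (grad V (glue q u) k - grad V F k) * (glue q u k - F k) ≤
      C₂ * C₁ * S * |glue q u k - F k|
    have hFk := (h₁ k).1
    -- `weight / F` is the gradient for which `F` would solve its equation exactly, so the sign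
    -- argument for two solutions applies. The remaining difference is the residual divided by `F`.
    have h3 : (grad V (glue q u) k - weight β a k / F k) * (glue q u k - F k) ≤ 0 :=
      sub_mul_sub_nonpos hcrit.2.1 hFk.le hcrit.2.2.1 (div_nonneg hcrit.1 hFk.le)
        (hcrit.2.2.2.trans (mul_div_cancel₀ _ hFk.ne').symm)
    have h4 : |weight β a k / F k - grad V F k| ≤ C₂ * C₁ * S := by
      have h5 := h₂ k (by have := (Finset.mem_Icc.1 hk).2; omega)
      have e : weight β a k / F k - grad V F k =
          -((F k ^ 2 * force V (fun e => seq F e ^ 2) (pos k) - weight β a k) / F k) := by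
        rw [grad]; field_simp; ring
      rw [e, abs_neg, abs_div, abs_of_pos hFk, div_le_iff₀ hFk]
      refine h5.trans ?_
      have h6 : 1 / Real.sqrt (n * (site k : ℝ) ^ 3) ≤ S := by
        have := inv_sqrt_mul_cube_le hn0 hi0 (hsite k) le_rfl
          ((hin k hk).trans (le_of_eq (one_mul _).symm))
        rwa [one_pow, one_mul] at this
      rw [← site_mul_sqrt_time] at h6
      have ht : 0 < Real.sqrt (time k) := Real.sqrt_pos.2 (time_pos k)
      have hsk := hsite k
      -- Division by `F`, which is at least `√t / C₁`, turns the residual `1 / (n i)` into `1 / √(n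
      -- i³)`.
      calc C₂ / (n * site k) =
            C₂ * Real.sqrt (time k) * (1 / (n * site k * Real.sqrt (time k))) := by
            field_simp
        _ ≤ C₂ * (C₁ * F k) * S := by
            gcongr
            exact (h₁ k).2.1
        _ = _ := by ring
    calc _ = (grad V (glue q u) k - weight β a k / F k) * (glue q u k - F k) +
          (weight β a k / F k - grad V F k) * (glue q u k - F k) := by ring
      _ ≤ 0 + |weight β a k / F k - grad V F k| * |glue q u k - F k| := by
          refine add_le_add h3 ?_
          rw [← abs_mul]; exact le_abs_self _
      _ ≤ _ := by
          rw [zero_add]; gcongr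

end HardEdge

theorem mainTheorem6 (V : Polynomial ℝ)
    (hV : ∃ κ : ℝ, 0 < κ ∧ StrongConvexOn Set.univ κ (fun x : ℝ => V.eval (x ^ 2)))
    (β a : ℝ) (hβ : 1 ≤ β) (ha : -1 < a) (c' : ℝ) :
    ∃ c : ℝ, 0 < c ∧
      ∀ (n i₀ i₁ : ℕ), 1 ≤ i₀ → i₀ ≤ i₁ → i₁ ≤ n →
      ∀ q : HardEdge.Values n (HardEdge.boundary n V.natDegree i₀ i₁), ‖q‖ ≤ c' →
        (0 ≤ 1 + a - 1 / β →
          ∃! z : HardEdge.Config n, HardEdge.IsMinimizer V β a z) ∧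
        (0 ≤ 1 + a - 1 / β ∨ 2 ≤ i₀ →
          ∃! u : HardEdge.Values n (Finset.Icc i₀ i₁), HardEdge.IsCondMinimizer V β a q u) ∧
        (∀ (z : HardEdge.Config n) (u : HardEdge.Values n (Finset.Icc i₀ i₁)),
          HardEdge.IsMinimizer V β a z → HardEdge.IsCondMinimizer V β a q u →
          ∀ i ∈ Finset.Icc i₀ i₁,
            HardEdge.deviation u z i ≤
              c * ‖q - HardEdge.restrict z (HardEdge.boundary n V.natDegree i₀ i₁)‖ *
                Real.exp (-HardEdge.distBoundary n V.natDegree i₀ i₁ i / c)) ∧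
        (i₁ + V.natDegree ≤ n →
          ∀ u : HardEdge.Values n (Finset.Icc i₀ i₁), HardEdge.IsCondMinimizer V β a q u →
          ∀ i ∈ Finset.Icc i₀ i₁,
            HardEdge.deviation u (HardEdge.fine n V β a) i ≤
              c * max (1 / Real.sqrt ((n : ℝ) * (i₀ : ℝ) ^ 3))
                (‖q - HardEdge.restrict (HardEdge.fine n V β a)
                    (HardEdge.boundary n V.natDegree i₀ i₁)‖ *
                  Real.exp (-HardEdge.distBoundary n V.natDegree i₀ i₁ i / c))) := by
  obtain ⟨κ, hκ, hconv⟩ := hV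
  have hmono := HardEdge.strongMono_of_strongConvexOn hconv
  obtain ⟨c₁, hc₁, h₁⟩ := HardEdge.exists_decay hκ hmono hβ a c'
  obtain ⟨c₂, hc₂, h₂⟩ := HardEdge.exists_fine_approximation hκ hmono hβ a c'
  -- Each estimate holds for every larger constant, although `c` also occurs in the exponent.
  refine ⟨max c₁ c₂, lt_max_of_lt_left hc₁, ?_⟩
  intro n i₀ i₁ hi₀ hi hi₁ q hq
  refine ⟨HardEdge.existsUnique_isMinimizer hκ hmono hβ ha,
    HardEdge.existsUnique_isCondMinimizer hκ hmono hβ ha, ?_, ?_⟩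
  · exact fun z u hz hu i _ => h₁ _ (le_max_left _ _) q hq z u hz hu i
  · exact fun hn u hu i _ => h₂ _ (le_max_right _ _) hi₀ hi hn q hq u hu i
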